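/- Let $(\mathbb X,\mathcal X)$ be a measurable space, $\mathbb X=\mathbb X_\ell\sqcup\mathbb X_s$ a partition into measurable sets of "large" and "small" objects, $v:\mathbb X\times\mathbb X\to[0,\infty]$ measurable and symmetric, $f(x,y)=e^{-v(x,y)}-1$ (with $e^{-\infty}=0$), and $\mu$ a $\sigma$-finite, possibly complex, measure on $\mathbb X$, i.e. $d\mu=\theta\,d|\mu|$ with $|\mu|$ a $\sigma$-finite measure and $\theta$ measurable, $|\theta|=1$. Let $\varphi^{\mathsf T}(x_1,\dots,x_n)=\sum_{\gamma}\prod_{\{i,j\}\in E(\gamma)}f(x_i,x_j)$, the sum being over connected graphs $\gamma$ on $\{1,\dots,n\}$. Let $\mathbb Y=\bigsqcup_{k\ge1}\mathbb X_s^k$ be the space of clouds, with the complex measure $\nu$ given by $$\int_{\mathbb Y}h\,d\nu=\sum_{k\ge1}\frac1{k!}\int_{\mathbb X_s^k}h(y_1,\dots,y_k)\,\varphi^{\mathsf T}(y_1,\dots,y_k)\,d\mu^k(y_1,\dots,y_k),$$ whose total variation $|\nu|$ has density $\frac1{k!}|\varphi^{\mathsf T}|$ with respect to $|\mu|^k$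 on $\mathbb X_s^k$. For $x\in\mathbb X_\ell$ and $Y=(y_1,\dots,y_k)\in\mathbb Y$ put $\zeta(x,Y)=\prod_{j=1}^k(1+f(x,y_j))-1$, and define the effective activity on $\mathbb X_\ell$ by $d\widehat\mu(x)=\exp\bigl(\int_{\mathbb Y}\zeta(x,Y)\,d\nu(Y)\bigr)d\mu(x)$. For $m,r\ge0$ with $m+r\ge1$ let $\mathcal C^*_{m,r}$ be the set of connected graphs on $\{1,\dots,m+r\}$ with no edge joining two vertices in $\{m+1,\dots,m+r\}$ and in which every vertex in $\{m+1,\dots,m+r\}$ is adjacent to at least two vertices in $\{1,\dots,m\}$, and let $$\varphi^{\mathsf T}_*(x_1,\dots,x_m;Y_1,\dots,Y_r)=\sum_{\gamma\in\mathcal C^*_{m,r}}\ \prod_{\substack{s<t\le m\\ \{s,t\}\in E(\gamma)}}f(x_s,x_t)\prod_{\substack{s\le m,\ k\le r\\ \{s,m+k\}\in E(\gamma)}}\zeta(x_s,Y_k).$$ Assume: 1. For some measurable $c:\mathbb X_s\to[0,\infty)$, $\int_{\mathbb X_s}|f(y,y')|e^{c(y')}d|\mu|(y')\le c(y)$ for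 all $y\in\mathbb X_s$, and $\int_{\mathbb X_s}|f(x,y)|e^{c(y)}d|\mu|(y)<\infty$ for all $x\in\mathbb X_\ell$. 2. $\tilde\zeta:\mathbb X_\ell\times\mathbb Y\to\mathbb R$ is measurable and, for all $k\ge2$, $|\mu|^k$-almost all $(x_1,\dots,x_k)\in\mathbb X_\ell^k$ and $|\nu|$-almost all $Y\in\mathbb Y$, with $P=\prod_{1\le i<j\le k}(1+f(x_i,x_j))$, $$P\prod_{i=1}^k|\zeta(x_i,Y)|\le P\prod_{i=1}^k|\tilde\zeta(x_i,Y)|,\qquad |\zeta(x_1,Y)|\,P\,\Bigl|\prod_{j=2}^k(1+\zeta(x_j,Y))-1\Bigr|\le|\tilde\zeta(x_1,Y)|\,P.$$ 3. $a:\mathbb X_\ell\to[0,\infty)$ and $b:\mathbb Y\to[0,\infty)$ are measurable and, for $|\mu|$-almost all $x\in\mathbb X_\ell$ and $|\nu|$-almost all $Y\in\mathbb Y$, $$\int_{\mathbb Y}|\tilde\zeta(x,Y')|e^{b(Y')}d|\nu|(Y')+\int_{\mathbb X_\ell}|f(x,x')|e^{a(x')}d|\widehat\mu|(x')\le a(x),\qquad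 \int_{\mathbb X_\ell}|\tilde\zeta(x',Y)|e^{a(x')}d|\widehat\mu|(x')\le b(Y).$$ Then for $|\mu|$-almost all $x_1\in\mathbb X_\ell$, $$\sum_{m=2}^\infty\frac1{(m-1)!}\int_{\mathbb X_\ell^{m-1}}\sum_{r=0}^\infty\frac1{r!}\int_{\mathbb Y^r}\bigl|\varphi^{\mathsf T}_*(x_1,\dots,x_m;Y_1,\dots,Y_r)\bigr|\prod_{j=1}^r d|\nu|(Y_j)\prod_{i=2}^m d|\widehat\mu|(x_i)\le e^{a(x_1)}-1,$$ and for $|\nu|$-almost all $Y_1\in\mathbb Y$, $$\sum_{m=2}^\infty\frac1{m!}\int_{\mathbb X_\ell^m}\sum_{r=1}^\infty\frac1{(r-1)!}\int_{\mathbb Y^{r-1}}\bigl|\varphi^{\mathsf T}_*(x_1,\dots,x_m;Y_1,\dots,Y_r)\bigr|\prod_{j=2}^r d|\nu|(Y_j)\prod_{i=1}^m d|\widehat\mu|(x_i)\le e^{b(Y_1)}-1.$$ -/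

import Mathlib

open MeasureTheory
open scoped ENNReal

noncomputable section

namespace BinaryCluster

/-- Mayer's function `f(x,y) = exp(-v(x,y)) - 1`, with `exp(-∞) = 0`, of a pair potential with
values in `[0,∞]`. -/
def mayer {X : Type*} (v : X → X → ℝ≥0∞) (x y : X) : ℝ :=
  if v x y = ∞ then -1 else Real.exp (-(v x y).toReal) - 1

open Classical in
/-- Ursell function `φᵀ(x₁,…,xₙ)`: the sum over connected graphs on the vertices `1,…,n` of the
product of `f(xᵢ,xⱼ)` over the edges `{i,j}`. -/
def ursell {X : Type*} (f : X → X → ℝ) {n : ℕ} (x : Fin n → X) : ℝ :=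
  ∑ γ : SimpleGraph (Fin n) with γ.Connected,
    ∏ p : Fin n × Fin n with p.1 < p.2 ∧ γ.Adj p.1 p.2, f (x p.1) (x p.2)

/-- The space of clouds (chains) `⨆_{k ≥ 1} Sᵏ`; the pair `⟨k, y⟩` is a chain of `k + 1` objects. -/
abbrev Cloud (S : Type*) : Type _ := Σ k : ℕ, (Fin (k + 1) → S)

section Model

variable {X : Type*} [MeasurableSpace X]

/-- The restriction of a measure to a (measurable) subset, as a measure on the subtype. -/
def onSubset (m : Measure X) (A : Set X) : Measure A := m.comap Subtype.val

/-- `ζ(x,(y₁,…,y_k)) = ∏ⱼ (1 + f(x,yⱼ)) - 1`. -/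
def zeta {X : Type*} (f : X → X → ℝ) {Xl Xs : Set X} (x : Xl) (Y : Cloud Xs) : ℝ :=
  ∏ j, (1 + f x (Y.2 j)) - 1

/-- The integral `∫ h dν = ∑_{k ≥ 1} (1/k!) ∫ h(y₁,…,y_k) φᵀ(y₁,…,y_k) μ(dy₁)⋯μ(dy_k)` over the
space of clouds, where the complex measure `μ` is given in polar form `dμ = θ dm` with `m = |μ|`. -/
def cloudIntegral (f : X → X → ℝ) (m : Measure X) (θ : X → ℂ) (Xs : Set X)
    (h : Cloud Xs → ℂ) : ℂ :=
  ∑' k : ℕ, ((k + 1).factorial : ℂ)⁻¹ *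
    ∫ y : Fin (k + 1) → Xs,
      h ⟨k, y⟩ * (ursell f (fun j => (y j : X)) : ℂ) * ∏ j, θ (y j)
      ∂(Measure.pi fun _ => onSubset m Xs)

/-- The total variation `|ν|` of the (complex) measure `ν` on the space of clouds: on chains of
length `k` it has the density `(1/k!) |φᵀ(y₁,…,y_k)|` with respect to `|μ|ᵏ`. -/
def cloudVariation (f : X → X → ℝ) (m : Measure X) (Xs : Set X) : Measure (Cloud Xs) :=
  Measure.sum fun k : ℕ =>
    (((k + 1).factorial : ℝ≥0∞)⁻¹ •
      (Measure.pi fun _ : Fin (k + 1) => onSubset m Xs).withDensity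
        (fun y => ‖ursell f (fun j => (y j : X))‖ₑ)).map (Sigma.mk k)

/-- The total variation `|μ̂|` of the effective activity `dμ̂(x) = exp(∫ ζ(x,Y) dν(Y)) dμ(x)` of the
large objects, where `dμ = θ dm` with `|θ| = 1`. -/
def effVariation (f : X → X → ℝ) (m : Measure X) (θ : X → ℂ) (Xl Xs : Set X) : Measure Xl :=
  (onSubset m Xl).withDensity fun x =>
    ‖Complex.exp (cloudIntegral f m θ Xs fun Y => (zeta f x Y : ℂ))‖ₑ

/-- The small objects form a convergent system: for some `c ≥ 0`,
`∫ |f(y,y')| e^{c(y')} d|μ|(y') ≤ c(y)` for every small `y`, and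
`∫ |f(x,y)| e^{c(y)} d|μ|(y) < ∞` for every large `x` (integrals over the small objects). -/
def SmallCondition (f : X → X → ℝ) (m : Measure X) (Xl Xs : Set X) : Prop :=
  ∃ c : Xs → ℝ, Measurable c ∧ (∀ y, 0 ≤ c y) ∧
    (∀ y : Xs, ∫⁻ y' : Xs, ENNReal.ofReal (|f y y'| * Real.exp (c y')) ∂(onSubset m Xs)
      ≤ ENNReal.ofReal (c y)) ∧
    (∀ x : Xl, ∫⁻ y : Xs, ENNReal.ofReal (|f x y| * Real.exp (c y)) ∂(onSubset m Xs) < ∞)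

/-- `∏_{i<j} (1 + f(xᵢ,xⱼ))`. -/
def boltzmann {X : Type*} (f : X → X → ℝ) {Xl : Set X} {k : ℕ} (x : Fin k → Xl) : ℝ :=
  ∏ p : Fin k × Fin k with p.1 < p.2, (1 + f (x p.1) (x p.2))

/-- The domination conditions on the reduced function `ζ̃`, for `k = n + 2 ≥ 2` large objects. -/
def ReducedZeta (f : X → X → ℝ) (m : Measure X) {Xl Xs : Set X}
    (ζt : Xl → Cloud Xs → ℝ) : Prop :=
  ∀ n : ℕ, ∀ᵐ x : Fin (n + 2) → Xl ∂(Measure.pi fun _ => onSubset m Xl),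
    ∀ᵐ Y ∂(cloudVariation f m Xs),
      boltzmann f x * ∏ i, |zeta f (x i) Y| ≤ boltzmann f x * ∏ i, |ζt (x i) Y| ∧
      |zeta f (x 0) Y| * boltzmann f x * |∏ j : Fin (n + 1), (1 + zeta f (x j.succ) Y) - 1|
        ≤ |ζt (x 0) Y| * boltzmann f x

end Model

/-- Graphs on `m` stars (`Sum.inl`) and `r` clouds (`Sum.inr`) without edges between clouds and such
that every cloud is adjacent to at least two stars. -/
structure IsStarCloudGraph {m r : ℕ} (γ : SimpleGraph (Fin m ⊕ Fin r)) : Prop where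
  no_cloud_edge : ∀ k l : Fin r, ¬ γ.Adj (Sum.inr k) (Sum.inr l)
  two_stars : ∀ k : Fin r, ∃ s t : Fin m, s ≠ t ∧
    γ.Adj (Sum.inl s) (Sum.inr k) ∧ γ.Adj (Sum.inl t) (Sum.inr k)

open Classical in
/-- The weight of a graph: the product of `f` over star-star edges and of `ζ` over star-cloud
edges. -/
def graphWeight {X : Type*} (f : X → X → ℝ) {Xl Xs : Set X} {m r : ℕ}
    (γ : SimpleGraph (Fin m ⊕ Fin r)) (x : Fin m → Xl) (Y : Fin r → Cloud Xs) : ℝ :=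
  (∏ p : Fin m × Fin m with p.1 < p.2 ∧ γ.Adj (Sum.inl p.1) (Sum.inl p.2),
      f (x p.1) (x p.2)) *
    ∏ p : Fin m × Fin r with γ.Adj (Sum.inl p.1) (Sum.inr p.2), zeta f (x p.1) (Y p.2)

open Classical in
/-- The modified Ursell function `φ*ᵀ(x₁,…,x_m; Y₁,…,Y_r)`. -/
def ursellStar {X : Type*} (f : X → X → ℝ) {Xl Xs : Set X} {m r : ℕ}
    (x : Fin m → Xl) (Y : Fin r → Cloud Xs) : ℝ :=
  ∑ γ : SimpleGraph (Fin m ⊕ Fin r) with IsStarCloudGraph γ ∧ γ.Connected, graphWeight f γ x Y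

end BinaryCluster

end

/-! A star-cloud graph is read as a hypergraph on the large objects ("stars"): a star-star edge is a
pair, and a cloud is the set of its neighbours. The graph is connected iff these hyperedges connect
all stars to a chosen root (`connected_iff_linked`). The modified Ursell function thus becomes a
`linkedSum`, a sum over choices of hyperedges in which the hyperedges can be treated one at a time.

Roots are removed one by one. Let `i` be a root, `I` the other roots and `B` the unexplored stars. A
cloud adjacent to `i` joins it to some `T ⊆ B` and to some subset of `I`. That subset has no
influence on what remains to be connected, so it is summed over before absolute values are taken.
This gives `z i * ∏_T z t * (∏_I (1 + z s) - 1_{T = ∅})` (`linkedSum_cloud`). The first condition on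
`ζ̃` bounds it for `T ≠ ∅`, the second for `T = ∅`. These conditions are informative only for stars
that do not exclude each other, but if two roots do, their optional edge contributes `1 + f = 0` and
the whole sum vanishes (`linkedSum_eq_zero_of_edge`). Edges from `i` to other roots give factors `1
+ f ∈ [0,1]`, edges from `i` to `B` create new roots, and then `i` is dropped. Iterating this and
integrating out the clouds bounds the modulus by `branchingWeight` (`listIntegral_forestSum_le`).

When the stars are integrated, sums over sublists become iterated integrals (`listIntegral_splits`)
and hence exponentials. With `A = e^a` and `B = e^b`, hypothesis 3 gives `exp(∫ ζ̃ e^b) exp(∫ |f|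
e^a) ≤ e^a` and `exp(∫ ζ̃ e^a) ≤ e^b`, and induction gives a bound by `∏ A` that is uniform in the
number of steps (`listIntegral_branchingWeight_le`). The term of the bare root equals 1 and is
subtracted. For a root cloud, its neighbours serve as the initial roots
(`linkedSum_singleton_cons`). Kernels are cut off outside sets of full measure, so that the
almost-everywhere hypotheses hold at every point. -/

noncomputable section

namespace BinaryCluster

universe u

/-! ### Splittings of lists and measurability of functions of lists -/

/-- All ways of splitting a list into a sublist and its complement. -/
def splits {α : Type*} : List α → List (List α × List α)
  | [] => [([], [])]
  | a :: l => (splits l).map (fun q => (a :: q.1, q.2)) ++ (splits l).map (fun q => (q.1, a :: q.2))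

theorem splits_map {α β : Type*} (φ : α → β) (l : List α) :
    splits (l.map φ) = (splits l).map (fun q => (q.1.map φ, q.2.map φ)) := by
  induction l with
  | nil => rfl
  | cons a l ih => simp [splits, ih, Function.comp_def]

theorem perm_of_mem_splits {α : Type*} {l : List α} :
    ∀ {q : List α × List α}, q ∈ splits l → (q.1 ++ q.2).Perm l := by
  induction l with
  | nil => intro q hq; simp [splits] at hq; subst hq; simp
  | cons a l ih =>
    intro q hq
    simp only [splits, List.mem_append, List.mem_map] at hq
    rcases hq with ⟨r, hr, rfl⟩ | ⟨r, hr, rfl⟩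
    · simpa using ih hr
    · exact List.perm_middle.trans ((ih hr).cons a)

section ListMeasurable

variable {α : Type u} [MeasurableSpace α]

/-- Measurability of a function of two lists: the function becomes measurable when the entries of
the lists are measurable functions of a parameter. -/
def ListMeasurable₂ (F : List α → List α → ℝ≥0∞) : Prop :=
  ∀ (γ : Type u) [MeasurableSpace γ] (P Q : List {g : γ → α // Measurable g}),
    Measurable fun c => F (P.map fun g => g.1 c) (Q.map fun g => g.1 c)

theorem ListMeasurable₂.cons_left {F : List α → List α → ℝ≥0∞} (hF : ListMeasurable₂ F) (y : α) :
    ListMeasurable₂ fun P Q => F (y :: P) Q := by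
  intro γ _ P Q
  exact hF γ (⟨fun _ => y, measurable_const⟩ :: P) Q

theorem ListMeasurable₂.cons_right {F : List α → List α → ℝ≥0∞} (hF : ListMeasurable₂ F) (y : α) :
    ListMeasurable₂ fun P Q => F P (y :: Q) := by
  intro γ _ P Q
  exact hF γ P (⟨fun _ => y, measurable_const⟩ :: Q)

theorem ListMeasurable₂.ofFn {F : List α → List α → ℝ≥0∞} (hF : ListMeasurable₂ F) {γ : Type u}
    [MeasurableSpace γ] {n k : ℕ} {g : γ → Fin n → α} {h : γ → Fin k → α}
    (hg : Measurable g) (hh : Measurable h) :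
    Measurable fun c => F (List.ofFn (g c)) (List.ofFn (h c)) := by
  have := hF γ (List.ofFn fun i => ⟨fun c => g c i, (measurable_pi_apply i).comp hg⟩)
    (List.ofFn fun i => ⟨fun c => h c i, (measurable_pi_apply i).comp hh⟩)
  simpa [List.map_ofFn, Function.comp_def] using this

theorem measurable_finCons {γ : Type*} [MeasurableSpace γ] {k : ℕ} {g : γ → α}
    {h : γ → Fin k → α} (hg : Measurable g) (hh : Measurable h) :
    Measurable fun c => (Fin.cons (g c) (h c) : Fin (k + 1) → α) := by
  refine measurable_pi_lambda _ fun i => ?_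
  refine Fin.cases ?_ (fun i => ?_) i
  · simpa using hg
  · simpa using measurable_pi_iff.1 hh i

theorem ListMeasurable₂.ofFn_cons_left {F : List α → List α → ℝ≥0∞} (hF : ListMeasurable₂ F)
    {γ : Type u} [MeasurableSpace γ] {k j : ℕ} {g : γ → α} {h : γ → Fin k → α}
    {h' : γ → Fin j → α} (hg : Measurable g) (hh : Measurable h) (hh' : Measurable h') :
    Measurable fun c => F (g c :: List.ofFn (h c)) (List.ofFn (h' c)) := by
  simpa [List.ofFn_succ] using hF.ofFn (measurable_finCons hg hh) hh'

theorem ListMeasurable₂.ofFn_cons_right {F : List α → List α → ℝ≥0∞} (hF : ListMeasurable₂ F)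
    {γ : Type u} [MeasurableSpace γ] {k j : ℕ} {g : γ → α} {h : γ → Fin k → α}
    {h' : γ → Fin j → α} (hg : Measurable g) (hh : Measurable h) (hh' : Measurable h') :
    Measurable fun c => F (List.ofFn (h c)) (g c :: List.ofFn (h' c)) := by
  simpa [List.ofFn_succ] using hF.ofFn hh (measurable_finCons hg hh')

/-- Functions of one list are treated as functions of two lists that ignore the second. Applied with
an empty second tuple, this gives measurability in the second list while the first is frozen. -/
theorem ListMeasurable₂.diag {F : List α → List α → ℝ≥0∞} (hF : ListMeasurable₂ F) (P₀ : List α) :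
    ListMeasurable₂ fun P _ => F P₀ P := by
  intro γ _ P Q
  have := hF γ (P₀.map fun y => ⟨fun _ => y, measurable_const⟩) P
  simpa [Function.comp_def] using this

theorem measurable_list_sum {γ δ : Type*} [MeasurableSpace γ] (l : List δ) {f : δ → γ → ℝ≥0∞}
    (hf : ∀ d ∈ l, Measurable (f d)) : Measurable fun c => (l.map fun d => f d c).sum := by
  induction l with
  | nil => simp
  | cons a l ih =>
    simp only [List.map_cons, List.sum_cons]
    exact (hf a (by simp)).add (ih fun d hd => hf d (by simp [hd]))

theorem measurable_list_prod {γ δ : Type*} [MeasurableSpace γ] (l : List δ) {f : δ → γ → ℝ≥0∞}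
    (hf : ∀ d ∈ l, Measurable (f d)) : Measurable fun c => (l.map fun d => f d c).prod := by
  induction l with
  | nil => simp
  | cons a l ih =>
    simp only [List.map_cons, List.prod_cons]
    exact (hf a (by simp)).mul (ih fun d hd => hf d (by simp [hd]))

theorem ListMeasurable₂.splits {F : List α → List α → ℝ≥0∞} (hF : ListMeasurable₂ F) :
    ListMeasurable₂ fun P _ => ((splits P).map fun q => F q.1 q.2).sum := by
  intro γ _ P Q
  simp only [splits_map, List.map_map, Function.comp_def]
  exact measurable_list_sum _ fun d _ => hF γ d.1 d.2

end ListMeasurable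

/-! ### Integrals over finite configurations and their generating series -/

section TupleIntegral

variable {α : Type u} [MeasurableSpace α] (μ : Measure α)

/-- The integral of a function of lists over all lists of length `n`. -/
def tupleIntegral (n : ℕ) (F : List α → ℝ≥0∞) : ℝ≥0∞ :=
  ∫⁻ x : Fin n → α, F (List.ofFn x) ∂Measure.pi fun _ => μ

/-- `∑ₙ 1/n! ∫ F(x₁,…,xₙ) μ(dx₁)⋯μ(dxₙ)`. -/
def listIntegral (F : List α → ℝ≥0∞) : ℝ≥0∞ :=
  ∑' n : ℕ, (n.factorial : ℝ≥0∞)⁻¹ * tupleIntegral μ n F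

@[simp] theorem tupleIntegral_zero (F : List α → ℝ≥0∞) : tupleIntegral μ 0 F = F [] := by
  simp [tupleIntegral]

theorem tupleIntegral_add {n : ℕ} {F G : List α → ℝ≥0∞}
    (hF : Measurable fun x : Fin n → α => F (List.ofFn x)) :
    tupleIntegral μ n (fun l => F l + G l) = tupleIntegral μ n F + tupleIntegral μ n G :=
  lintegral_add_left hF _

variable [SigmaFinite μ]

theorem tupleIntegral_succ {n : ℕ} {F : List α → ℝ≥0∞}
    (hF : Measurable fun x : α × (Fin n → α) => F (x.1 :: List.ofFn x.2)) :
    tupleIntegral μ (n + 1) F = ∫⁻ y, tupleIntegral μ n (fun l => F (y :: l)) ∂μ := by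
  have e := (measurePreserving_piFinSuccAbove (fun _ : Fin (n + 1) => μ) 0).symm
  unfold tupleIntegral
  rw [← e.lintegral_comp_emb (MeasurableEquiv.measurableEmbedding _), lintegral_prod]
  · simp [MeasurableEquiv.piFinSuccAbove]
  · simpa [MeasurableEquiv.piFinSuccAbove, List.ofFn_cons] using hF.aemeasurable

theorem measurable_tupleIntegral {γ : Type*} [MeasurableSpace γ] {n : ℕ}
    {F : γ → List α → ℝ≥0∞}
    (hF : Measurable fun x : γ × (Fin n → α) => F x.1 (List.ofFn x.2)) :
    Measurable fun c => tupleIntegral μ n (F c) :=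
  hF.lintegral_prod_right'

theorem tupleIntegral_swap {γ : Type*} [MeasurableSpace γ] (ρ : Measure γ) [SFinite ρ] {n : ℕ}
    {F : γ → List α → ℝ≥0∞}
    (hF : Measurable fun x : γ × (Fin n → α) => F x.1 (List.ofFn x.2)) :
    ∫⁻ c, tupleIntegral μ n (F c) ∂ρ = tupleIntegral μ n (fun l => ∫⁻ c, F c l ∂ρ) :=
  lintegral_lintegral_swap hF.aemeasurable

end TupleIntegral

/-- The product rule for exponential generating functions: `(n choose i) / n! = 1 / (i! j!)` for `i
+ j = n`. -/
theorem tsum_factorial_antidiagonal (a : ℕ → ℕ → ℝ≥0∞) :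
    ∑' n : ℕ, (n.factorial : ℝ≥0∞)⁻¹ *
        ∑ ij ∈ Finset.HasAntidiagonal.antidiagonal n, (n.choose ij.1 : ℝ≥0∞) * a ij.1 ij.2 =
      ∑' i : ℕ, (i.factorial : ℝ≥0∞)⁻¹ * ∑' j : ℕ, (j.factorial : ℝ≥0∞)⁻¹ * a i j := by
  have h1 : ∀ n : ℕ, (n.factorial : ℝ≥0∞)⁻¹ *
        ∑ ij ∈ Finset.HasAntidiagonal.antidiagonal n, (n.choose ij.1 : ℝ≥0∞) * a ij.1 ij.2 =
      ∑ ij ∈ Finset.HasAntidiagonal.antidiagonal n,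
        (ij.1.factorial : ℝ≥0∞)⁻¹ * ((ij.2.factorial : ℝ≥0∞)⁻¹ * a ij.1 ij.2) := by
    intro n
    rw [Finset.mul_sum]
    refine Finset.sum_congr rfl fun ij hij => ?_
    rw [← mul_assoc, ← mul_assoc]
    congr 1
    obtain ⟨i, j⟩ := ij
    simp only [Finset.HasAntidiagonal.mem_antidiagonal] at hij
    subst hij
    have hn : (((i + j).factorial : ℕ) : ℝ≥0∞) =
        ((i + j).choose i : ℝ≥0∞) * (i.factorial : ℝ≥0∞) * (j.factorial : ℝ≥0∞) := by
      have := Nat.add_choose_mul_factorial_mul_factorial i j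
      rw [← Nat.choose_symm_add] at this
      exact_mod_cast this.symm
    have hc : ((i + j).choose i : ℝ≥0∞) ≠ 0 := by
      exact_mod_cast (Nat.choose_pos (Nat.le_add_right i j)).ne'
    have hi : ((i.factorial : ℕ) : ℝ≥0∞) ≠ 0 := by exact_mod_cast i.factorial_ne_zero
    have hj : ((j.factorial : ℕ) : ℝ≥0∞) ≠ 0 := by exact_mod_cast j.factorial_ne_zero
    have hct : ((i + j).choose i : ℝ≥0∞) ≠ ∞ := ENNReal.natCast_ne_top _
    have hit : ((i.factorial : ℕ) : ℝ≥0∞) ≠ ∞ := ENNReal.natCast_ne_top _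
    have hjt : ((j.factorial : ℕ) : ℝ≥0∞) ≠ ∞ := ENNReal.natCast_ne_top _
    rw [hn, ENNReal.mul_inv (Or.inr hjt) (Or.inr hj), ENNReal.mul_inv (Or.inr hit) (Or.inr hi)]
    calc _ = (((i + j).choose i : ℝ≥0∞)⁻¹ * ((i + j).choose i : ℝ≥0∞)) *
          ((i.factorial : ℝ≥0∞)⁻¹ * (j.factorial : ℝ≥0∞)⁻¹) := by ring
      _ = _ := by rw [ENNReal.inv_mul_cancel hc hct, one_mul]
  simp_rw [h1, ← ENNReal.tsum_mul_left]
  rw [← ENNReal.tsum_prod (f := fun i j : ℕ => (i.factorial : ℝ≥0∞)⁻¹ *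
      ((j.factorial : ℝ≥0∞)⁻¹ * a i j)),
    ← (Finset.HasAntidiagonal.sigmaAntidiagonalEquivProd (A := ℕ)).tsum_eq, ENNReal.tsum_sigma']
  refine tsum_congr fun n => ?_
  rw [tsum_fintype, ← Finset.sum_coe_sort]
  rfl

section TupleIntegral

variable {α : Type u} [MeasurableSpace α] (μ : Measure α)

theorem tupleIntegral_mono {n : ℕ} {F G : List α → ℝ≥0∞} (h : ∀ l, F l ≤ G l) :
    tupleIntegral μ n F ≤ tupleIntegral μ n G :=
  lintegral_mono fun _ => h _

theorem tupleIntegral_const_mul {n : ℕ} (r : ℝ≥0∞) {F : List α → ℝ≥0∞}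
    (hF : Measurable fun x : Fin n → α => F (List.ofFn x)) :
    tupleIntegral μ n (fun l => r * F l) = r * tupleIntegral μ n F :=
  lintegral_const_mul r hF

theorem listIntegral_mono {F G : List α → ℝ≥0∞} (h : ∀ l, F l ≤ G l) :
    listIntegral μ F ≤ listIntegral μ G :=
  ENNReal.tsum_le_tsum fun _ => by gcongr; exact tupleIntegral_mono μ h

theorem listIntegral_const_mul (r : ℝ≥0∞) {F : List α → ℝ≥0∞}
    (hF : ∀ n, Measurable fun x : Fin n → α => F (List.ofFn x)) :
    listIntegral μ (fun l => r * F l) = r * listIntegral μ F := by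
  simp only [listIntegral, tupleIntegral_const_mul μ r (hF _), ← ENNReal.tsum_mul_left]
  exact tsum_congr fun n => by ring

theorem listIntegral_tsum {F : ℕ → List α → ℝ≥0∞}
    (hF : ∀ k n, Measurable fun x : Fin n → α => F k (List.ofFn x)) :
    listIntegral μ (fun l => ∑' k, F k l) = ∑' k, listIntegral μ (F k) := by
  have h : ∀ n, tupleIntegral μ n (fun l => ∑' k, F k l) = ∑' k, tupleIntegral μ n (F k) :=
    fun n => lintegral_tsum fun k => (hF k n).aemeasurable
  simp only [listIntegral, h, ← ENNReal.tsum_mul_left]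
  exact ENNReal.tsum_comm

variable [SigmaFinite μ]

theorem listIntegral_swap {γ : Type*} [MeasurableSpace γ] (ρ : Measure γ) [SFinite ρ]
    {F : γ → List α → ℝ≥0∞}
    (hF : ∀ n, Measurable fun x : γ × (Fin n → α) => F x.1 (List.ofFn x.2)) :
    ∫⁻ c, listIntegral μ (F c) ∂ρ = listIntegral μ (fun l => ∫⁻ c, F c l ∂ρ) := by
  unfold listIntegral
  rw [lintegral_tsum]
  · refine tsum_congr fun n => ?_
    rw [lintegral_const_mul _ (measurable_tupleIntegral μ (hF n)), tupleIntegral_swap μ ρ (hF n)]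
  · exact fun n => ((measurable_tupleIntegral μ (hF n)).const_mul _).aemeasurable

/-- By symmetry of the product measure only the size of the left part matters, and there are `n
choose i` splittings with a left part of size `i`. The induction is Pascal's rule, according to the
side that receives the first entry. -/
theorem tupleIntegral_splits (n : ℕ) : ∀ {G : List α → List α → ℝ≥0∞}, ListMeasurable₂ G →
    tupleIntegral μ n (fun l => ((splits l).map fun q => G q.1 q.2).sum) =
      ∑ ij ∈ Finset.HasAntidiagonal.antidiagonal n, (n.choose ij.1 : ℝ≥0∞) *
        tupleIntegral μ ij.1 (fun P => tupleIntegral μ ij.2 (G P)) := by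
  induction n with
  | zero => intro G hG; simp [splits]
  | succ n ih =>
    intro G hG
    have hsl : Measurable fun x : α × (Fin n → α) =>
        ((splits (List.ofFn x.2)).map fun q => G (x.1 :: q.1) q.2).sum := by
      have e : ∀ x : α × (Fin n → α), List.ofFn x.2 = (List.finRange n).map x.2 :=
        fun x => List.ofFn_eq_map
      simp only [e, splits_map, List.map_map, Function.comp_def]
      refine measurable_list_sum _ fun q _ => ?_
      have := hG (α × (Fin n → α)) (⟨Prod.fst, measurable_fst⟩ ::
        q.1.map fun i => ⟨fun x => x.2 i, by fun_prop⟩) (q.2.map fun i => ⟨fun x => x.2 i, by fun_prop⟩)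
      simpa [Function.comp_def] using this
    have hs : Measurable fun x : α × (Fin n → α) =>
        ((splits (x.1 :: List.ofFn x.2)).map fun q => G q.1 q.2).sum := by
      have := hG.splits.ofFn (γ := α × (Fin n → α)) (measurable_finCons measurable_fst measurable_snd)
        (measurable_snd)
      simpa [List.ofFn_succ] using this
    rw [tupleIntegral_succ μ hs]
    have h1 : ∀ y, tupleIntegral μ n
          (fun l => ((splits (y :: l)).map fun q => G q.1 q.2).sum) =
        ∑ ij ∈ Finset.HasAntidiagonal.antidiagonal n, (n.choose ij.1 : ℝ≥0∞) *
          tupleIntegral μ ij.1 (fun P => tupleIntegral μ ij.2 (G (y :: P))) +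
        ∑ ij ∈ Finset.HasAntidiagonal.antidiagonal n, (n.choose ij.1 : ℝ≥0∞) *
          tupleIntegral μ ij.1 (fun P => tupleIntegral μ ij.2 (fun Q => G P (y :: Q))) := by
      intro y
      rw [← ih (hG.cons_left y), ← ih (hG.cons_right y), ← tupleIntegral_add]
      · simp [splits, Function.comp_def]
      · exact hsl.comp (measurable_const.prodMk measurable_id)
    simp_rw [h1]
    have ml : ∀ i j, Measurable fun x : α × (Fin i → α) =>
        tupleIntegral μ j (G (x.1 :: List.ofFn x.2)) := fun i j =>
      measurable_tupleIntegral μ (hG.ofFn_cons_left (measurable_fst.comp measurable_fst)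
        (measurable_snd.comp measurable_fst) measurable_snd)
    have mr : ∀ i j, Measurable fun x : (α × (Fin i → α)) × (Fin j → α) =>
        G (List.ofFn x.1.2) (x.1.1 :: List.ofFn x.2) := fun i j =>
      (hG.ofFn_cons_right (measurable_fst.comp measurable_fst)
        (measurable_snd.comp measurable_fst) measurable_snd)
    have mr' : ∀ i j, Measurable fun x : α × (Fin i → α) =>
        tupleIntegral μ j (fun Q => G (List.ofFn x.2) (x.1 :: Q)) := fun i j =>
      measurable_tupleIntegral μ (F := fun (x : α × (Fin i → α)) Q =>
        G (List.ofFn x.2) (x.1 :: Q)) (mr i j)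
    have ml2 : ∀ i j, Measurable fun y =>
        tupleIntegral μ i (fun P => tupleIntegral μ j (G (y :: P))) := fun i j =>
      measurable_tupleIntegral μ (F := fun y P => tupleIntegral μ j (G (y :: P))) (ml i j)
    have mr2 : ∀ i j, Measurable fun y =>
        tupleIntegral μ i (fun P => tupleIntegral μ j (fun Q => G P (y :: Q))) := fun i j =>
      measurable_tupleIntegral μ
        (F := fun y P => tupleIntegral μ j (fun Q => G P (y :: Q))) (mr' i j)
    rw [lintegral_add_left (Finset.measurable_fun_sum _ fun ij _ => (ml2 _ _).const_mul _),
      lintegral_finsetSum _ fun ij _ => (ml2 _ _).const_mul _,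
      lintegral_finsetSum _ fun ij _ => (mr2 _ _).const_mul _,
      Finset.sum_antidiagonal_choose_succ_mul
        (fun i j => tupleIntegral μ i (fun P => tupleIntegral μ j (G P))) n, add_comm]
    congr 1
    · refine Finset.sum_congr rfl fun ij _ => ?_
      -- If the first entry goes to the right, its integral is outermost and has to be moved inside
      -- the integral over the left part before it can be merged with the right part.
      rw [lintegral_const_mul _ (mr2 _ _), tupleIntegral_swap μ μ (mr' _ _)]
      congr 1
      unfold tupleIntegral
      refine lintegral_congr fun x => ?_
      exact (tupleIntegral_succ μ (hG.ofFn_cons_right (h := fun _ => x) measurable_fst measurable_const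
        measurable_snd)).symm
    · refine Finset.sum_congr rfl fun ij hij => ?_
      rw [lintegral_const_mul _ (ml2 _ _), tupleIntegral_succ μ (ml _ _),
        Nat.choose_symm_of_eq_add (Finset.HasAntidiagonal.mem_antidiagonal.1 hij).symm]

/-- The mechanism that makes sums over trees factorize: a sum over sublists integrates to two
independent configuration integrals. -/
theorem listIntegral_splits {G : List α → List α → ℝ≥0∞} (hG : ListMeasurable₂ G) :
    listIntegral μ (fun l => ((splits l).map fun q => G q.1 q.2).sum) =
      listIntegral μ (fun P => listIntegral μ (G P)) := by
  have hm : ∀ i j, Measurable fun x : Fin i → α => tupleIntegral μ j (G (List.ofFn x)) :=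
    fun i j => measurable_tupleIntegral μ (hG.ofFn measurable_fst measurable_snd)
  simp only [listIntegral, tupleIntegral_splits μ _ hG]
  rw [tsum_factorial_antidiagonal
    (fun i j => tupleIntegral μ i (fun P => tupleIntegral μ j (G P)))]
  refine tsum_congr fun i => ?_
  congr 1
  have : tupleIntegral μ i (fun P => ∑' j : ℕ, (j.factorial : ℝ≥0∞)⁻¹ * tupleIntegral μ j (G P)) =
      ∑' j : ℕ, tupleIntegral μ i
        (fun P => (j.factorial : ℝ≥0∞)⁻¹ * tupleIntegral μ j (G P)) :=
    lintegral_tsum fun j => ((hm i j).const_mul _).aemeasurable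
  rw [this]
  exact tsum_congr fun j =>
    (tupleIntegral_const_mul μ _ (F := fun P => tupleIntegral μ j (G P)) (hm i j)).symm

theorem tupleIntegral_prod {h : α → ℝ≥0∞} (hh : Measurable h) (n : ℕ) :
    tupleIntegral μ n (fun l => (l.map h).prod) = (∫⁻ x, h x ∂μ) ^ n := by
  induction n with
  | zero => simp
  | succ n ih =>
    rw [tupleIntegral_succ]
    · simp only [List.map_cons, List.prod_cons]
      have : ∀ y, tupleIntegral μ n (fun l => h y * (l.map h).prod) =
          h y * (∫⁻ x, h x ∂μ) ^ n := fun y => by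
        rw [tupleIntegral_const_mul, ih]
        simp only [List.map_ofFn, List.prod_ofFn]
        fun_prop
      simp_rw [this]
      rw [lintegral_mul_const _ hh, pow_succ']
    · simp only [List.map_cons, List.prod_cons, List.map_ofFn, List.prod_ofFn]
      fun_prop

/-- The exponential series in `[0,∞]`. -/
def expSeries (c : ℝ≥0∞) : ℝ≥0∞ := ∑' n : ℕ, (n.factorial : ℝ≥0∞)⁻¹ * c ^ n

theorem listIntegral_prod {h : α → ℝ≥0∞} (hh : Measurable h) :
    listIntegral μ (fun l => (l.map h).prod) = expSeries (∫⁻ x, h x ∂μ) := by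
  simp only [listIntegral, expSeries, tupleIntegral_prod μ hh]

theorem expSeries_mono {c d : ℝ≥0∞} (h : c ≤ d) : expSeries c ≤ expSeries d :=
  ENNReal.tsum_le_tsum fun _ => by gcongr

theorem expSeries_ofReal {r : ℝ} (hr : 0 ≤ r) :
    expSeries (ENNReal.ofReal r) = ENNReal.ofReal (Real.exp r) := by
  rw [Real.exp_eq_exp_ℝ, NormedSpace.exp_eq_tsum_div,
    ENNReal.ofReal_tsum_of_nonneg (fun n => by positivity) (Real.summable_pow_div_factorial r)]
  refine tsum_congr fun n => ?_
  rw [ENNReal.ofReal_div_of_pos (by positivity), ENNReal.ofReal_pow hr, ENNReal.ofReal_natCast,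
    ENNReal.div_eq_inv_mul]

/-- The bound on `c + d` forces both to be finite, which reduces the claim to the functional
equation of the real exponential. -/
theorem expSeries_mul_le {c d : ℝ≥0∞} {r : ℝ} (hr : 0 ≤ r) (h : c + d ≤ ENNReal.ofReal r) :
    expSeries c * expSeries d ≤ ENNReal.ofReal (Real.exp r) := by
  have hc : c ≠ ∞ := ne_top_of_le_ne_top ENNReal.ofReal_ne_top (le_self_add.trans h)
  have hd : d ≠ ∞ := ne_top_of_le_ne_top ENNReal.ofReal_ne_top (le_add_self.trans h)
  lift c to NNReal using hc
  lift d to NNReal using hd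
  have e : ∀ t : NNReal, expSeries t = ENNReal.ofReal (Real.exp t) := fun t => by
    rw [← ENNReal.ofReal_coe_nnreal, expSeries_ofReal t.coe_nonneg]
  rw [e, e, ← ENNReal.ofReal_mul (Real.exp_pos _).le, ← Real.exp_add]
  refine ENNReal.ofReal_le_ofReal (Real.exp_le_exp.2 ?_)
  rw [← ENNReal.coe_add, ← ENNReal.ofReal_coe_nnreal, ENNReal.ofReal_le_ofReal_iff hr] at h
  simpa using h

end TupleIntegral

/-! ### Branching weights -/

section Branching

variable {α β : Type*} [MeasurableSpace β] (ν : Measure β)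

/-- `∑ ∏_{t ∈ T} h(t) F(T ∪ I, B \ T)`, the sum being over the sublists `T` of `B`. -/
def splitSum (h : α → ℝ≥0∞) (F : List α → List α → ℝ≥0∞) (I B : List α) : ℝ≥0∞ :=
  ((splits B).map fun q => (q.1.map h).prod * F (q.1 ++ I) q.2).sum

/-- Attach one cloud to the star `i`, and a set of new stars to this cloud. -/
def cloudOp (z : α → β → ℝ≥0∞) (i : α) (F : List α → List α → ℝ≥0∞) (I B : List α) : ℝ≥0∞ :=
  ∫⁻ Y, z i Y * splitSum (fun t => z t Y) F I B ∂ν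

/-- The weight of the forests of depth at most `q` that explore the stars `B` from the roots `I`:
a star is joined to stars by `p` and to clouds by `z`, a cloud is joined to stars by `z`, and the
clouds are integrated out. -/
def branchingWeight (p : α → α → ℝ≥0∞) (z : α → β → ℝ≥0∞) : ℕ → List α → List α → ℝ≥0∞
  | _, [], B => if B = [] then 1 else 0
  -- One unit of `q` is spent per processed root, and each star is processed at most once, so `q ≥
  -- |I| + |B|` loses nothing.
  | 0, _ :: _, _ => 0
  | q + 1, i :: I, B => ∑' n : ℕ, (n.factorial : ℝ≥0∞)⁻¹ *
      ((cloudOp ν z i)^[n] (splitSum (p i) (branchingWeight p z q))) I B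

theorem branchingWeight_nil (p : α → α → ℝ≥0∞) (z : α → β → ℝ≥0∞) (q : ℕ) (B : List α) :
    branchingWeight ν p z q [] B = if B = [] then 1 else 0 := by
  cases q <;> rfl

variable {ι : Type*}

theorem splitSum_map (φ : ι → α) (h : α → ℝ≥0∞) {F : List α → List α → ℝ≥0∞}
    {F' : List ι → List ι → ℝ≥0∞} (hF : ∀ I B, F' I B = F (I.map φ) (B.map φ)) (I B : List ι) :
    splitSum (fun t => h (φ t)) F' I B = splitSum h F (I.map φ) (B.map φ) := by
  simp [splitSum, splits_map, Function.comp_def, hF]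

/-- Graph estimates are made on distinct vertex labels, integrals on positions in space; `φ` sends
labels to positions. -/
theorem branchingWeight_map (φ : ι → α) (p : α → α → ℝ≥0∞) (z : α → β → ℝ≥0∞) (q : ℕ) :
    ∀ I B : List ι, branchingWeight ν (fun i j => p (φ i) (φ j)) (fun i => z (φ i)) q I B =
      branchingWeight ν p z q (I.map φ) (B.map φ) := by
  induction q with
  | zero => intro I B; cases I <;> simp [branchingWeight]
  | succ q ih =>
    intro I B
    cases I with
    | nil => simp [branchingWeight]
    | cons i I =>
      simp only [branchingWeight, List.map_cons]
      refine tsum_congr fun n => ?_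
      congr 1
      have : ∀ n, ∀ I B : List ι, ((cloudOp ν (fun i => z (φ i)) i)^[n] (splitSum (fun j => p (φ i) (φ j))
          (branchingWeight ν (fun i j => p (φ i) (φ j)) (fun i => z (φ i)) q))) I B =
          ((cloudOp ν z (φ i))^[n] (splitSum (p (φ i)) (branchingWeight ν p z q)))
            (I.map φ) (B.map φ) := by
        intro n
        induction n with
        | zero => intro I B; exact splitSum_map φ _ ih I B
        | succ n ihn =>
          intro I B
          simp only [Function.iterate_succ_apply']
          refine lintegral_congr fun Y => ?_
          rw [splitSum_map φ (fun t => z t Y) ihn]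
      exact this n I B

/-- The contribution of the root without any cloud or further star; it accounts for the `- 1` in the
final bound. -/
theorem one_le_branchingWeight (p : α → α → ℝ≥0∞) (z : α → β → ℝ≥0∞) (q : ℕ) (i : α) :
    1 ≤ branchingWeight ν p z (q + 1) [i] [] := by
  refine le_trans ?_ (ENNReal.le_tsum 0)
  simp [splitSum, splits, branchingWeight_nil]

end Branching

/-! ### The fixed point bound on the integrated branching weights -/

section SplitSum

variable {α : Type u} [MeasurableSpace α] (μ : Measure α) [SigmaFinite μ]

/-- After `listIntegral_splits`, each newly attached star `t` carries `h t` and, as a new root, `A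
t`. The sum over all sets of new stars is then the exponential of `∫ h A`. -/
theorem listIntegral_splitSum_le {h A : α → ℝ≥0∞} (hh : Measurable h) (hA : Measurable A)
    {F : List α → List α → ℝ≥0∞} (hF : ListMeasurable₂ F) {c : ℝ≥0∞}
    (hc : ∀ J, listIntegral μ (F J) ≤ c * (J.map A).prod) (I : List α) :
    listIntegral μ (splitSum h F I) ≤ expSeries (∫⁻ t, h t * A t ∂μ) * (c * (I.map A).prod) := by
  have hm : ListMeasurable₂ fun P Q => (P.map h).prod * F (P ++ I) Q := by
    intro γ _ P Q
    simp only [List.map_map, Function.comp_def]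
    refine Measurable.mul (measurable_list_prod _ fun g _ => hh.comp g.2) ?_
    have := hF γ (P ++ I.map fun y => ⟨fun _ => y, measurable_const⟩) Q
    simpa [Function.comp_def] using this
  have hFo : ∀ J n, Measurable fun x : Fin n → α => F J (List.ofFn x) := fun J n =>
    (hF.diag J).ofFn (k := 0) measurable_id (h := fun _ => Fin.elim0) measurable_const
  unfold splitSum
  rw [listIntegral_splits μ hm]
  calc _ ≤ listIntegral μ
        (fun P => (c * (I.map A).prod) * (P.map fun t => h t * A t).prod) := by
        refine listIntegral_mono μ fun P => ?_
        rw [listIntegral_const_mul μ _ (hFo _)]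
        calc _ ≤ (P.map h).prod * (c * ((P ++ I).map A).prod) := by gcongr; exact hc _
          _ = _ := by rw [List.prod_map_mul, List.map_append, List.prod_append]; ring
    _ = _ := by
        rw [listIntegral_const_mul, listIntegral_prod μ (h := fun t => h t * A t) (hh.mul hA), mul_comm]
        intro n
        simp only [List.map_ofFn, List.prod_ofFn]
        fun_prop

end SplitSum

section Bounds

variable {α β : Type u} [MeasurableSpace α] [MeasurableSpace β]

theorem measurable_splitSum {h : β → α → ℝ≥0∞} (hh : Measurable (Function.uncurry h))
    {γ : Type u} [MeasurableSpace γ] {y : γ → β} (hy : Measurable y)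
    {F : γ → List α → List α → ℝ≥0∞}
    (hF : ∀ P Q : List {g : γ → α // Measurable g},
      Measurable fun c => F c (P.map fun g => g.1 c) (Q.map fun g => g.1 c))
    (P Q : List {g : γ → α // Measurable g}) :
    Measurable fun c => splitSum (h (y c)) (F c) (P.map fun g => g.1 c) (Q.map fun g => g.1 c) := by
  simp only [splitSum, splits_map, List.map_map, Function.comp_def]
  refine measurable_list_sum _ fun q _ => ?_
  refine Measurable.mul ?_ ?_
  · exact measurable_list_prod _ fun g _ => hh.comp (hy.prodMk g.2)
  · simpa using hF (q.1 ++ P) q.2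

variable (μ : Measure α) (ν : Measure β) [SigmaFinite μ] [SigmaFinite ν]

theorem measurable_cloudOp {z : α → β → ℝ≥0∞} (hz : Measurable (Function.uncurry z))
    {F : α → List α → List α → ℝ≥0∞}
    (hF : ∀ (γ : Type u) [MeasurableSpace γ] (i : {g : γ → α // Measurable g})
      (P Q : List {g : γ → α // Measurable g}),
      Measurable fun c => F (i.1 c) (P.map fun g => g.1 c) (Q.map fun g => g.1 c))
    (γ : Type u) [MeasurableSpace γ] (i : {g : γ → α // Measurable g})
    (P Q : List {g : γ → α // Measurable g}) :
    Measurable fun c => cloudOp ν z (i.1 c) (F (i.1 c))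
      (P.map fun g => g.1 c) (Q.map fun g => g.1 c) := by
  unfold cloudOp
  refine Measurable.lintegral_prod_right' (f := fun x : γ × β => z (i.1 x.1) x.2 *
    splitSum (fun t => z t x.2) (F (i.1 x.1)) (P.map fun g => g.1 x.1) (Q.map fun g => g.1 x.1)) ?_
  refine Measurable.mul (hz.comp ((i.2.comp measurable_fst).prodMk measurable_snd)) ?_
  have := measurable_splitSum (h := fun Y t => z t Y) (hz.comp measurable_swap)
    (γ := γ × β) measurable_snd (F := fun x => F (i.1 x.1))
    (fun P Q => hF (γ × β) ⟨_, i.2.comp measurable_fst⟩ P Q)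
    (P.map fun g => ⟨_, g.2.comp measurable_fst⟩) (Q.map fun g => ⟨_, g.2.comp measurable_fst⟩)
  simpa [Function.comp_def] using this

theorem listMeasurable_iterate_cloudOp {z : α → β → ℝ≥0∞} (hz : Measurable (Function.uncurry z))
    {F : α → List α → List α → ℝ≥0∞}
    (hF : ∀ (γ : Type u) [MeasurableSpace γ] (i : {g : γ → α // Measurable g})
      (P Q : List {g : γ → α // Measurable g}),
      Measurable fun c => F (i.1 c) (P.map fun g => g.1 c) (Q.map fun g => g.1 c)) (n : ℕ)
    (γ : Type u) [MeasurableSpace γ] (i : {g : γ → α // Measurable g})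
    (P Q : List {g : γ → α // Measurable g}) :
    Measurable fun c => ((cloudOp ν z (i.1 c))^[n] (F (i.1 c)))
      (P.map fun g => g.1 c) (Q.map fun g => g.1 c) := by
  induction n generalizing γ with
  | zero => exact hF γ i P Q
  | succ n ih =>
    simp only [Function.iterate_succ_apply']
    exact measurable_cloudOp ν hz (F := fun i => (cloudOp ν z i)^[n] (F i))
      (fun γ _ i P Q => ih γ i P Q) γ i P Q

theorem listMeasurable_branchingWeight {p : α → α → ℝ≥0∞} (hp : Measurable (Function.uncurry p))
    {z : α → β → ℝ≥0∞} (hz : Measurable (Function.uncurry z)) (q : ℕ) :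
    ListMeasurable₂ (branchingWeight ν p z q) := by
  induction q with
  | zero =>
    intro γ _ P Q
    cases P <;> simp [branchingWeight]
  | succ q ih =>
    intro γ _ P Q
    cases P with
    | nil => simp [branchingWeight]
    | cons i P =>
      simp only [branchingWeight, List.map_cons]
      refine Measurable.tsum fun n => Measurable.const_mul ?_ _
      exact listMeasurable_iterate_cloudOp ν hz
        (F := fun i => splitSum (p i) (branchingWeight ν p z q))
        (fun γ _ i P Q => measurable_splitSum hp i.2 (fun P Q => ih γ P Q) P Q) n γ i P Q

/-- With the cloud `Y` integrated last, the stars attached to it contribute `exp(∫ z(t,Y) A(t))`,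
which `b Y` bounds. -/
theorem listIntegral_cloudOp_le {z : α → β → ℝ≥0∞} (hz : Measurable (Function.uncurry z))
    {A : α → ℝ≥0∞} (hA : Measurable A) {b : β → ℝ≥0∞} (hbm : Measurable b)
    (hb : ∀ Y, expSeries (∫⁻ t, z t Y * A t ∂μ) ≤ b Y) (i : α)
    {F : List α → List α → ℝ≥0∞} (hF : ListMeasurable₂ F) {c : ℝ≥0∞}
    (hc : ∀ J, listIntegral μ (F J) ≤ c * (J.map A).prod) (I : List α) :
    listIntegral μ (cloudOp ν z i F I) ≤
      (∫⁻ Y, z i Y * b Y ∂ν) * (c * (I.map A).prod) := by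
  have hzi : Measurable (z i) := hz.comp measurable_prodMk_left
  have hzY : ∀ Y, Measurable fun t => z t Y := fun Y => hz.comp measurable_prodMk_right
  have hs : ∀ n, Measurable fun x : β × (Fin n → α) =>
      splitSum (fun t => z t x.1) F I (List.ofFn x.2) := by
    intro n
    have := measurable_splitSum (h := fun Y t => z t Y) (hz.comp measurable_swap)
      (γ := β × (Fin n → α)) measurable_fst (F := fun _ => F) (fun P Q => hF _ P Q)
      (I.map fun y => ⟨fun _ => y, measurable_const⟩)
      (List.ofFn fun i => ⟨fun x => x.2 i, by fun_prop⟩)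
    simpa [Function.comp_def, List.map_ofFn] using this
  unfold cloudOp
  rw [← listIntegral_swap μ ν (F := fun Y B => z i Y * splitSum (fun t => z t Y) F I B)
    (fun n => (hzi.comp measurable_fst).mul (hs n))]
  calc _ ≤ ∫⁻ Y, z i Y * b Y * (c * (I.map A).prod) ∂ν := by
        refine lintegral_mono fun Y => ?_
        dsimp only
        rw [listIntegral_const_mul μ _ fun n => (hs n).comp measurable_prodMk_left, mul_assoc]
        gcongr
        refine (listIntegral_splitSum_le μ (hzY Y) hA hF hc I).trans ?_
        gcongr
        exact hb Y
    _ ≤ _ := by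
        rw [lintegral_mul_const _ (f := fun Y => z i Y * b Y) (hzi.mul hbm)]

/-- The fixed point argument: sums over trees are bounded by the solutions `A`, `b` of the tree
inequalities. -/
theorem listIntegral_branchingWeight_le {p : α → α → ℝ≥0∞} (hp : Measurable (Function.uncurry p))
    {z : α → β → ℝ≥0∞} (hz : Measurable (Function.uncurry z))
    {A : α → ℝ≥0∞} (hA : Measurable A) {b : β → ℝ≥0∞} (hbm : Measurable b)
    (hb : ∀ Y, expSeries (∫⁻ t, z t Y * A t ∂μ) ≤ b Y)
    (ha : ∀ i, expSeries (∫⁻ Y, z i Y * b Y ∂ν) * expSeries (∫⁻ t, p i t * A t ∂μ) ≤ A i)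
    (q : ℕ) (I : List α) :
    listIntegral μ (branchingWeight ν p z q I) ≤ (I.map A).prod := by
  have nil : ∀ q, listIntegral μ (branchingWeight ν p z q []) ≤ 1 := by
    intro q
    rw [listIntegral, tsum_eq_single 0]
    · simp [branchingWeight_nil]
    · intro n hn
      simp [tupleIntegral, branchingWeight_nil, hn]
  induction q generalizing I with
  | zero =>
    cases I with
    | nil => simpa using nil 0
    | cons i I => simp [branchingWeight, listIntegral, tupleIntegral]
  | succ q ih =>
    cases I with
    | nil => simpa using nil (q + 1)
    | cons i I =>
      have hF : ListMeasurable₂ (branchingWeight ν p z q) :=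
        listMeasurable_branchingWeight ν hp hz q
      have hp' : ∀ i, Measurable (p i) := fun i => hp.comp measurable_prodMk_left
      have hK : ∀ n (γ : Type u) [MeasurableSpace γ] (i : {g : γ → α // Measurable g})
          (P Q : List {g : γ → α // Measurable g}),
          Measurable fun c => ((cloudOp ν z (i.1 c))^[n]
            (splitSum (p (i.1 c)) (branchingWeight ν p z q)))
              (P.map fun g => g.1 c) (Q.map fun g => g.1 c) :=
        fun n => listMeasurable_iterate_cloudOp ν hz
          (F := fun i => splitSum (p i) (branchingWeight ν p z q))
          (fun γ _ i P Q => measurable_splitSum hp i.2 (fun P Q => hF γ P Q) P Q) n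
      have hKi : ∀ n, ListMeasurable₂ ((cloudOp ν z i)^[n]
          (splitSum (p i) (branchingWeight ν p z q))) :=
        fun n γ _ P Q => hK n γ ⟨fun _ => i, measurable_const⟩ P Q
      -- Each cloud at the root contributes one factor `∫ z b`; the `1/n!` in the branching weight
      -- then turns the powers into an exponential.
      have hn : ∀ n J, listIntegral μ ((cloudOp ν z i)^[n]
          (splitSum (p i) (branchingWeight ν p z q)) J) ≤
          ((∫⁻ Y, z i Y * b Y ∂ν) ^ n * expSeries (∫⁻ t, p i t * A t ∂μ)) * (J.map A).prod := by
        intro n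
        induction n with
        | zero =>
          intro J
          have := listIntegral_splitSum_le μ (hp' i) hA hF (c := 1) (by simpa using ih) J
          simpa using this
        | succ n ihn =>
          intro J
          rw [Function.iterate_succ_apply']
          refine (listIntegral_cloudOp_le μ ν hz hA hbm hb i (hKi n) ihn J).trans_eq ?_
          ring
      have hKo : ∀ n k, Measurable fun x : Fin k → α => ((cloudOp ν z i)^[n]
          (splitSum (p i) (branchingWeight ν p z q))) I (List.ofFn x) := fun n k =>
        ((hKi n).diag I).ofFn (k := 0) measurable_id (h := fun _ => Fin.elim0) measurable_const
      simp only [branchingWeight, List.map_cons, List.prod_cons]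
      rw [listIntegral_tsum μ (F := fun n B => (n.factorial : ℝ≥0∞)⁻¹ *
        ((cloudOp ν z i)^[n] (splitSum (p i) (branchingWeight ν p z q))) I B)
        fun n k => (hKo n k).const_mul _]
      simp only [listIntegral_const_mul μ _ (hKo _)]
      calc _ ≤ ∑' n : ℕ, ((n.factorial : ℝ≥0∞)⁻¹ * (∫⁻ Y, z i Y * b Y ∂ν) ^ n) *
            (expSeries (∫⁻ t, p i t * A t ∂μ) * (I.map A).prod) := by
            refine ENNReal.tsum_le_tsum fun n => ?_
            rw [mul_assoc]
            gcongr
            rw [← mul_assoc]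
            exact hn n I
        _ = expSeries (∫⁻ Y, z i Y * b Y ∂ν) * expSeries (∫⁻ t, p i t * A t ∂μ) *
            (I.map A).prod := by
            rw [ENNReal.tsum_mul_right, mul_assoc]; rfl
        _ ≤ _ := by gcongr; exact ha i

end Bounds

/-! ### Connectedness by hyperedges -/

section Linked

variable {ι : Type*} [DecidableEq ι]

/-- Every vertex of `U` is connected to the set `I` of roots by the hyperedges `hs`: each proper
subset of `U` that contains the roots is left by a hyperedge. -/
def Linked (I U : Finset ι) (hs : List (Finset ι)) : Prop :=
  ∀ S : Finset ι, I ⊆ S → S ⊂ U → ∃ A ∈ hs, (A ∩ S).Nonempty ∧ (A ∩ (U \ S)).Nonempty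

theorem linked_congr_mem {I U : Finset ι} {hs hs' : List (Finset ι)}
    (h : ∀ A, A ∈ hs ↔ A ∈ hs') : Linked I U hs ↔ Linked I U hs' := by
  simp only [Linked, h]

/-- Here and below, the prefix `t` stands for hyperedges that `linkedSum` chooses later and puts in
front. -/
theorem linked_cons_empty {I U : Finset ι} {t hs : List (Finset ι)} :
    Linked I U (t ++ ∅ :: hs) ↔ Linked I U (t ++ hs) := by
  simp only [Linked, List.mem_append, List.mem_cons]
  refine forall_congr' fun S => forall_congr' fun _ => forall_congr' fun _ => ⟨?_, ?_⟩
  · rintro ⟨A, hA | rfl | hA, h1, h2⟩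
    · exact ⟨A, Or.inl hA, h1, h2⟩
    · simp at h1
    · exact ⟨A, Or.inr hA, h1, h2⟩
  · rintro ⟨A, hA | hA, h⟩
    · exact ⟨A, Or.inl hA, h⟩
    · exact ⟨A, Or.inr (Or.inr hA), h⟩

/-- A hyperedge that meets the roots turns all its vertices into roots: it leaves every `S ⊇ I` that
does not contain it, and never leaves an `S` that does. -/
theorem linked_cons_of_inter {I U A : Finset ι} {t hs : List (Finset ι)}
    (hA : (A ∩ I).Nonempty) (hU : A ⊆ U) :
    Linked I U (t ++ A :: hs) ↔ Linked (I ∪ A) U (t ++ hs) := by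
  simp only [Linked, List.mem_append, List.mem_cons]
  constructor
  · intro h S hS hSU
    obtain ⟨C, hC, h1, x, hx⟩ := h S (Finset.union_subset_iff.1 hS).1 hSU
    rcases hC with hC | rfl | hC
    · exact ⟨C, Or.inl hC, h1, x, hx⟩
    · simp only [Finset.mem_inter, Finset.mem_sdiff] at hx
      exact absurd ((Finset.union_subset_iff.1 hS).2 hx.1) hx.2.2
    · exact ⟨C, Or.inr hC, h1, x, hx⟩
  · intro h S hS hSU
    by_cases hAS : A ⊆ S
    · obtain ⟨C, hC, h1⟩ := h S (Finset.union_subset hS hAS) hSU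
      rcases hC with hC | hC
      · exact ⟨C, Or.inl hC, h1⟩
      · exact ⟨C, Or.inr (Or.inr hC), h1⟩
    · refine ⟨A, Or.inr (Or.inl rfl), hA.mono (Finset.inter_subset_inter_left hS), ?_⟩
      obtain ⟨x, hx, hxS⟩ := Finset.not_subset.1 hAS
      exact ⟨x, by simp [hx, hxS, hU hx]⟩

/-- A root that lies on no hyperedge cannot help to connect anything. Test sets correspond under `S
↦ insert i S`. -/
theorem linked_erase_root {I U : Finset ι} {i : ι} (hiI : i ∉ I) (hiU : i ∈ U)
    {t : List (Finset ι)} (ht : ∀ A ∈ t, i ∉ A) :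
    Linked (insert i I) U t ↔ Linked I (U.erase i) t := by
  constructor
  · intro h S hS hSU
    have hiS : i ∉ S := fun hi => by simpa using hSU.1 hi
    obtain ⟨A, hA, ⟨x, hx⟩, y, hy⟩ := h (insert i S) (Finset.insert_subset_insert i hS) (by
      rw [Finset.ssubset_iff_of_subset]
      · obtain ⟨x, hx, hxS⟩ := Finset.exists_of_ssubset hSU
        simp only [Finset.mem_erase] at hx
        exact ⟨x, hx.2, by simp [hx.1, hxS]⟩
      · exact Finset.insert_subset hiU (hSU.1.trans (Finset.erase_subset _ _)))
    have hiA := ht A hA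
    simp only [Finset.mem_inter, Finset.mem_insert, Finset.mem_sdiff, not_or] at hx hy
    refine ⟨A, hA, ⟨x, ?_⟩, y, ?_⟩
    · rcases hx.2 with rfl | hxS
      · exact absurd hx.1 hiA
      · simp [hx.1, hxS]
    · simp [hy]
  · intro h S hS hSU
    have hiS : i ∈ S := hS (Finset.mem_insert_self i I)
    obtain ⟨A, hA, ⟨x, hx⟩, y, hy⟩ := h (S.erase i)
      (fun a ha => Finset.mem_erase.2 ⟨fun e => hiI (e ▸ ha), hS (Finset.mem_insert_of_mem ha)⟩) (by
        rw [Finset.ssubset_iff_of_subset (Finset.erase_subset_erase i hSU.1)]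
        obtain ⟨x, hx, hxS⟩ := Finset.exists_of_ssubset hSU
        refine ⟨x, Finset.mem_erase.2 ⟨?_, hx⟩, by simp [hxS]⟩
        rintro rfl
        exact hxS hiS)
    simp only [Finset.mem_inter, Finset.mem_erase, Finset.mem_sdiff, not_and] at hx hy
    exact ⟨A, hA, ⟨x, by simp [hx]⟩, y, by simp [hy.1, hy.2.1.2, hy.2.2 hy.2.1.1]⟩

end Linked

/-! ### Optional edges between stars -/

section Edges

variable {ι : Type*} [DecidableEq ι]

/-- The weight of an optional edge `{i, j}`. -/
def edge (f : ι → ι → ℝ) (i j : ι) (A : Finset ι) : ℝ :=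
  (if A = ∅ then 1 else 0) + if A = {i, j} then f i j else 0

/-- The weights of the optional edges between the vertices of a list. -/
def pairEdges (f : ι → ι → ℝ) : List ι → List (Finset ι → ℝ)
  | [] => []
  | i :: l => l.map (edge f i) ++ pairEdges f l

theorem edge_comm {f : ι → ι → ℝ} (hf : ∀ i j, f i j = f j i) (i j : ι) :
    edge f i j = edge f j i := by
  funext A
  simp [edge, hf i j, Finset.pair_comm i j]

theorem pairEdges_perm {f : ι → ι → ℝ} (hf : ∀ i j, f i j = f j i) {l l' : List ι}
    (h : l.Perm l') : (pairEdges f l).Perm (pairEdges f l') := by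
  induction h with
  | nil => rfl
  | cons i h ih => exact (h.map _).append ih
  | swap i j l =>
    simp only [pairEdges, List.map_cons, List.cons_append, edge_comm hf i j]
    refine List.Perm.cons _ ?_
    rw [← List.append_assoc, ← List.append_assoc]
    exact List.perm_append_comm.append_right _
  | trans _ _ ih ih' => exact ih.trans ih'

theorem edge_mem_pairEdges {f : ι → ι → ℝ} (hf : ∀ i j, f i j = f j i) {l : List ι} {i j : ι}
    (hi : i ∈ l) (hj : j ∈ l) (hij : i ≠ j) : edge f i j ∈ pairEdges f l := by
  induction l with
  | nil => simp at hi
  | cons a l ih =>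
    simp only [pairEdges, List.mem_append, List.mem_map]
    rcases List.mem_cons.1 hi with rfl | hi'
    · rcases List.mem_cons.1 hj with rfl | hj'
      · exact absurd rfl hij
      · exact Or.inl ⟨j, hj', rfl⟩
    · rcases List.mem_cons.1 hj with rfl | hj'
      · exact Or.inl ⟨i, hi', edge_comm hf _ _⟩
      · exact Or.inr (ih hi' hj')

theorem edge_eq_zero_of_mem_pairEdges {f : ι → ι → ℝ} {l : List ι} {c : Finset ι → ℝ}
    (hc : c ∈ pairEdges f l) {A : Finset ι} (hA : ¬ A ⊆ l.toFinset) : c A = 0 := by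
  induction l with
  | nil => simp [pairEdges] at hc
  | cons a l ih =>
    simp only [pairEdges, List.mem_append, List.mem_map] at hc
    rcases hc with ⟨j, hj, rfl⟩ | hc
    · have h1 : A ≠ ∅ := by rintro rfl; simp at hA
      have h2 : A ≠ {a, j} := by rintro rfl; simp [Finset.insert_subset_iff, hj] at hA
      simp [edge, h1, h2]
    · exact ih hc fun h => hA (h.trans fun x hx => by simp_all)

/-- Passes from sums over subsets, natural for hyperedges, to sums over sublists, natural for
integration. -/
theorem sum_powerset_splits {M : Type*} [AddCommMonoid M] (g : Finset ι → M) {l : List ι}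
    (hl : l.Nodup) :
    ∑ T ∈ l.toFinset.powerset, g T = ((splits l).map fun q => g q.1.toFinset).sum := by
  induction l generalizing g with
  | nil => simp [splits]
  | cons a l ih =>
    rw [List.nodup_cons] at hl
    rw [List.toFinset_cons, Finset.sum_powerset_insert (by simpa using hl.1), ih _ hl.2,
      ih _ hl.2, add_comm]
    simp [splits, Function.comp_def]

theorem sum_powerset_union {M : Type*} [AddCommMonoid M] (g : Finset ι → M) {I B : Finset ι}
    (h : Disjoint I B) :
    ∑ A ∈ (I ∪ B).powerset, g A = ∑ T ∈ B.powerset, ∑ A ∈ I.powerset, g (A ∪ T) := by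
  induction B using Finset.induction_on generalizing g with
  | empty => simp
  | insert b B hb ih =>
    rw [Finset.disjoint_insert_right] at h
    rw [Finset.union_insert, Finset.sum_powerset_insert (by simp [hb, h.1]), ih _ h.2, ih _ h.2,
      Finset.sum_powerset_insert hb]
    simp

end Edges

/-! ### Weighted sums over connecting hyperedges -/

section LinkedSum

variable {ι : Type*} [DecidableEq ι] [Fintype ι]

open Classical in
/-- Each hyperedge of a list is summed over all subsets of vertices, with the weights given by the
entries of the list, the sum being restricted to the choices that, together with the hyperedges
`hs`, connect all vertices of `U` to the roots `I`. -/
def linkedSum (I U : Finset ι) : List (Finset ι → ℝ) → List (Finset ι) → ℝ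
  | [], hs => if Linked I U hs then 1 else 0
  | c :: cs, hs => ∑ A, c A * linkedSum I U cs (A :: hs)

/-- Choices that violate `Q` have weight zero, so the two notions of connectedness need to agree
only on hyperedges satisfying `Q`. -/
theorem linkedSum_congr {Q : Finset ι → Prop} {I U I' U' : Finset ι} {cs : List (Finset ι → ℝ)}
    {hs hs' : List (Finset ι)} (hQ : ∀ c ∈ cs, ∀ A, ¬ Q A → c A = 0)
    (h : ∀ t : List (Finset ι), (∀ A ∈ t, Q A) →
      (Linked I U (t ++ hs) ↔ Linked I' U' (t ++ hs'))) :
    linkedSum I U cs hs = linkedSum I' U' cs hs' := by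
  induction cs generalizing hs hs' with
  | nil =>
    have := h [] (by simp)
    simp only [List.nil_append] at this
    by_cases hL : Linked I' U' hs'
    · simp [linkedSum, hL, this.2 hL]
    · have hL' : ¬ Linked I U hs := fun h => hL (this.1 h)
      simp [linkedSum, hL, hL']
  | cons c cs ih =>
    refine Finset.sum_congr rfl fun A _ => ?_
    by_cases hA : Q A
    · rw [ih (fun c hc => hQ c (by simp [hc]))]
      intro t ht
      simpa using h (t ++ [A]) (by simpa [or_imp, forall_and] using ⟨ht, hA⟩)
    · simp [hQ c (by simp) A hA]

theorem linkedSum_congr' {I U I' : Finset ι} {cs : List (Finset ι → ℝ)}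
    {hs hs' : List (Finset ι)}
    (h : ∀ t : List (Finset ι), (Linked I U (t ++ hs) ↔ Linked I' U (t ++ hs'))) :
    linkedSum I U cs hs = linkedSum I' U cs hs' :=
  linkedSum_congr (Q := fun _ => True) (fun _ _ _ h => absurd trivial h) fun t _ => h t

/-- `Linked` depends only on the set of hyperedges, so the finite sums over them commute. -/
theorem linkedSum_perm {I U : Finset ι} {cs cs' : List (Finset ι → ℝ)} (h : cs.Perm cs') :
    ∀ hs, linkedSum I U cs hs = linkedSum I U cs' hs := by
  induction h with
  | nil => intro hs; rfl
  | cons c _ ih => intro hs; simp only [linkedSum, ih]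
  | swap c d l =>
    intro hs
    simp only [linkedSum, Finset.mul_sum]
    rw [Finset.sum_comm]
    refine Finset.sum_congr rfl fun A _ => Finset.sum_congr rfl fun B _ => ?_
    rw [mul_left_comm]
    congr 2
    refine linkedSum_congr' fun t => ?_
    refine linked_congr_mem fun C => ?_
    simp only [List.mem_append, List.mem_cons]
    tauto
  | trans _ _ ih ih' => intro hs; rw [ih, ih']

theorem linkedSum_absorb {I U A : Finset ι} (hA : (A ∩ I).Nonempty) (hU : A ⊆ U)
    (cs : List (Finset ι → ℝ)) (hs : List (Finset ι)) :
    linkedSum I U cs (A :: hs) = linkedSum (I ∪ A) U cs hs :=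
  linkedSum_congr' fun _ => linked_cons_of_inter hA hU

theorem linkedSum_empty_cons (I U : Finset ι) (cs : List (Finset ι → ℝ)) (hs : List (Finset ι)) :
    linkedSum I U cs (∅ :: hs) = linkedSum I U cs hs :=
  linkedSum_congr' fun _ => linked_cons_empty

/-- Deletion and contraction of an edge at a root: it is absent, or it is present and its other
endpoint becomes a root. -/
theorem linkedSum_edge (f : ι → ι → ℝ) {I U : Finset ι} {i j : ι} (hi : i ∈ I) (hiU : i ∈ U)
    (hj : j ∈ U) (cs : List (Finset ι → ℝ)) (hs : List (Finset ι)) :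
    linkedSum I U (edge f i j :: cs) hs =
      linkedSum I U cs hs + f i j * linkedSum (insert j I) U cs hs := by
  have h : linkedSum I U cs ({i, j} :: hs) = linkedSum (insert j I) U cs hs := by
    rw [linkedSum_absorb ⟨i, by simp [hi]⟩ (by simp [Finset.insert_subset_iff, hiU, hj])]
    congr 1
    ext x
    simp only [Finset.mem_union, Finset.mem_insert, Finset.mem_singleton]
    constructor
    · rintro (h | rfl | rfl) <;> simp_all
    · tauto
  simp [linkedSum, edge, add_mul, Finset.sum_add_distrib, linkedSum_empty_cons, h]

/-- An edge between two roots is irrelevant for connectedness, so its two options sum to the factor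
`1 + f = 0`. This is why the domination conditions are needed only for stars that do not exclude
each other. -/
theorem linkedSum_eq_zero_of_edge {f : ι → ι → ℝ} {I U : Finset ι} (hIU : I ⊆ U) {i j : ι}
    (hi : i ∈ I) (hj : j ∈ I) (hf : f i j = -1) {cs : List (Finset ι → ℝ)}
    (hc : edge f i j ∈ cs) (hs : List (Finset ι)) : linkedSum I U cs hs = 0 := by
  obtain ⟨s, t, rfl⟩ := List.append_of_mem hc
  rw [linkedSum_perm List.perm_middle, linkedSum_edge f hi (hIU hi) (hIU hj), hf,
    Finset.insert_eq_of_mem hj]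
  ring

theorem linkedSum_erase_root {I U : Finset ι} {i : ι} (hiI : i ∉ I) (hiU : i ∈ U)
    {cs : List (Finset ι → ℝ)} (hc : ∀ c ∈ cs, ∀ A, i ∈ A → c A = 0) :
    linkedSum (insert i I) U cs [] = linkedSum I (U.erase i) cs [] :=
  linkedSum_congr (Q := fun A => i ∉ A) (fun c h A hA => hc c h A (not_not.1 hA)) fun t ht => by
    simpa using linked_erase_root hiI hiU ht

/-- The weight of the set `A` of stars adjacent to a cloud. -/
def cloudWeight (z : ι → ℝ) (U A : Finset ι) : ℝ :=
  if A ⊆ U ∧ 2 ≤ A.card then ∏ s ∈ A, z s else 0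

/-- The central resummation. A neighbourhood containing `i` is `{i} ∪ A ∪ T` with `A ⊆ I` and `T ⊆
B`; only `T` affects connectedness, since `A` consists of roots. Summing over `A` gives `∏ (1 + z
s)`. For `T = ∅` the choice `A = ∅` is excluded because a cloud has at least two neighbours, whence
the subtracted 1. -/
theorem linkedSum_cloud (z : ι → ℝ) {i : ι} {I B : Finset ι} (hiI : i ∉ I) (hiB : i ∉ B)
    (hIB : Disjoint I B) (cs : List (Finset ι → ℝ)) (hs : List (Finset ι)) :
    linkedSum (insert i I) (insert i (I ∪ B)) (cloudWeight z (insert i (I ∪ B)) :: cs) hs =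
      linkedSum (insert i I) (insert i (I ∪ B)) (cloudWeight z (I ∪ B) :: cs) hs +
      ∑ T ∈ B.powerset, z i * (∏ t ∈ T, z t) * ((∏ s ∈ I, (1 + z s)) - if T = ∅ then 1 else 0) *
        linkedSum (insert i (T ∪ I)) (insert i (I ∪ B)) cs hs := by
  set U := insert i (I ∪ B) with hU
  have hi : i ∉ I ∪ B := by simp [hiI, hiB]
  have hsplit : ∀ A, cloudWeight z U A =
      cloudWeight z (I ∪ B) A + if i ∈ A then cloudWeight z U A else 0 := by
    intro A
    by_cases hA : i ∈ A
    · have : ¬ A ⊆ I ∪ B := fun h => hi (h hA)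
      simp only [hA, if_true]
      simp [cloudWeight, this]
    · have : A ⊆ U ↔ A ⊆ I ∪ B := Finset.subset_insert_iff_of_notMem hA
      simp [hA, cloudWeight, this]
  have e : ∀ A, cloudWeight z U A * linkedSum (insert i I) U cs (A :: hs) =
      cloudWeight z (I ∪ B) A * linkedSum (insert i I) U cs (A :: hs) +
        (if i ∈ A then cloudWeight z U A else 0) * linkedSum (insert i I) U cs (A :: hs) :=
    fun A => by rw [← add_mul, ← hsplit]
  simp only [linkedSum]
  rw [Finset.sum_congr rfl fun A _ => e A, Finset.sum_add_distrib]
  congr 1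
  have h1 : ∑ A : Finset ι, (if i ∈ A then cloudWeight z U A else 0) *
        linkedSum (insert i I) U cs (A :: hs) =
      ∑ A ∈ U.powerset, (if i ∈ A then cloudWeight z U A else 0) *
        linkedSum (insert i I) U cs (A :: hs) := by
    symm
    refine Finset.sum_subset (Finset.subset_univ _) fun A _ hA => ?_
    have : ¬ A ⊆ U := by simpa using hA
    simp [cloudWeight, this]
  rw [h1, hU, Finset.sum_powerset_insert hi, ← hU, Finset.sum_eq_zero, zero_add,
    sum_powerset_union _ hIB]
  · refine Finset.sum_congr rfl fun T hT => ?_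
    rw [Finset.mem_powerset] at hT
    have hterm : ∀ A ∈ I.powerset, (if i ∈ insert i (A ∪ T) then cloudWeight z U (insert i (A ∪ T))
          else 0) * linkedSum (insert i I) U cs (insert i (A ∪ T) :: hs) =
        z i * (∏ t ∈ T, z t) * linkedSum (insert i (T ∪ I)) U cs hs *
          (∏ s ∈ A, z s - if A = ∅ then if T = ∅ then 1 else 0 else 0) := by
      intro A hA
      rw [Finset.mem_powerset] at hA
      have hAT : A ∪ T ⊆ I ∪ B := Finset.union_subset_union hA hT
      have hiAT : i ∉ A ∪ T := fun h => hi (hAT h)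
      have hdis : Disjoint A T := (hIB.mono_left hA).mono_right hT
      rw [linkedSum_absorb ⟨i, by simp⟩ (Finset.insert_subset_insert i hAT)]
      have hset : insert i I ∪ insert i (A ∪ T) = insert i (T ∪ I) := by
        ext x
        simp only [Finset.mem_union, Finset.mem_insert]
        have := @hA x
        tauto
      rw [hset]
      simp only [cloudWeight, Finset.mem_insert_self, if_true, Finset.card_insert_of_notMem hiAT,
        Finset.insert_subset_insert i hAT, hU, true_and, Finset.prod_insert hiAT,
        Finset.prod_union hdis]
      by_cases hA0 : A = ∅ <;> by_cases hT0 : T = ∅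
      · subst hA0 hT0; simp
      · have : 1 ≤ T.card := Finset.card_pos.2 (Finset.nonempty_iff_ne_empty.2 hT0)
        simp [hA0, hT0]
      · have : 1 ≤ A.card := Finset.card_pos.2 (Finset.nonempty_iff_ne_empty.2 hA0)
        have hA1 : A.Nonempty := Finset.card_pos.1 this
        simp [hA0, hT0, hA1]; ring
      · have : 1 ≤ A.card := Finset.card_pos.2 (Finset.nonempty_iff_ne_empty.2 hA0)
        have : 1 ≤ (A ∪ T).card := this.trans (Finset.card_le_card Finset.subset_union_left)
        simp [hA0, this]; ring
    rw [Finset.sum_congr rfl hterm, ← Finset.mul_sum, Finset.sum_sub_distrib, Finset.prod_one_add]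
    simp
    ring
  · intro A hA
    have : i ∉ A := fun h => hi (Finset.mem_powerset.1 hA h)
    simp [this]

end LinkedSum

/-! ### Domination by reduced weights and removal of one root -/

theorem enorm_list_sum_le {δ : Type*} (l : List δ) (g : δ → ℝ) :
    ‖(l.map g).sum‖ₑ ≤ (l.map fun d => ‖g d‖ₑ).sum := by
  induction l with
  | nil => simp
  | cons d l ih =>
    simp only [List.map_cons, List.sum_cons]
    exact (enorm_add_le _ _).trans (by gcongr)

theorem enorm_list_prod {δ : Type*} (l : List δ) (g : δ → ℝ) :
    ‖(l.map g).prod‖ₑ = (l.map fun d => ‖g d‖ₑ).prod := by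
  induction l with
  | nil => simp
  | cons d l ih => simp [enorm_mul, ih]

theorem list_sum_map_le {δ : Type*} {l : List δ} {g h : δ → ℝ≥0∞} (H : ∀ d ∈ l, g d ≤ h d) :
    (l.map g).sum ≤ (l.map h).sum := by
  induction l with
  | nil => simp
  | cons d l ih =>
    simp only [List.map_cons, List.sum_cons]
    exact add_le_add (H d (by simp)) (ih fun d hd => H d (by simp [hd]))

theorem splitSum_mono {ι : Type*} {h : ι → ℝ≥0∞} {F F' : List ι → List ι → ℝ≥0∞} {I B : List ι}
    (H : ∀ q ∈ splits B, F (q.1 ++ I) q.2 ≤ F' (q.1 ++ I) q.2) :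
    splitSum h F I B ≤ splitSum h F' I B :=
  list_sum_map_le fun q hq => by gcongr; exact H q hq

theorem perm_append_of_mem_splits {ι : Type*} {I B : List ι} {q : List ι × List ι}
    (hq : q ∈ splits B) : ((q.1 ++ I) ++ q.2).Perm (I ++ B) := by
  refine ((List.perm_append_comm (l₁ := q.1) (l₂ := I)).append_right q.2).trans ?_
  rw [List.append_assoc]
  exact (perm_of_mem_splits hq).append_left I

section Dominated

variable {ι : Type*}

/-- The domination of the weights `z` of the edges at a cloud by reduced weights `zt`, for stars
that do not exclude each other. -/
structure Dominated (f : ι → ι → ℝ) (z : ι → ℝ) (zt : ι → ℝ≥0∞) : Prop where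
  mem_Icc : ∀ i, z i ∈ Set.Icc (-1 : ℝ) 0
  prod_le : ∀ l : List ι, l.Nodup → 2 ≤ l.length → l.Pairwise (fun i j => f i j ≠ -1) →
    (l.map fun i => ‖z i‖ₑ).prod ≤ (l.map zt).prod
  reduced_le : ∀ (i : ι) (J : List ι), (i :: J).Nodup →
    (i :: J).Pairwise (fun i j => f i j ≠ -1) →
    ‖z i‖ₑ * ‖(J.map fun j => 1 + z j).prod - 1‖ₑ ≤ zt i

theorem Dominated.enorm_prod_one_add_le {f : ι → ι → ℝ} {z : ι → ℝ} {zt : ι → ℝ≥0∞}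
    (h : Dominated f z zt) (l : List ι) : ‖(l.map fun j => 1 + z j).prod‖ₑ ≤ 1 := by
  induction l with
  | nil => simp
  | cons i l ih =>
    have hi : ‖1 + z i‖ₑ ≤ 1 := by
      have := h.mem_Icc i
      rw [← enorm_one (G := ℝ), enorm_le_iff_norm_le, Real.norm_eq_abs, norm_one, abs_le]
      constructor <;> linarith [this.1, this.2]
    simpa [enorm_mul] using mul_le_mul' hi ih

/-- For `T = []` this is `reduced_le`. Otherwise `i :: T` has at least two stars, `prod_le` applies,
and the factor over `I` is at most 1 since `z ∈ [-1, 0]`. -/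
theorem Dominated.attach_le {f : ι → ι → ℝ} {z : ι → ℝ} {zt : ι → ℝ≥0∞}
    (h : Dominated f z zt) {i : ι} {I T : List ι} (hnd : (i :: (T ++ I)).Nodup)
    (hp : (i :: (T ++ I)).Pairwise (fun i j => f i j ≠ -1)) :
    ‖z i * (T.map z).prod * ((I.map fun s => 1 + z s).prod - if T = [] then 1 else 0)‖ₑ ≤
      zt i * (T.map zt).prod := by
  by_cases hT : T = []
  · subst hT
    simpa [enorm_mul] using h.reduced_le i I (by simpa using hnd) (by simpa using hp)
  · have hs : (i :: T).Sublist (i :: (T ++ I)) :=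
      List.Sublist.cons_cons i (List.sublist_append_left T I)
    have h1 := h.prod_le (i :: T) (hnd.sublist hs) (by
      have := List.length_pos_of_ne_nil hT
      simp only [List.length_cons]; omega) (hp.sublist hs)
    simp only [List.map_cons, List.prod_cons] at h1
    rw [if_neg hT, sub_zero, enorm_mul, enorm_mul, enorm_list_prod T]
    calc _ ≤ zt i * (T.map zt).prod * 1 := mul_le_mul' h1 (h.enorm_prod_one_add_le I)
      _ = _ := mul_one _

end Dominated

variable {ι : Type*} [DecidableEq ι] [Fintype ι]

/-- The resummed identity `linkedSum_cloud`, with each coefficient bounded by `Dominated.attach_le`.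
-/
theorem enorm_linkedSum_cloud_le {f : ι → ι → ℝ} (hf : ∀ i j, f i j = f j i) {z : ι → ℝ}
    {zt : ι → ℝ≥0∞} (hz : Dominated f z zt) {i : ι} {I B : List ι}
    (hnd : (i :: (I ++ B)).Nodup) {cs : List (Finset ι → ℝ)}
    (hcs : ∀ c ∈ pairEdges f (i :: (I ++ B)), c ∈ cs) :
    ‖linkedSum (insert i I.toFinset) (i :: (I ++ B)).toFinset
        (cloudWeight z (i :: (I ++ B)).toFinset :: cs) []‖ₑ ≤
      ‖linkedSum (insert i I.toFinset) (i :: (I ++ B)).toFinset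
        (cloudWeight z (I ++ B).toFinset :: cs) []‖ₑ +
      zt i * splitSum zt (fun I' _ => ‖linkedSum (insert i I'.toFinset)
        (i :: (I ++ B)).toFinset cs []‖ₑ) I B := by
  have hnd' := hnd
  rw [List.nodup_cons, List.nodup_append] at hnd'
  obtain ⟨hi, hI, hB, hd⟩ := hnd'
  have hdis : Disjoint I.toFinset B.toFinset := by
    rw [Finset.disjoint_left]
    intro a ha hb
    exact hd a (by simpa using ha) a (by simpa using hb) rfl
  have key := linkedSum_cloud z (i := i) (I := I.toFinset) (B := B.toFinset)
    (by simpa using fun h => hi (List.mem_append_left _ h))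
    (by simpa using fun h => hi (List.mem_append_right _ h)) hdis cs []
  rw [← List.toFinset_append, ← List.toFinset_cons (a := i) (l := I ++ B)] at key
  rw [key, sum_powerset_splits (fun T => z i * (∏ t ∈ T, z t) *
    ((∏ s ∈ I.toFinset, (1 + z s)) - if T = ∅ then 1 else 0) *
      linkedSum (insert i (T ∪ I.toFinset)) (i :: (I ++ B)).toFinset cs []) hB]
  refine (enorm_add_le _ _).trans ?_
  gcongr
  refine (enorm_list_sum_le _ _).trans ?_
  rw [splitSum, ← List.sum_map_mul_left]
  refine list_sum_map_le fun q hq => ?_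
  have hperm : (i :: ((q.1 ++ I) ++ q.2)).Perm (i :: (I ++ B)) :=
    (perm_append_of_mem_splits hq).cons i
  have hnd2 : (i :: (q.1 ++ I)).Nodup := (hperm.nodup_iff.2 hnd).sublist
    (List.Sublist.cons_cons i (List.sublist_append_left _ _))
  have hq1 : q.1.Nodup := ((List.nodup_append.1 (List.nodup_cons.1 hnd2).2)).1
  have hif : (if q.1.toFinset = ∅ then (1 : ℝ) else 0) = if q.1 = [] then 1 else 0 := by
    by_cases h : q.1 = [] <;> simp [h]
  rw [List.prod_toFinset _ hq1, List.prod_toFinset _ hI, hif, ← List.toFinset_append, enorm_mul, ← mul_assoc]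
  -- If the remaining sum is nonzero, no two of its roots exclude each other, which is what
  -- `attach_le` requires.
  by_cases h0 : linkedSum (insert i (q.1 ++ I).toFinset) (i :: (I ++ B)).toFinset cs [] = 0
  · simp only [h0, enorm_zero, mul_zero, le_refl]
  · gcongr
    refine hz.attach_le hnd2 ?_
    have hsub : ∀ a ∈ i :: (q.1 ++ I), a ∈ i :: (I ++ B) := fun a ha =>
      hperm.subset (List.Sublist.subset
        (List.Sublist.cons_cons i (List.sublist_append_left _ _)) ha)
    refine List.Pairwise.imp_of_mem (R := fun a b => a ≠ b) ?_ hnd2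
    intro a b ha hb hab hfab
    refine h0 (linkedSum_eq_zero_of_edge ?_ (i := a) (j := b) ?_ ?_ hfab
      (hcs _ (edge_mem_pairEdges hf (hsub a ha) (hsub b hb) hab)) [])
    · rw [← List.toFinset_cons]
      intro x hx
      rw [List.mem_toFinset] at hx ⊢
      exact hsub x hx
    · rw [← List.toFinset_cons, List.mem_toFinset]; exact ha
    · rw [← List.toFinset_cons, List.mem_toFinset]; exact hb

/-- Iterated deletion and contraction of the edges from `i` to the unexplored stars. -/
theorem enorm_linkedSum_edges_le {f : ι → ι → ℝ} {i : ι} {p : ι → ℝ≥0∞}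
    (hp : ∀ j, ‖f i j‖ₑ ≤ p j) {U : Finset ι} {cs : List (Finset ι → ℝ)} :
    ∀ {B : List ι} {R : Finset ι}, i ∈ R → i ∈ U → (∀ j ∈ B, j ∈ U) →
    ‖linkedSum R U (B.map (edge f i) ++ cs) []‖ₑ ≤
      ((splits B).map fun q => (q.1.map p).prod *
        ‖linkedSum (q.1.toFinset ∪ R) U cs []‖ₑ).sum := by
  intro B
  induction B with
  | nil => intro R _ _ _; simp [splits]
  | cons b B ih =>
    intro R hi hiU hB
    rw [List.map_cons, List.cons_append, linkedSum_edge f hi hiU (hB b (by simp))]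
    refine (enorm_add_le _ _).trans ?_
    have hB' : ∀ j ∈ B, j ∈ U := fun j hj => hB j (by simp [hj])
    have h1 := ih hi hiU hB'
    have h2 := ih (R := insert b R) (by simp [hi]) hiU hB'
    rw [enorm_mul, add_comm]
    simp only [splits, List.map_append, List.map_map, List.sum_append, Function.comp_def,
      List.map_cons, List.prod_cons, List.toFinset_cons, mul_assoc]
    refine add_le_add ?_ h1
    rw [List.sum_map_mul_left]
    refine mul_le_mul' (hp b) (h2.trans_eq ?_)
    simp

/-- Both options of an edge between roots leave the same connectedness condition, so each edge
contributes `1 + f ∈ [0, 1]`. Taking absolute values earlier would lose this cancellation. -/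
theorem enorm_linkedSum_root_edges_le {f : ι → ι → ℝ} (hf : ∀ i j, f i j ∈ Set.Icc (-1 : ℝ) 0)
    {i : ι} {U R : Finset ι} {cs : List (Finset ι → ℝ)} (hi : i ∈ R) (hRU : R ⊆ U)
    {I : List ι} (hI : ∀ j ∈ I, j ∈ R) :
    ‖linkedSum R U (I.map (edge f i) ++ cs) []‖ₑ ≤ ‖linkedSum R U cs []‖ₑ := by
  induction I with
  | nil => simp
  | cons b I ih =>
    have hb := hI b (by simp)
    rw [List.map_cons, List.cons_append, linkedSum_edge f hi (hRU hi) (hRU hb),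
      Finset.insert_eq_of_mem hb, ← one_add_mul, enorm_mul]
    have h1 : ‖1 + f i b‖ₑ ≤ 1 := by
      have := hf i b
      rw [← enorm_one (G := ℝ), enorm_le_iff_norm_le, Real.norm_eq_abs, norm_one, abs_le]
      constructor <;> linarith [this.1, this.2]
    calc _ ≤ 1 * ‖linkedSum R U cs []‖ₑ := mul_le_mul' h1 (ih fun j hj => hI j (by simp [hj]))
      _ = _ := one_mul _

section Forest

variable {β : Type*}

/-- The sum over the graphs on the stars of the lists `I`, `B` and the clouds `D` in which all
vertices are connected to the roots `I`. -/
def forestSum (f : ι → ι → ℝ) (z : ι → β → ℝ) (I B : List ι) (D : List β) : ℝ :=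
  linkedSum I.toFinset (I ++ B).toFinset
    (D.map (fun Y => cloudWeight (fun s => z s Y) (I ++ B).toFinset) ++ pairEdges f (I ++ B)) []

/-- The variant of `forestSum` with an additional root `i` that is not adjacent to the clouds of
the list `D'`. -/
def rootedSum (f : ι → ι → ℝ) (z : ι → β → ℝ) (i : ι) (I B : List ι) (D D' : List β) : ℝ :=
  linkedSum (insert i I.toFinset) (i :: (I ++ B)).toFinset
    (D.map (fun Y => cloudWeight (fun s => z s Y) (i :: (I ++ B)).toFinset) ++
      (D'.map (fun Y => cloudWeight (fun s => z s Y) (I ++ B).toFinset) ++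
        pairEdges f (i :: (I ++ B)))) []

theorem forestSum_cons (f : ι → ι → ℝ) (z : ι → β → ℝ) (i : ι) (I B : List ι) (D : List β) :
    forestSum f z (i :: I) B D = rootedSum f z i I B D [] := by
  simp [forestSum, rootedSum]

/-- The cloud `Y` either avoids `i`, and is moved to the list `D'`, or meets `i` and is used up in
creating new roots. -/
theorem enorm_rootedSum_cons_le {f : ι → ι → ℝ} (hf : ∀ i j, f i j = f j i) {z : ι → β → ℝ}
    {zt : ι → β → ℝ≥0∞} (Y : β) (hz : Dominated f (fun s => z s Y) (fun s => zt s Y)) {i : ι}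
    {I B : List ι} (hnd : (i :: (I ++ B)).Nodup) (D D' : List β) :
    ‖rootedSum f z i I B (Y :: D) D'‖ₑ ≤ ‖rootedSum f z i I B D (Y :: D')‖ₑ +
      zt i Y * splitSum (fun s => zt s Y) (fun I' B' => ‖rootedSum f z i I' B' D D'‖ₑ) I B := by
  unfold rootedSum
  rw [List.map_cons, List.cons_append]
  refine (enorm_linkedSum_cloud_le hf hz hnd (by simp +contextual)).trans ?_
  gcongr ?_ + zt i Y * ?_
  · rw [linkedSum_perm]
    simp only [List.map_cons, List.cons_append]
    exact List.perm_middle.symm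
  · refine splitSum_mono fun q hq => ?_
    have hperm := perm_append_of_mem_splits (I := I) hq
    rw [List.toFinset_eq_of_perm _ _ hperm, List.toFinset_eq_of_perm _ _ (hperm.cons i)]
    rw [linkedSum_perm]
    exact ((pairEdges_perm hf (hperm.cons i)).symm.append_left _).append_left _

/-- Once no cloud can meet `i`, only its star edges remain. After they are summed, `i` lies on no
hyperedge and can be erased. -/
theorem enorm_rootedSum_nil_le {f : ι → ι → ℝ} (hf : ∀ i j, f i j = f j i)
    (hf1 : ∀ i j, f i j ∈ Set.Icc (-1 : ℝ) 0) {p : ι → ι → ℝ≥0∞} (hp : ∀ i j, ‖f i j‖ₑ ≤ p i j)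
    (z : ι → β → ℝ) {i : ι} {I B : List ι} (hnd : (i :: (I ++ B)).Nodup) (D : List β) :
    ‖rootedSum f z i I B [] D‖ₑ ≤
      splitSum (p i) (fun I' B' => ‖forestSum f z I' B' D‖ₑ) I B := by
  have hi : i ∉ I ++ B := (List.nodup_cons.1 hnd).1
  set C := D.map (fun Y => cloudWeight (fun s => z s Y) (I ++ B).toFinset) with hC
  have h1 : rootedSum f z i I B [] D = linkedSum (insert i I.toFinset) (i :: (I ++ B)).toFinset
      (I.map (edge f i) ++ (B.map (edge f i) ++ (C ++ pairEdges f (I ++ B)))) [] := by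
    unfold rootedSum
    rw [linkedSum_perm]
    simp only [List.map_nil, List.nil_append, pairEdges, List.map_append, List.append_assoc]
    exact (List.perm_append_comm_assoc _ _ _).trans
      ((List.perm_append_comm_assoc _ _ _).append_left _)
  rw [h1]
  refine (enorm_linkedSum_root_edges_le hf1 (by simp) ?_ (by simp +contextual)).trans ?_
  · simp [Finset.insert_subset_insert]
  refine (enorm_linkedSum_edges_le (hp i) (by simp) (by simp) (by simp +contextual)).trans ?_
  unfold splitSum
  refine list_sum_map_le fun q hq => ?_
  gcongr
  have hperm := perm_append_of_mem_splits (I := I) hq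
  have hsub : ∀ x ∈ q.1 ++ I, x ∈ I ++ B := fun x hx =>
    hperm.subset (List.mem_append_left _ hx)
  have hU : ((i :: (I ++ B)).toFinset).erase i = (I ++ B).toFinset := by
    rw [List.toFinset_cons, Finset.erase_insert (by simpa using hi)]
  rw [Finset.union_insert, ← List.toFinset_append, linkedSum_erase_root, hU]
  · unfold forestSum
    dsimp only
    rw [List.toFinset_eq_of_perm _ _ hperm, ← hC,
      linkedSum_perm ((pairEdges_perm hf hperm.symm).append_left C)]
  · simpa using fun h => hi (hsub i h)
  · simp
  · intro c hc A hA
    have hAU : ¬ A ⊆ (I ++ B).toFinset := fun h => hi (by simpa using h hA)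
    rcases List.mem_append.1 hc with hc | hc
    · rw [hC, List.mem_map] at hc
      obtain ⟨Y, _, rfl⟩ := hc
      simp only [cloudWeight, hAU, false_and, if_false]
    · exact edge_eq_zero_of_mem_pairEdges hc hAU

theorem linkedSum_eq_zero_of_not_linked {I U : Finset ι} (h : ∀ hs, ¬ Linked I U hs)
    (cs : List (Finset ι → ℝ)) (hs : List (Finset ι)) : linkedSum I U cs hs = 0 := by
  induction cs generalizing hs with
  | nil => simp [linkedSum, h]
  | cons c cs ih => simp [linkedSum, ih]

/-- Without roots no star can be reached, and without stars no cloud has two neighbours. -/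
theorem enorm_forestSum_nil_le (f : ι → ι → ℝ) (z : ι → β → ℝ) (B : List ι) (D : List β) :
    ‖forestSum f z [] B D‖ₑ ≤ if B = [] ∧ D = [] then 1 else 0 := by
  cases B with
  | nil =>
    cases D with
    | nil =>
      have h : Linked (∅ : Finset ι) ∅ [] := fun S _ hS => absurd hS (by simp)
      simp [forestSum, pairEdges, linkedSum, h]
    | cons Y D =>
      have : ∀ A : Finset ι, cloudWeight (fun s => z s Y) ∅ A = 0 := by
        intro A
        unfold cloudWeight
        rw [if_neg]
        rintro ⟨h1, h2⟩
        rw [Finset.subset_empty] at h1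
        simp [h1] at h2
      simp [forestSum, linkedSum, this]
  | cons b B =>
    unfold forestSum
    rw [linkedSum_eq_zero_of_not_linked]
    · simp
    · intro hs h
      obtain ⟨A, _, hA, _⟩ := h ∅ (by simp) (by
        rw [Finset.empty_ssubset]
        exact ⟨b, by simp⟩)
      simp at hA

end Forest

/-! ### Integration over the clouds for fixed stars -/

section ListSums

variable {α : Type u} [MeasurableSpace α] (μ : Measure α)

theorem lintegral_list_sum {γ δ : Type*} [MeasurableSpace γ] (ρ : Measure γ) (l : List δ)
    (c : δ → ℝ≥0∞) {F : δ → γ → ℝ≥0∞} (hF : ∀ d, Measurable (F d)) :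
    ∫⁻ y, (l.map fun d => c d * F d y).sum ∂ρ = (l.map fun d => c d * ∫⁻ y, F d y ∂ρ).sum := by
  induction l with
  | nil => simp
  | cons d l ih =>
    simp only [List.map_cons, List.sum_cons]
    rw [lintegral_add_left ((hF d).const_mul _), lintegral_const_mul _ (hF d), ih]

theorem tupleIntegral_splitSum {ι : Type*} {n : ℕ} (h : ι → ℝ≥0∞)
    {F : List ι → List ι → List α → ℝ≥0∞}
    (hF : ∀ I B, Measurable fun x : Fin n → α => F I B (List.ofFn x)) (I B : List ι) :
    tupleIntegral μ n (fun l => splitSum h (fun I B => F I B l) I B) =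
      splitSum h (fun I B => tupleIntegral μ n (F I B)) I B :=
  lintegral_list_sum _ (splits B) _ (F := fun q x => F (q.1 ++ I) q.2 (List.ofFn x))
    fun _ => hF _ _

end ListSums

section CloudOp

variable {ι β κ : Type*} [MeasurableSpace β] (ν : Measure β)

theorem splitSum_tsum (h : ι → ℝ≥0∞) (c : κ → ℝ≥0∞) (F : κ → List ι → List ι → ℝ≥0∞)
    (I B : List ι) :
    splitSum h (fun I B => ∑' k, c k * F k I B) I B = ∑' k, c k * splitSum h (F k) I B := by
  have : ∀ l : List (List ι × List ι),
      (l.map fun q => (q.1.map h).prod * ∑' k, c k * F k (q.1 ++ I) q.2).sum =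
        ∑' k, c k * (l.map fun q => (q.1.map h).prod * F k (q.1 ++ I) q.2).sum := by
    intro l
    induction l with
    | nil => simp
    | cons q l ih =>
      simp only [List.map_cons, List.sum_cons, ih, mul_add, ENNReal.tsum_add]
      rw [← ENNReal.tsum_mul_left]
      congr 1
      exact tsum_congr fun k => by ring
  exact this _

theorem measurable_splitSum_right {z : ι → β → ℝ≥0∞} (hz : ∀ s, Measurable (z s))
    (F : List ι → List ι → ℝ≥0∞) (I B : List ι) :
    Measurable fun Y => splitSum (fun s => z s Y) F I B :=
  measurable_list_sum _ fun q _ =>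
    (measurable_list_prod q.1 fun s _ => hz s).mul_const _

theorem cloudOp_tsum [Countable κ] {z : ι → β → ℝ≥0∞} (hz : ∀ s, Measurable (z s)) (i : ι)
    (c : κ → ℝ≥0∞) (F : κ → List ι → List ι → ℝ≥0∞) (I B : List ι) :
    cloudOp ν z i (fun I B => ∑' k, c k * F k I B) I B = ∑' k, c k * cloudOp ν z i (F k) I B := by
  have hm : ∀ k, Measurable fun Y => z i Y * splitSum (fun s => z s Y) (F k) I B :=
    fun k => (hz i).mul (measurable_splitSum_right hz _ _ _)
  unfold cloudOp
  simp only [splitSum_tsum, ← ENNReal.tsum_mul_left]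
  simp only [mul_left_comm (z i _)]
  rw [lintegral_tsum fun k => ((hm k).const_mul _).aemeasurable]
  exact tsum_congr fun k => lintegral_const_mul _ (hm k)

theorem iterate_cloudOp_tsum [Countable κ] {z : ι → β → ℝ≥0∞} (hz : ∀ s, Measurable (z s)) (i : ι)
    (c : κ → ℝ≥0∞) (F : κ → List ι → List ι → ℝ≥0∞) (n : ℕ) :
    (cloudOp ν z i)^[n] (fun I B => ∑' k, c k * F k I B) =
      fun I B => ∑' k, c k * ((cloudOp ν z i)^[n] (F k)) I B := by
  induction n with
  | zero => rfl
  | succ n ih =>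
    simp only [Function.iterate_succ_apply', ih]
    funext I B
    exact cloudOp_tsum ν hz i c (fun k => (cloudOp ν z i)^[n] (F k)) I B

theorem cloudOp_mono {z : ι → β → ℝ≥0∞} {i : ι} {F F' : List ι → List ι → ℝ≥0∞} {I B : List ι}
    (H : ∀ q ∈ splits B, F (q.1 ++ I) q.2 ≤ F' (q.1 ++ I) q.2) :
    cloudOp ν z i F I B ≤ cloudOp ν z i F' I B :=
  lintegral_mono fun _ => mul_le_mul_right (splitSum_mono H) _

/-- `cloudOp` only moves stars from `B` to `I`, so the comparison is needed only on rearrangements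
of `L`; in particular length and absence of repetitions are preserved. -/
theorem iterate_cloudOp_mono {z : ι → β → ℝ≥0∞} {i : ι} {F F' : List ι → List ι → ℝ≥0∞}
    {L : List ι} (H : ∀ I B, (I ++ B).Perm L → F I B ≤ F' I B) (n : ℕ) :
    ∀ I B, (I ++ B).Perm L → ((cloudOp ν z i)^[n] F) I B ≤ ((cloudOp ν z i)^[n] F') I B := by
  induction n with
  | zero => exact H
  | succ n ih =>
    intro I B hp
    simp only [Function.iterate_succ_apply']
    exact cloudOp_mono ν fun q hq => ih _ _ ((perm_append_of_mem_splits hq).trans hp)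

end CloudOp

theorem listIntegral_splitSum_comm {ι : Type*} {β : Type u} [MeasurableSpace β] (ν : Measure β)
    {h : ι → ℝ≥0∞} {F : List ι → List ι → List β → ℝ≥0∞}
    (hF : ∀ I B n, Measurable fun x : Fin n → β => F I B (List.ofFn x)) (I B : List ι) :
    listIntegral ν (fun l => splitSum h (fun I B => F I B l) I B) =
      splitSum h (fun I B => listIntegral ν (F I B)) I B := by
  simp only [listIntegral, splitSum_tsum]
  exact tsum_congr fun n => by rw [tupleIntegral_splitSum ν h (fun I B => hF I B n)]

theorem measurable_cloudWeight {ι : Type*} [DecidableEq ι] {β : Type*} [MeasurableSpace β]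
    {γ : Type*} [MeasurableSpace γ] {z : ι → β → ℝ}
    (hz : ∀ s, Measurable (z s)) {y : γ → β} (hy : Measurable y) (U A : Finset ι) :
    Measurable fun c => cloudWeight (fun s => z s (y c)) U A := by
  unfold cloudWeight
  split_ifs
  · exact Finset.measurable_fun_prod _ fun s _ => (hz s).comp hy
  · exact measurable_const

section Integrated

variable {ι : Type*} [DecidableEq ι] [Fintype ι] {β : Type u} [MeasurableSpace β] (ν : Measure β)

theorem measurable_linkedSum {γ : Type*} [MeasurableSpace γ] (I U : Finset ι)
    {l : List (Finset ι → γ → ℝ)} (h : ∀ c ∈ l, ∀ A, Measurable (c A)) (hs : List (Finset ι)) :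
    Measurable fun y => linkedSum I U (l.map fun c A => c A y) hs := by
  induction l generalizing hs with
  | nil => exact measurable_const
  | cons c l ih =>
    exact Finset.measurable_fun_sum _ fun A _ =>
      (h c (by simp) A).mul (ih (fun c hc => h c (by simp [hc])) _)

theorem listMeasurable_rootedSum (f : ι → ι → ℝ) {z : ι → β → ℝ} (hz : ∀ s, Measurable (z s))
    (i : ι) (I B : List ι) : ListMeasurable₂ fun D D' => ‖rootedSum f z i I B D D'‖ₑ := by
  intro γ _ P Q
  refine Measurable.enorm ?_
  have := measurable_linkedSum (γ := γ) (insert i I.toFinset) (i :: (I ++ B)).toFinset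
    (l := P.map (fun g A c => cloudWeight (fun s => z s (g.1 c)) (i :: (I ++ B)).toFinset A) ++
      (Q.map (fun g A c => cloudWeight (fun s => z s (g.1 c)) (I ++ B).toFinset A) ++
        (pairEdges f (i :: (I ++ B))).map fun e A _ => e A)) ?_ []
  · simpa only [rootedSum, List.map_append, List.map_map, Function.comp_def, List.map_id'] using this
  · intro c hc A
    simp only [List.mem_append, List.mem_map] at hc
    rcases hc with ⟨g, _, rfl⟩ | ⟨g, _, rfl⟩ | ⟨e, _, rfl⟩
    · exact measurable_cloudWeight hz g.2 _ _
    · exact measurable_cloudWeight hz g.2 _ _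
    · exact measurable_const

theorem listMeasurable_forestSum (f : ι → ι → ℝ) {z : ι → β → ℝ} (hz : ∀ s, Measurable (z s))
    (I B : List ι) : ListMeasurable₂ fun D _ => ‖forestSum f z I B D‖ₑ := by
  intro γ _ P _
  refine Measurable.enorm ?_
  have := measurable_linkedSum (γ := γ) I.toFinset (I ++ B).toFinset
    (l := P.map (fun g A c => cloudWeight (fun s => z s (g.1 c)) (I ++ B).toFinset A) ++
        (pairEdges f (I ++ B)).map fun e A _ => e A) ?_ []
  · simpa only [forestSum, List.map_append, List.map_map, Function.comp_def, List.map_id'] using this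
  · intro c hc A
    simp only [List.mem_append, List.mem_map] at hc
    rcases hc with ⟨g, _, rfl⟩ | ⟨e, _, rfl⟩
    · exact measurable_cloudWeight hz g.2 _ _
    · exact measurable_const

theorem measurable_forestSum_ofFn (f : ι → ι → ℝ) {z : ι → β → ℝ} (hz : ∀ s, Measurable (z s))
    (I B : List ι) (n : ℕ) :
    Measurable fun Y : Fin n → β => ‖forestSum f z I B (List.ofFn Y)‖ₑ :=
  (listMeasurable_forestSum f hz I B).ofFn (k := 0) measurable_id (h := fun _ => Fin.elim0)
    measurable_const

/-- The integral of the modulus of `rootedSum` over `n` clouds that may be adjacent to the root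
and `s` clouds that may not. -/
def rootedIntegral (f : ι → ι → ℝ) (z : ι → β → ℝ) (i : ι) (n s : ℕ) (I B : List ι) : ℝ≥0∞ :=
  tupleIntegral ν n fun D => tupleIntegral ν s fun D' => ‖rootedSum f z i I B D D'‖ₑ

variable [SigmaFinite ν]

/-- Integrated form of `enorm_rootedSum_cons_le`: a cloud moves from the first family to the second,
or is absorbed in `cloudOp`. -/
theorem rootedIntegral_succ_le {f : ι → ι → ℝ} (hf : ∀ i j, f i j = f j i) {z : ι → β → ℝ}
    (hz : ∀ s, Measurable (z s)) {zt : ι → β → ℝ≥0∞}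
    (hd : ∀ Y, Dominated f (fun s => z s Y) (fun s => zt s Y)) {i : ι} {I B : List ι}
    (hnd : (i :: (I ++ B)).Nodup) (n s : ℕ) :
    rootedIntegral ν f z i (n + 1) s I B ≤ rootedIntegral ν f z i n (s + 1) I B +
      cloudOp ν zt i (rootedIntegral ν f z i n s) I B := by
  have hF := listMeasurable_rootedSum f hz i
  have hF2 : ∀ I B (D : List β), Measurable fun x : Fin s → β =>
      ‖rootedSum f z i I B D (List.ofFn x)‖ₑ := fun I B D =>
    ((hF I B).diag D).ofFn (k := 0) measurable_id (h := fun _ => Fin.elim0) measurable_const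
  have hF1 : ∀ I B, Measurable fun x : Fin n → β =>
      tupleIntegral ν s fun D' => ‖rootedSum f z i I B (List.ofFn x) D'‖ₑ := fun I B =>
    measurable_tupleIntegral ν ((hF I B).ofFn measurable_fst measurable_snd)
  have mr : Measurable fun x : (β × (Fin n → β)) × (Fin s → β) =>
      ‖rootedSum f z i I B (List.ofFn x.1.2) (x.1.1 :: List.ofFn x.2)‖ₑ :=
    (hF I B).ofFn_cons_right (measurable_fst.comp measurable_fst)
      (measurable_snd.comp measurable_fst) measurable_snd
  have mr' : Measurable fun x : β × (Fin n → β) => tupleIntegral ν s fun D' =>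
      ‖rootedSum f z i I B (List.ofFn x.2) (x.1 :: D')‖ₑ :=
    measurable_tupleIntegral ν (F := fun (x : β × (Fin n → β)) D' =>
      ‖rootedSum f z i I B (List.ofFn x.2) (x.1 :: D')‖ₑ) mr
  have ms : ∀ (D : List β) (y : β), Measurable fun x : Fin s → β =>
      ‖rootedSum f z i I B D (y :: List.ofFn x)‖ₑ := fun D y =>
    (((hF I B).cons_right y).diag D).ofFn (k := 0) measurable_id
      (h := fun _ => Fin.elim0) measurable_const
  have hpt : ∀ y, tupleIntegral ν n (fun D => tupleIntegral ν s fun D' =>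
        ‖rootedSum f z i I B (y :: D) D'‖ₑ) ≤
      tupleIntegral ν n (fun D => tupleIntegral ν s fun D' =>
        ‖rootedSum f z i I B D (y :: D')‖ₑ) +
      zt i y * splitSum (fun t => zt t y) (rootedIntegral ν f z i n s) I B := by
    intro y
    have e1 : ∀ D, tupleIntegral ν s (fun D' => ‖rootedSum f z i I B (y :: D) D'‖ₑ) ≤
        tupleIntegral ν s (fun D' => ‖rootedSum f z i I B D (y :: D')‖ₑ) +
        zt i y * splitSum (fun t => zt t y) (fun I' B' => tupleIntegral ν s fun D' =>
          ‖rootedSum f z i I' B' D D'‖ₑ) I B := by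
      intro D
      refine (tupleIntegral_mono ν fun D' =>
        enorm_rootedSum_cons_le hf y (hd y) hnd D D').trans_eq ?_
      rw [tupleIntegral_add ν (ms D y), tupleIntegral_const_mul, tupleIntegral_splitSum]
      · exact fun I B => hF2 I B D
      · exact measurable_list_sum _ fun q _ => (hF2 _ _ D).const_mul _
    refine (tupleIntegral_mono ν e1).trans_eq ?_
    rw [tupleIntegral_add ν, tupleIntegral_const_mul, tupleIntegral_splitSum]
    · rfl
    · exact fun I B => hF1 I B
    · exact measurable_list_sum _ fun q _ => (hF1 _ _).const_mul _
    · exact mr'.comp (measurable_const.prodMk measurable_id)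
  unfold rootedIntegral
  rw [tupleIntegral_succ]
  · refine (lintegral_mono hpt).trans_eq ?_
    rw [lintegral_add_left (measurable_tupleIntegral ν (F := fun y D => tupleIntegral ν s fun D' =>
      ‖rootedSum f z i I B D (y :: D')‖ₑ) mr'), tupleIntegral_swap ν ν mr']
    congr 1
    unfold tupleIntegral
    refine lintegral_congr fun x => ?_
    exact (tupleIntegral_succ ν (F := fun D' => ‖rootedSum f z i I B (List.ofFn x) D'‖ₑ)
      ((hF I B).ofFn_cons_right (h := fun _ => x) measurable_fst
      measurable_const measurable_snd)).symm
  · exact measurable_tupleIntegral ν (F := fun (x : β × (Fin n → β)) D' =>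
      ‖rootedSum f z i I B (x.1 :: List.ofFn x.2) D'‖ₑ)
      ((hF I B).ofFn_cons_left (measurable_fst.comp measurable_fst)
      (measurable_snd.comp measurable_fst) measurable_snd)

/-- Iterating the two alternatives for each of the `n` clouds produces binomial coefficients by
Pascal's rule: `k` clouds meet the root and `l = n - k` are passed on. -/
theorem rootedIntegral_le {f : ι → ι → ℝ} (hf : ∀ i j, f i j = f j i) {z : ι → β → ℝ}
    (hz : ∀ s, Measurable (z s)) {zt : ι → β → ℝ≥0∞} (hzt : ∀ s, Measurable (zt s))
    (hd : ∀ Y, Dominated f (fun s => z s Y) (fun s => zt s Y)) {i : ι} (n : ℕ) :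
    ∀ {I B : List ι}, (i :: (I ++ B)).Nodup → ∀ s : ℕ,
    rootedIntegral ν f z i n s I B ≤ ∑ kl ∈ Finset.HasAntidiagonal.antidiagonal n,
      (n.choose kl.1 : ℝ≥0∞) *
        ((cloudOp ν zt i)^[kl.1] (rootedIntegral ν f z i 0 (kl.2 + s))) I B := by
  induction n with
  | zero => intro I B _ s; simp
  | succ n ih =>
    intro I B hnd s
    refine (rootedIntegral_succ_le ν hf hz hd hnd n s).trans ?_
    rw [Finset.sum_antidiagonal_choose_succ_mul
      (fun k l => ((cloudOp ν zt i)^[k] (rootedIntegral ν f z i 0 (l + s))) I B) n]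
    refine add_le_add ?_ ?_
    · refine (ih hnd (s + 1)).trans_eq (Finset.sum_congr rfl fun kl _ => ?_)
      rw [add_assoc, add_comm 1 s]
    · refine (cloudOp_mono ν (F' := fun I B => ∑ kl ∈ Finset.HasAntidiagonal.antidiagonal n,
        (n.choose kl.1 : ℝ≥0∞) *
          ((cloudOp ν zt i)^[kl.1] (rootedIntegral ν f z i 0 (kl.2 + s))) I B)
        fun q hq => ih (((perm_append_of_mem_splits hq).cons i).nodup_iff.2 hnd)
        s).trans_eq ?_
      -- The finite sum is written as a series so that `cloudOp_tsum` applies.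
      have h1 : (fun I B => ∑ kl ∈ Finset.HasAntidiagonal.antidiagonal n, (n.choose kl.1 : ℝ≥0∞) *
          ((cloudOp ν zt i)^[kl.1] (rootedIntegral ν f z i 0 (kl.2 + s))) I B) =
          fun I B => ∑' kl : Finset.HasAntidiagonal.antidiagonal n, (n.choose kl.1.1 : ℝ≥0∞) *
          ((cloudOp ν zt i)^[kl.1.1] (rootedIntegral ν f z i 0 (kl.1.2 + s))) I B := by
        funext I B
        rw [Finset.tsum_subtype (Finset.HasAntidiagonal.antidiagonal n) fun kl : ℕ × ℕ =>
          (n.choose kl.1 : ℝ≥0∞) *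
          ((cloudOp ν zt i)^[kl.1] (rootedIntegral ν f z i 0 (kl.2 + s))) I B]
      rw [h1, cloudOp_tsum ν hzt i (fun kl : Finset.HasAntidiagonal.antidiagonal n =>
          (n.choose kl.1.1 : ℝ≥0∞)) (fun kl =>
          ((cloudOp ν zt i)^[kl.1.1] (rootedIntegral ν f z i 0 (kl.1.2 + s)))),
        Finset.tsum_subtype (Finset.HasAntidiagonal.antidiagonal n) fun kl : ℕ × ℕ =>
          (n.choose kl.1 : ℝ≥0∞) * cloudOp ν zt i
          ((cloudOp ν zt i)^[kl.1] (rootedIntegral ν f z i 0 (kl.2 + s))) I B]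
      refine Finset.sum_congr rfl fun kl hkl => ?_
      rw [Function.iterate_succ_apply',
        Nat.choose_symm_of_eq_add (Finset.HasAntidiagonal.mem_antidiagonal.1 hkl).symm]

/-- Induction on the number of stars. The factor `1/n!` makes the clouds at the first root
independent of those left for the remaining forest, which reproduces the recursion of
`branchingWeight`. -/
theorem listIntegral_forestSum_le {f : ι → ι → ℝ} (hf : ∀ i j, f i j = f j i)
    (hf1 : ∀ i j, f i j ∈ Set.Icc (-1 : ℝ) 0) {p : ι → ι → ℝ≥0∞} (hp : ∀ i j, ‖f i j‖ₑ ≤ p i j)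
    {z : ι → β → ℝ} (hz : ∀ s, Measurable (z s)) {zt : ι → β → ℝ≥0∞}
    (hzt : ∀ s, Measurable (zt s)) (hd : ∀ Y, Dominated f (fun s => z s Y) (fun s => zt s Y))
    (q : ℕ) : ∀ {I B : List ι}, (I ++ B).Nodup → (I ++ B).length ≤ q →
    listIntegral ν (fun D => ‖forestSum f z I B D‖ₑ) ≤ branchingWeight ν p zt q I B := by
  have nil : ∀ q B, listIntegral ν (fun D => ‖forestSum f z [] B D‖ₑ) ≤
      branchingWeight ν p zt q [] B := by
    intro q B
    refine (listIntegral_mono ν fun D => enorm_forestSum_nil_le f z B D).trans ?_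
    rw [branchingWeight_nil, listIntegral, tsum_eq_single 0]
    · simp
    · intro n hn
      simp [tupleIntegral, hn]
  induction q with
  | zero =>
    intro I B _ hl
    cases I with
    | nil => exact nil 0 B
    | cons i I => simp at hl
  | succ q ih =>
    intro I B hnd hl
    cases I with
    | nil => exact nil (q + 1) B
    | cons i I =>
      -- After the clouds at `i`, the star edges at `i` are summed and `i` disappears, so the
      -- induction hypothesis applies with one star fewer.
      have h0 : ∀ I' B', (I' ++ B').Perm (I ++ B) →
          ∑' l : ℕ, (l.factorial : ℝ≥0∞)⁻¹ * rootedIntegral ν f z i 0 l I' B' ≤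
          splitSum (p i) (branchingWeight ν p zt q) I' B' := by
        intro I' B' hperm
        have hnd' : (i :: (I' ++ B')).Nodup := (hperm.cons i).nodup_iff.2 hnd
        have e : ∑' l : ℕ, (l.factorial : ℝ≥0∞)⁻¹ * rootedIntegral ν f z i 0 l I' B' =
            listIntegral ν fun D' => ‖rootedSum f z i I' B' [] D'‖ₑ := by
          simp only [rootedIntegral, tupleIntegral_zero, listIntegral]
        rw [e]
        refine (listIntegral_mono ν fun D' =>
          enorm_rootedSum_nil_le hf hf1 hp z hnd' D').trans ?_
        rw [listIntegral_splitSum_comm ν fun I B n => measurable_forestSum_ofFn f hz I B n]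
        refine splitSum_mono fun r hr => ?_
        have hpr := (perm_append_of_mem_splits (I := I') hr).trans hperm
        refine ih (hpr.nodup_iff.2 (List.nodup_cons.1 hnd).2) ?_
        rw [hpr.length_eq]
        simpa using hl
      simp only [forestSum_cons]
      calc listIntegral ν (fun D => ‖rootedSum f z i I B D []‖ₑ) =
          ∑' n : ℕ, (n.factorial : ℝ≥0∞)⁻¹ * rootedIntegral ν f z i n 0 I B := by
            simp only [rootedIntegral, tupleIntegral_zero, listIntegral]
        _ ≤ ∑' n : ℕ, (n.factorial : ℝ≥0∞)⁻¹ * ∑ kl ∈ Finset.HasAntidiagonal.antidiagonal n,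
            (n.choose kl.1 : ℝ≥0∞) *
              ((cloudOp ν zt i)^[kl.1] (rootedIntegral ν f z i 0 kl.2)) I B :=
            ENNReal.tsum_le_tsum fun n => by
              gcongr
              simpa using rootedIntegral_le ν hf hz hzt hd n hnd 0
        _ = ∑' k : ℕ, (k.factorial : ℝ≥0∞)⁻¹ * ((cloudOp ν zt i)^[k]
            (fun I B => ∑' l : ℕ, (l.factorial : ℝ≥0∞)⁻¹ * rootedIntegral ν f z i 0 l I B)) I B := by
            rw [tsum_factorial_antidiagonal fun k l =>
              ((cloudOp ν zt i)^[k] (rootedIntegral ν f z i 0 l)) I B]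
            refine tsum_congr fun k => ?_
            rw [iterate_cloudOp_tsum ν hzt i (fun l : ℕ => (l.factorial : ℝ≥0∞)⁻¹)
              (fun l => rootedIntegral ν f z i 0 l)]
        _ ≤ _ := by
            simp only [branchingWeight]
            refine ENNReal.tsum_le_tsum fun k => ?_
            gcongr
            exact iterate_cloudOp_mono ν h0 k I B (List.Perm.refl _)

end Integrated

/-! ### Expansion of `linkedSum` into explicit choices of hyperedges -/

section Expansion

variable {ι : Type*}

/-- The pairs of entries of a list, in the order of the list. -/
def orderedPairs : List ι → List (ι × ι)
  | [] => []
  | i :: l => l.map (fun j => (i, j)) ++ orderedPairs l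

theorem mem_of_mem_orderedPairs {l : List ι} {e : ι × ι} (he : e ∈ orderedPairs l) :
    e.1 ∈ l ∧ e.2 ∈ l := by
  induction l with
  | nil => simp [orderedPairs] at he
  | cons i l ih =>
    simp only [orderedPairs, List.mem_append, List.mem_map] at he
    rcases he with ⟨j, hj, rfl⟩ | he
    · simp [hj]
    · simp [ih he]

theorem nodup_orderedPairs {l : List ι} (hl : l.Nodup) : (orderedPairs l).Nodup := by
  induction l with
  | nil => simp [orderedPairs]
  | cons i l ih =>
    rw [List.nodup_cons] at hl
    refine List.nodup_append.2 ⟨hl.2.map fun a b h => (Prod.mk.inj h).2, ih hl.2, ?_⟩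
    rintro a ha b hb rfl
    obtain ⟨j, _, rfl⟩ := List.mem_map.1 ha
    exact hl.1 (mem_of_mem_orderedPairs hb).1

theorem mem_orderedPairs_of_pairwise [Preorder ι] {l : List ι} (hl : l.Pairwise (· < ·))
    {e : ι × ι} : e ∈ orderedPairs l ↔ e.1 ∈ l ∧ e.2 ∈ l ∧ e.1 < e.2 := by
  induction l with
  | nil => simp [orderedPairs]
  | cons i l ih =>
    rw [List.pairwise_cons] at hl
    simp only [orderedPairs, List.mem_append, List.mem_map, ih hl.2, List.mem_cons]
    constructor
    · rintro (⟨j, hj, rfl⟩ | ⟨h1, h2, h3⟩)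
      · exact ⟨Or.inl rfl, Or.inr hj, hl.1 j hj⟩
      · exact ⟨Or.inr h1, Or.inr h2, h3⟩
    · rintro ⟨h1 | h1, h2 | h2, h3⟩
      · rw [h1, h2] at h3; exact absurd h3 (lt_irrefl _)
      · exact Or.inl ⟨e.2, h2, by rw [← h1]⟩
      · rw [h2] at h3; exact absurd (h3.trans (hl.1 _ h1)) (lt_irrefl _)
      · exact Or.inr ⟨h1, h2, h3⟩

variable [DecidableEq ι]

theorem pairEdges_eq_map (f : ι → ι → ℝ) (l : List ι) :
    pairEdges f l = (orderedPairs l).map fun e => edge f e.1 e.2 := by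
  induction l with
  | nil => rfl
  | cons i l ih => simp [pairEdges, orderedPairs, ih, Function.comp_def]

variable [Fintype ι]

theorem linkedSum_append_ofFn (I U : Finset ι) (cs : List (Finset ι → ℝ)) {r : ℕ}
    (c : Fin r → Finset ι → ℝ) (hs : List (Finset ι)) :
    linkedSum I U (List.ofFn c ++ cs) hs =
      ∑ J : Fin r → Finset ι, (∏ k, c k (J k)) * linkedSum I U cs (List.ofFn J ++ hs) := by
  induction r generalizing hs with
  | zero => simp
  | succ r ih =>
    rw [← (Fin.consEquiv fun _ => Finset ι).sum_comp, Fintype.sum_prod_type]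
    simp only [List.ofFn_succ, List.cons_append, linkedSum]
    refine Finset.sum_congr rfl fun A _ => ?_
    rw [ih, Finset.mul_sum]
    refine Finset.sum_congr rfl fun J _ => ?_
    simp only [Fin.consEquiv_apply, Fin.prod_univ_succ, Fin.cons_zero, Fin.cons_succ, mul_assoc]
    congr 2
    refine linkedSum_congr' fun t => linked_congr_mem fun C => ?_
    simp only [List.mem_append, List.mem_cons]
    tauto

-- Choosing each optional edge independently amounts to choosing the set `E` of edges that are
-- present.
open Classical in
theorem linkedSum_map_edge (f : ι → ι → ℝ) (I U : Finset ι) {es : List (ι × ι)} (hes : es.Nodup)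
    (hs : List (Finset ι)) :
    linkedSum I U (es.map fun e => edge f e.1 e.2) hs =
      ∑ E ∈ es.toFinset.powerset, (∏ e ∈ E, f e.1 e.2) *
        if Linked I U (E.toList.map (fun e => {e.1, e.2}) ++ hs) then 1 else 0 := by
  induction es generalizing hs with
  | nil => simp [linkedSum]
  | cons e es ih =>
    rw [List.nodup_cons] at hes
    have he : e ∉ es.toFinset := by simpa using hes.1
    rw [List.toFinset_cons, Finset.sum_powerset_insert he]
    simp only [List.map_cons, linkedSum, edge, add_mul, ite_mul, one_mul, zero_mul,
      Finset.sum_add_distrib, Finset.sum_ite_eq', Finset.mem_univ, if_true]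
    rw [linkedSum_empty_cons]
    congr 1
    · convert ih hes.2 hs
    · have h2 := ih hes.2 ({e.1, e.2} :: hs)
      rw [show linkedSum I U (List.map (fun e => edge f e.1 e.2) es) ({e.1, e.2} :: hs) = _ from h2,
        Finset.mul_sum]
      refine Finset.sum_congr rfl fun E hE => ?_
      have heE : e ∉ E := fun h => he (Finset.mem_powerset.1 hE h)
      rw [Finset.prod_insert heE, mul_assoc]
      congr 2
      refine if_congr (linked_congr_mem fun C => ?_) rfl rfl
      simp only [List.mem_append, List.mem_cons, List.mem_map, Finset.mem_toList,
        Finset.mem_insert]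
      constructor
      · rintro (⟨a, ha, rfl⟩ | rfl | h)
        · exact Or.inl ⟨a, Or.inr ha, rfl⟩
        · exact Or.inl ⟨e, Or.inl rfl, rfl⟩
        · exact Or.inr h
      · rintro (⟨a, rfl | ha, rfl⟩ | h)
        · exact Or.inr (Or.inl rfl)
        · exact Or.inl ⟨a, ha, rfl⟩
        · exact Or.inr (Or.inr h)

end Expansion

/-! ### Star-cloud graphs as hypergraphs -/

section Graphs

variable {m r : ℕ}

/-- The graph with the star-star edges `E` in which the cloud `k` is adjacent to the stars
`J k`. -/
def starCloudGraph (E : Finset (Fin m × Fin m)) (J : Fin r → Finset (Fin m)) :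
    SimpleGraph (Fin m ⊕ Fin r) where
  Adj
    | .inl s, .inl t => s ≠ t ∧ ((s, t) ∈ E ∨ (t, s) ∈ E)
    | .inl s, .inr k => s ∈ J k
    | .inr k, .inl s => s ∈ J k
    | .inr _, .inr _ => False
  symm := by
    constructor
    rintro (s | k) (t | l) h
    · exact ⟨h.1.symm, h.2.symm⟩
    · exact h
    · exact h
    · exact h
  loopless := by
    constructor
    rintro (s | k) h
    · exact h.1 rfl
    · exact h

open Classical in
/-- The hyperedges of a graph: its star-star edges and the neighborhoods of its clouds. -/
def graphHyperedges (γ : SimpleGraph (Fin m ⊕ Fin r)) : List (Finset (Fin m)) :=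
  ((Finset.univ.filter fun p : Fin m × Fin m =>
    p.1 < p.2 ∧ γ.Adj (Sum.inl p.1) (Sum.inl p.2)).toList.map fun e => {e.1, e.2}) ++
  List.ofFn fun k : Fin r => Finset.univ.filter fun s => γ.Adj (Sum.inl s) (Sum.inr k)

theorem mem_graphHyperedges_edge {γ : SimpleGraph (Fin m ⊕ Fin r)} {s t : Fin m}
    (h : γ.Adj (Sum.inl s) (Sum.inl t)) : {s, t} ∈ graphHyperedges γ := by
  have hst : s ≠ t := by rintro rfl; exact γ.loopless.irrefl _ h
  simp only [graphHyperedges, List.mem_append, List.mem_map, Finset.mem_toList,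
    Finset.mem_filter, Finset.mem_univ, true_and]
  rcases lt_or_gt_of_ne hst with h1 | h1
  · exact Or.inl ⟨(s, t), ⟨h1, h⟩, rfl⟩
  · exact Or.inl ⟨(t, s), ⟨h1, h.symm⟩, Finset.pair_comm _ _⟩

open Classical in
theorem mem_graphHyperedges_cloud (γ : SimpleGraph (Fin m ⊕ Fin r)) (k : Fin r) :
    (Finset.univ.filter fun s => γ.Adj (Sum.inl s) (Sum.inr k)) ∈ graphHyperedges γ := by
  simp only [graphHyperedges, List.mem_append, List.mem_ofFn]
  exact Or.inr ⟨k, rfl⟩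

/-- A path through a cloud is a step within one hyperedge. Conversely, linkedness applied to the set
of stars reachable from `i` shows that this set contains every star, and every cloud has a
neighbouring star. -/
theorem connected_iff_linked {γ : SimpleGraph (Fin m ⊕ Fin r)} (hγ : IsStarCloudGraph γ)
    (i : Fin m) : γ.Connected ↔ Linked {i} Finset.univ (graphHyperedges γ) := by
  classical
  constructor
  · intro h S hS hSU
    by_contra hno
    push Not at hno
    obtain ⟨t, _, ht⟩ := Finset.exists_of_ssubset hSU
    -- If no hyperedge left `S`, the stars of `S` together with the clouds touching `S` would be
    -- closed under adjacency.
    let T : Set (Fin m ⊕ Fin r) := fun v => match v with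
      | .inl s => s ∈ S
      | .inr k => ∃ s ∈ S, γ.Adj (Sum.inl s) (Sum.inr k)
    have hclosed : ∀ u v, T u → γ.Adj u v → T v := by
      rintro (s | k) (t | l) hu huv
      · by_contra htS
        have := hno _ (mem_graphHyperedges_edge huv) ⟨s, by simp; exact hu⟩
        exact Finset.notMem_empty t (this ▸ (by simpa using htS))
      · exact ⟨s, hu, huv⟩
      · obtain ⟨s, hs, hsk⟩ := hu
        by_contra htS
        have := hno _ (mem_graphHyperedges_cloud γ k) ⟨s, by simp [hs, hsk]⟩
        refine Finset.notMem_empty t (this ▸ ?_)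
        simp only [Finset.mem_inter, Finset.mem_filter, Finset.mem_univ, true_and,
          Finset.mem_sdiff]
        exact ⟨huv.symm, htS⟩
      · exact absurd huv (hγ.no_cloud_edge k l)
    have hall : ∀ v, T v := by
      intro v
      have hr := (SimpleGraph.reachable_iff_reflTransGen _ _).1 (h.preconnected (Sum.inl i) v)
      induction hr with
      | refl => exact hS (Finset.mem_singleton_self i)
      | tail _ hbc ih => exact hclosed _ _ ih hbc
    exact ht (hall (Sum.inl t))
  · intro h
    have hstar : ∀ s, γ.Reachable (Sum.inl i) (Sum.inl s) := by
      by_contra hne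
      push Not at hne
      obtain ⟨t, ht⟩ := hne
      obtain ⟨A, hA, ⟨s, hs⟩, u, hu⟩ := h
        (Finset.univ.filter fun s => γ.Reachable (Sum.inl i) (Sum.inl s))
        (by simp) (by
          rw [Finset.ssubset_univ_iff]
          intro he
          have := he ▸ Finset.mem_univ t
          exact ht (by simpa using this))
      simp only [Finset.mem_inter, Finset.mem_filter, Finset.mem_univ, true_and,
        Finset.mem_sdiff] at hs hu
      simp only [graphHyperedges, List.mem_append, List.mem_map, Finset.mem_toList,
        Finset.mem_filter, Finset.mem_univ, true_and, List.mem_ofFn] at hA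
      rcases hA with ⟨e, he, rfl⟩ | ⟨k, rfl⟩
      · simp only [Finset.mem_insert, Finset.mem_singleton] at hs hu
        have hadj := he.2
        rcases hs.1 with rfl | rfl <;> rcases hu.1 with rfl | rfl
        · exact hu.2 hs.2
        · exact hu.2 (hs.2.trans hadj.reachable)
        · exact hu.2 (hs.2.trans hadj.symm.reachable)
        · exact hu.2 hs.2
      · simp only [Finset.mem_filter, Finset.mem_univ, true_and] at hs hu
        exact hu.2 (hs.2.trans (hs.1.reachable.trans hu.1.symm.reachable))
    rw [SimpleGraph.connected_iff_exists_forall_reachable]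
    refine ⟨Sum.inl i, ?_⟩
    rintro (s | k)
    · exact hstar s
    · obtain ⟨s, t, _, hs, _⟩ := hγ.two_stars k
      exact (hstar s).trans hs.reachable

theorem filter_adj_starCloudGraph {E : Finset (Fin m × Fin m)} (hE : ∀ p ∈ E, p.1 < p.2)
    (J : Fin r → Finset (Fin m)) [DecidablePred fun p : Fin m × Fin m =>
      p.1 < p.2 ∧ (starCloudGraph E J).Adj (Sum.inl p.1) (Sum.inl p.2)] :
    (Finset.univ.filter fun p : Fin m × Fin m =>
      p.1 < p.2 ∧ (starCloudGraph E J).Adj (Sum.inl p.1) (Sum.inl p.2)) = E := by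
  ext p
  rw [Finset.mem_filter]
  simp only [starCloudGraph, Finset.mem_univ, true_and]
  constructor
  · rintro ⟨h, _, h1 | h1⟩
    · exact h1
    · exact absurd (hE _ h1) h.asymm
  · exact fun h => ⟨hE p h, (hE p h).ne, Or.inl h⟩

theorem mem_graphHyperedges_starCloudGraph {E : Finset (Fin m × Fin m)}
    (hE : ∀ p ∈ E, p.1 < p.2) (J : Fin r → Finset (Fin m)) (A : Finset (Fin m)) :
    A ∈ graphHyperedges (starCloudGraph E J) ↔
      A ∈ E.toList.map (fun e => {e.1, e.2}) ++ (List.ofFn J ++ []) := by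
  classical
  unfold graphHyperedges
  rw [filter_adj_starCloudGraph hE]
  have : (fun k : Fin r => Finset.univ.filter fun s =>
      (starCloudGraph E J).Adj (Sum.inl s) (Sum.inr k)) = J := by
    funext k
    ext s
    rw [Finset.mem_filter]
    simp [starCloudGraph]
  rw [this, List.append_nil]

theorem isStarCloudGraph_starCloudGraph_iff (E : Finset (Fin m × Fin m))
    (J : Fin r → Finset (Fin m)) :
    IsStarCloudGraph (starCloudGraph E J) ↔ ∀ k, 2 ≤ (J k).card := by
  constructor
  · intro h k
    obtain ⟨s, t, hst, hs, ht⟩ := h.two_stars k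
    exact Finset.one_lt_card.2 ⟨s, hs, t, ht, hst⟩
  · intro h
    refine ⟨fun k l hkl => hkl, fun k => ?_⟩
    obtain ⟨s, hs, t, ht, hst⟩ := Finset.one_lt_card.1 (h k)
    exact ⟨s, t, hst, hs, ht⟩

-- The termwise comparison of the two sums; both sides vanish if some cloud has fewer than two
-- neighbours.
open Classical in
theorem weight_starCloudGraph (f : Fin m → Fin m → ℝ) (z : Fin m → Fin r → ℝ) (i : Fin m)
    {E : Finset (Fin m × Fin m)} (hE : ∀ p ∈ E, p.1 < p.2) (J : Fin r → Finset (Fin m)) :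
    (∏ k, cloudWeight (fun s => z s k) Finset.univ (J k)) * ((∏ e ∈ E, f e.1 e.2) *
        if Linked {i} Finset.univ (E.toList.map (fun e => {e.1, e.2}) ++ (List.ofFn J ++ []))
        then 1 else 0) =
      if IsStarCloudGraph (starCloudGraph E J) ∧ (starCloudGraph E J).Connected then
        (∏ p : Fin m × Fin m with p.1 < p.2 ∧
          (starCloudGraph E J).Adj (Sum.inl p.1) (Sum.inl p.2), f p.1 p.2) *
        ∏ p : Fin m × Fin r with (starCloudGraph E J).Adj (Sum.inl p.1) (Sum.inr p.2),
          z p.1 p.2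
      else 0 := by
  by_cases h : ∀ k, 2 ≤ (J k).card
  · have hS := (isStarCloudGraph_starCloudGraph_iff E J).2 h
    have hL : (starCloudGraph E J).Connected ↔ Linked {i} Finset.univ
        (E.toList.map (fun e => {e.1, e.2}) ++ (List.ofFn J ++ [])) :=
      (connected_iff_linked hS i).trans
        (linked_congr_mem (mem_graphHyperedges_starCloudGraph hE J))
    have hprod : ∏ p : Fin m × Fin r with (starCloudGraph E J).Adj (Sum.inl p.1) (Sum.inr p.2),
        z p.1 p.2 = ∏ k, cloudWeight (fun s => z s k) Finset.univ (J k) := by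
      rw [Finset.prod_filter, Fintype.prod_prod_type_right]
      refine Finset.prod_congr rfl fun k _ => ?_
      rw [← Finset.prod_filter, cloudWeight, if_pos ⟨Finset.subset_univ _, h k⟩]
      congr 1
      ext s
      rw [Finset.mem_filter]
      simp [starCloudGraph]
    rw [filter_adj_starCloudGraph hE, hprod]
    simp only [hS, true_and, hL]
    split_ifs
    · ring
    · simp
  · have hS : ¬ IsStarCloudGraph (starCloudGraph E J) := fun hS =>
      h ((isStarCloudGraph_starCloudGraph_iff E J).1 hS)
    push Not at h
    obtain ⟨k, hk⟩ := h
    rw [Finset.prod_eq_zero (Finset.mem_univ k), zero_mul]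
    · simp [hS]
    · rw [cloudWeight, if_neg]
      rintro ⟨_, h2⟩
      omega

open Classical in
/-- The sum over connected star-cloud graphs as a sum over choices of hyperedges. -/
theorem sum_graphs_eq_linkedSum (f : Fin m → Fin m → ℝ) (z : Fin m → Fin r → ℝ) (i : Fin m) :
    ∑ γ : SimpleGraph (Fin m ⊕ Fin r) with IsStarCloudGraph γ ∧ γ.Connected,
      (∏ p : Fin m × Fin m with p.1 < p.2 ∧ γ.Adj (Sum.inl p.1) (Sum.inl p.2), f p.1 p.2) *
        ∏ p : Fin m × Fin r with γ.Adj (Sum.inl p.1) (Sum.inr p.2), z p.1 p.2 =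
    linkedSum {i} Finset.univ
      (List.ofFn (fun k => cloudWeight (fun s => z s k) Finset.univ) ++
        pairEdges f (List.finRange m)) [] := by
  have hpairs : (orderedPairs (List.finRange m)).toFinset =
      Finset.univ.filter fun p : Fin m × Fin m => p.1 < p.2 := by
    ext e
    rw [List.mem_toFinset, mem_orderedPairs_of_pairwise (List.pairwise_lt_finRange m)]
    simp
  -- The graph sum is extended by zeros to all graphs without cloud-cloud edges, since exactly these
  -- correspond to arbitrary pairs of neighbourhoods `J` and edge sets `E`.
  have hsub : (Finset.univ.filter fun γ : SimpleGraph (Fin m ⊕ Fin r) =>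
      IsStarCloudGraph γ ∧ γ.Connected) ⊆ Finset.univ.filter fun γ =>
        ∀ k l : Fin r, ¬ γ.Adj (Sum.inr k) (Sum.inr l) := by
    intro γ hγ
    simp only [Finset.mem_filter, Finset.mem_univ, true_and] at hγ ⊢
    exact hγ.1.no_cloud_edge
  rw [linkedSum_append_ofFn, pairEdges_eq_map]
  simp only [linkedSum_map_edge f _ _ (nodup_orderedPairs (List.nodup_finRange m)), hpairs,
    Finset.mul_sum]
  rw [← Finset.sum_product', ← Finset.inter_eq_right.2 hsub, ← Finset.filter_mem_eq_inter,
    Finset.sum_filter]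
  simp only [Finset.mem_filter, Finset.mem_univ, true_and]
  symm
  refine Finset.sum_bij' (fun q _ => starCloudGraph q.2 q.1)
    (fun γ _ => (fun k => Finset.univ.filter fun s => γ.Adj (Sum.inl s) (Sum.inr k),
      Finset.univ.filter fun p : Fin m × Fin m =>
        p.1 < p.2 ∧ γ.Adj (Sum.inl p.1) (Sum.inl p.2))) ?_ ?_ ?_ ?_ ?_
  · intro q _
    simp [starCloudGraph]
  · intro γ _
    simp only [Finset.mem_product, Finset.mem_univ, true_and, Finset.mem_powerset]
    exact fun p hp => by simp_all
  · rintro ⟨J, E⟩ hq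
    have hE : ∀ p ∈ E, p.1 < p.2 := fun p hp => by
      have := (Finset.mem_powerset.1 (Finset.mem_product.1 hq).2) hp
      simpa using this
    refine Prod.ext ?_ (filter_adj_starCloudGraph hE J)
    funext k
    ext s
    rw [Finset.mem_filter]
    simp [starCloudGraph]
  · intro γ hγ
    simp only [Finset.mem_filter, Finset.mem_univ, true_and] at hγ
    ext u v
    rcases u with s | k <;> rcases v with t | l
    · simp only [starCloudGraph, Finset.mem_filter, Finset.mem_univ, true_and]
      constructor
      · rintro ⟨_, h | h⟩
        · exact h.2
        · exact h.2.symm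
      · intro h
        have hst : s ≠ t := by rintro rfl; exact γ.loopless.irrefl _ h
        refine ⟨hst, ?_⟩
        rcases lt_or_gt_of_ne hst with h1 | h1
        · exact Or.inl ⟨h1, h⟩
        · exact Or.inr ⟨h1, h.symm⟩
    · simp [starCloudGraph]
    · simp [starCloudGraph, γ.adj_comm]
    · simp [starCloudGraph, hγ k l]
  · rintro ⟨J, E⟩ hq
    have hE : ∀ p ∈ E, p.1 < p.2 := fun p hp => by
      have := (Finset.mem_powerset.1 (Finset.mem_product.1 hq).2) hp
      simpa using this
    exact weight_starCloudGraph f z i hE J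

end Graphs

/-! ### A cloud as the root -/

section CloudRoot

variable {ι β : Type*} [DecidableEq ι] [Fintype ι]

/-- Being connected does not depend on the choice of root. In both directions, a test set `S` on the
wrong side of `i` or `A` is replaced by its complement `U \ S`, which the same hyperedges leave. -/
theorem linkedSum_singleton_cons {U A : Finset ι} {i : ι} (hi : i ∈ U) (hA : A.Nonempty)
    (hAU : A ⊆ U) (cs : List (Finset ι → ℝ)) (hs : List (Finset ι)) :
    linkedSum {i} U cs (A :: hs) = linkedSum A U cs hs := by
  refine linkedSum_congr' fun t => ?_
  simp only [Linked, List.mem_append, List.mem_cons, Finset.singleton_subset_iff]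
  constructor
  · intro h S hS hSU
    have aux : ∀ B : Finset ι, (B = A → False) → (B ∈ t ∨ B = A ∨ B ∈ hs) → (B ∈ t ∨ B ∈ hs) := by
      tauto
    by_cases hiS : i ∈ S
    · obtain ⟨B, hB, h1, y, hy⟩ := h S hiS hSU
      refine ⟨B, aux B ?_ hB, h1, y, hy⟩
      rintro rfl
      simp only [Finset.mem_inter, Finset.mem_sdiff] at hy
      exact hy.2.2 (hS hy.1)
    · obtain ⟨B, hB, ⟨y, hy⟩, z, hz⟩ := h (U \ S) (by simp [hi, hiS]) (by
        rw [Finset.ssubset_iff_of_subset Finset.sdiff_subset]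
        obtain ⟨a, ha⟩ := hA
        exact ⟨a, hAU ha, by simp [hS ha]⟩)
      rw [Finset.sdiff_sdiff_eq_self hSU.1] at hz
      refine ⟨B, aux B ?_ hB, ⟨z, hz⟩, y, hy⟩
      rintro rfl
      simp only [Finset.mem_inter, Finset.mem_sdiff] at hy
      exact hy.2.2 (hS hy.1)
  · intro h S hiS hSU
    have aux : ∀ B : Finset ι, (B ∈ t ∨ B ∈ hs) → (B ∈ t ∨ B = A ∨ B ∈ hs) := by tauto
    by_cases h1 : (A ∩ S).Nonempty
    · by_cases h2 : (A ∩ (U \ S)).Nonempty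
      · exact ⟨A, Or.inr (Or.inl rfl), h1, h2⟩
      · obtain ⟨B, hB, h3⟩ := h S (fun a ha => by
          by_contra haS
          exact h2 ⟨a, by simp [ha, hAU ha, haS]⟩) hSU
        exact ⟨B, aux B hB, h3⟩
    · obtain ⟨B, hB, h3, h4⟩ := h (U \ S) (fun a ha => by
          have : a ∉ S := fun haS => h1 ⟨a, by simp [ha, haS]⟩
          simp [hAU ha, this]) (by
        rw [Finset.ssubset_iff_of_subset Finset.sdiff_subset]
        exact ⟨i, hi, by simp [hiS]⟩)
      rw [Finset.sdiff_sdiff_eq_self hSU.1] at h4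
      exact ⟨B, aux B hB, h4, h3⟩

/-- The neighbours of the root cloud become the roots of a forest. Their weight is bounded by
`prod_le`, unless two of them exclude each other and the forest sum vanishes. -/
theorem enorm_linkedSum_cloud_root_le {f : ι → ι → ℝ} (hf : ∀ i j, f i j = f j i)
    {z : ι → β → ℝ} {zt : ι → β → ℝ≥0∞} (Y : β)
    (hz : Dominated f (fun s => z s Y) (fun s => zt s Y)) {L : List ι} (hL : L.Nodup)
    {i : ι} (hi : i ∈ L) (D : List β) :
    ‖linkedSum {i} L.toFinset ((Y :: D).map (fun Y => cloudWeight (fun s => z s Y) L.toFinset) ++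
      pairEdges f L) []‖ₑ ≤
      splitSum (fun s => zt s Y) (fun I B => ‖forestSum f z I B D‖ₑ) [] L := by
  set cs := D.map (fun Y => cloudWeight (fun s => z s Y) L.toFinset) ++ pairEdges f L with hcs
  have h1 : linkedSum {i} L.toFinset ((Y :: D).map
        (fun Y => cloudWeight (fun s => z s Y) L.toFinset) ++ pairEdges f L) [] =
      ∑ A ∈ L.toFinset.powerset, (if 2 ≤ A.card then ∏ s ∈ A, z s Y else 0) *
        linkedSum A L.toFinset cs [] := by
    rw [List.map_cons, List.cons_append, ← hcs, linkedSum]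
    rw [← Finset.sum_subset (Finset.subset_univ L.toFinset.powerset)]
    · refine Finset.sum_congr rfl fun A hA => ?_
      rw [Finset.mem_powerset] at hA
      by_cases h2 : 2 ≤ A.card
      · rw [linkedSum_singleton_cons (by simpa using hi) (Finset.card_pos.1 (by omega)) hA]
        simp [cloudWeight, hA, h2]
      · simp [cloudWeight, h2]
    · intro A _ hA
      have : ¬ A ⊆ L.toFinset := by simpa using hA
      simp [cloudWeight, this]
  rw [h1, sum_powerset_splits (fun A => (if 2 ≤ A.card then ∏ s ∈ A, z s Y else 0) *
        linkedSum A L.toFinset cs []) hL]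
  refine (enorm_list_sum_le _ _).trans ?_
  unfold splitSum
  refine list_sum_map_le fun q hq => ?_
  have hperm := perm_of_mem_splits hq
  have hq1 : q.1.Nodup := (List.nodup_append.1 (hperm.nodup_iff.2 hL)).1
  have hsub : ∀ a ∈ q.1, a ∈ L := fun a ha => hperm.subset (List.mem_append_left _ ha)
  have hlin : linkedSum q.1.toFinset L.toFinset cs [] = forestSum f z q.1 q.2 D := by
    unfold forestSum
    rw [List.toFinset_eq_of_perm _ _ hperm, hcs,
      linkedSum_perm ((pairEdges_perm hf hperm.symm).append_left _)]
  rw [hlin, enorm_mul, List.append_nil, List.toFinset_card_of_nodup hq1,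
    List.prod_toFinset _ hq1]
  by_cases h0 : forestSum f z q.1 q.2 D = 0
  · simp [h0]
  gcongr
  split_ifs with h2
  · rw [enorm_list_prod]
    refine hz.prod_le q.1 hq1 h2 (List.Pairwise.imp_of_mem (R := fun a b => a ≠ b) ?_ hq1)
    intro a b ha hb hab hfab
    refine h0 (hlin ▸ linkedSum_eq_zero_of_edge ?_ (List.mem_toFinset.2 ha)
      (List.mem_toFinset.2 hb) hfab (List.mem_append_right _
        (edge_mem_pairEdges hf (hsub a ha) (hsub b hb) hab)) [])
    intro x hx
    rw [List.mem_toFinset] at hx ⊢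
    exact hsub x hx
  · simp

end CloudRoot

/-! ### The modified Ursell functions and their bounds for fixed stars -/

section Model

variable {X : Type u} {Xl Xs : Set X}

theorem ursellStar_eq_linkedSum (f : X → X → ℝ) {M r : ℕ} (x : Fin (M + 1) → Xl)
    (Y : Fin r → Cloud Xs) :
    ursellStar f x Y = linkedSum {0} Finset.univ
      (List.ofFn (fun k => cloudWeight (fun s => zeta f (x s) (Y k)) Finset.univ) ++
        pairEdges (fun i j => f (x i) (x j)) (List.finRange (M + 1))) [] :=
  sum_graphs_eq_linkedSum (fun i j => f (x i) (x j)) (fun s k => zeta f (x s) (Y k)) 0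

/-- Star 0 is the root. The weights `z` have to agree with `zeta` only at the given clouds, which
leaves room for a cutoff elsewhere. -/
theorem ursellStar_eq_forestSum (f : X → X → ℝ) {M r : ℕ} (x : Fin (M + 1) → Xl)
    (Y : Fin r → Cloud Xs) {z : Fin (M + 1) → Cloud Xs → ℝ}
    (hz : ∀ k s, z s (Y k) = zeta f (x s) (Y k)) :
    ursellStar f x Y = forestSum (fun i j => f (x i) (x j)) z [0]
      ((List.finRange M).map Fin.succ) (List.ofFn Y) := by
  have h : [0] ++ (List.finRange M).map Fin.succ = List.finRange (M + 1) := by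
    rw [List.finRange_succ]; rfl
  have hU : (List.finRange (M + 1)).toFinset = Finset.univ := by ext; simp
  rw [ursellStar_eq_linkedSum, forestSum, h, hU, List.map_ofFn]
  simp [Function.comp_def, hz]

theorem enorm_ursellStar_cons_le (f : X → X → ℝ) (hf : ∀ x y, f x y = f y x) {M r : ℕ}
    (x : Fin (M + 1) → Xl) (Y₁ : Cloud Xs) (Y : Fin r → Cloud Xs)
    {z : Fin (M + 1) → Cloud Xs → ℝ} (hz₁ : ∀ s, z s Y₁ = zeta f (x s) Y₁)
    (hz : ∀ k s, z s (Y k) = zeta f (x s) (Y k)) {zt : Fin (M + 1) → Cloud Xs → ℝ≥0∞}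
    (hd : Dominated (fun i j => f (x i) (x j)) (fun s => z s Y₁) (fun s => zt s Y₁)) :
    ‖ursellStar f x (Fin.cons Y₁ Y : Fin (r + 1) → Cloud Xs)‖ₑ ≤
      splitSum (fun s => zt s Y₁)
        (fun I B => ‖forestSum (fun i j => f (x i) (x j)) z I B (List.ofFn Y)‖ₑ) []
        (List.finRange (M + 1)) := by
  have hU : (List.finRange (M + 1)).toFinset = Finset.univ := by ext; simp
  refine le_trans (le_of_eq ?_) (enorm_linkedSum_cloud_root_le (fun i j => hf _ _) Y₁ hd
    (List.nodup_finRange (M + 1)) (List.mem_finRange 0) (List.ofFn Y))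
  rw [ursellStar_eq_linkedSum, hU]
  simp [List.ofFn_succ, Function.comp_def, hz, hz₁]

/-- The domination conditions hold at the cloud `Y` for all subfamilies of the stars `x`. -/
def Compatible (f : X → X → ℝ) (ζt : Xl → Cloud Xs → ℝ) {m : ℕ} (x : Fin m → Xl)
    (Y : Cloud Xs) : Prop :=
  ∀ (n : ℕ) (σ : Fin (n + 2) → Fin m), Function.Injective σ →
    boltzmann f (fun i => x (σ i)) * ∏ i, |zeta f (x (σ i)) Y| ≤
      boltzmann f (fun i => x (σ i)) * ∏ i, |ζt (x (σ i)) Y| ∧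
    |zeta f (x (σ 0)) Y| * boltzmann f (fun i => x (σ i)) *
        |∏ j : Fin (n + 1), (1 + zeta f (x (σ j.succ)) Y) - 1| ≤
      |ζt (x (σ 0)) Y| * boltzmann f (fun i => x (σ i))

theorem zeta_mem_Icc {f : X → X → ℝ} (hf : ∀ x y, f x y ∈ Set.Icc (-1 : ℝ) 0) (x : Xl)
    (Y : Cloud Xs) : zeta f x Y ∈ Set.Icc (-1 : ℝ) 0 := by
  have h0 : 0 ≤ ∏ j, (1 + f x (Y.2 j)) :=
    Finset.prod_nonneg fun j _ => by linarith [(hf x (Y.2 j)).1]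
  have h1 : ∏ j, (1 + f x (Y.2 j)) ≤ 1 :=
    Finset.prod_le_one (fun j _ => by linarith [(hf x (Y.2 j)).1])
      fun j _ => by linarith [(hf x (Y.2 j)).2]
  constructor <;> unfold zeta <;> linarith

theorem boltzmann_pos {f : X → X → ℝ} (hf : ∀ x y, f x y ∈ Set.Icc (-1 : ℝ) 0) {k : ℕ}
    {x : Fin k → Xl} (h : ∀ i j, i < j → f (x i) (x j) ≠ -1) : 0 < boltzmann f x := by
  refine Finset.prod_pos fun p hp => ?_
  have h1 := h p.1 p.2 (Finset.mem_filter.1 hp).2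
  have h2 := lt_of_le_of_ne (hf (x p.1) (x p.2)).1 h1.symm
  linarith

/-- For stars that do not exclude each other, the Boltzmann factor is positive and can be divided
out. Lists without repetition are injective tuples, and for `J = []` the left side of `reduced_le`
is zero. -/
theorem Compatible.dominated {f : X → X → ℝ} (hf : ∀ x y, f x y ∈ Set.Icc (-1 : ℝ) 0)
    {ζt : Xl → Cloud Xs → ℝ} {m : ℕ} {x : Fin m → Xl} {Y : Cloud Xs}
    (h : Compatible f ζt x Y) :
    Dominated (fun i j => f (x i) (x j)) (fun s => zeta f (x s) Y) (fun s => ‖ζt (x s) Y‖ₑ) := by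
  have tuple : ∀ (l : List (Fin m)) (k : ℕ), l.length = k → ∃ σ : Fin k → Fin m,
      List.ofFn σ = l := by
    rintro l _ rfl
    exact ⟨l.get, List.ofFn_get l⟩
  refine ⟨fun s => zeta_mem_Icc hf _ _, ?_, ?_⟩
  · intro l hl h2 hp
    obtain ⟨n, hn⟩ := Nat.exists_eq_add_of_le h2
    obtain ⟨σ, rfl⟩ := tuple l (n + 2) (by omega)
    rw [List.nodup_ofFn] at hl
    rw [List.pairwise_ofFn] at hp
    have hb := boltzmann_pos hf (x := fun i => x (σ i)) hp
    have h1 := le_of_mul_le_mul_left (h n σ hl).1 hb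
    simp only [List.map_ofFn, List.prod_ofFn, Function.comp_def, Real.enorm_eq_ofReal_abs]
    rw [← ENNReal.ofReal_prod_of_nonneg fun _ _ => abs_nonneg _,
      ← ENNReal.ofReal_prod_of_nonneg fun _ _ => abs_nonneg _]
    exact ENNReal.ofReal_le_ofReal h1
  · intro i J hl hp
    cases J with
    | nil => simp
    | cons j J =>
      obtain ⟨σ, hσ⟩ := tuple (i :: j :: J) (J.length + 2) (by simp)
      rw [← hσ, List.nodup_ofFn] at hl
      rw [← hσ, List.pairwise_ofFn] at hp
      rw [List.ofFn_succ, List.cons.injEq] at hσ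
      rw [← hσ.1, ← hσ.2]
      have hb := boltzmann_pos hf (x := fun i => x (σ i)) hp
      have h1 := (h J.length σ hl).2
      rw [mul_right_comm] at h1
      have h2 := le_of_mul_le_mul_right h1 hb
      simp only [List.map_ofFn, List.prod_ofFn, Function.comp_def, Real.enorm_eq_ofReal_abs]
      rw [← ENNReal.ofReal_mul (abs_nonneg _)]
      exact ENNReal.ofReal_le_ofReal h2

theorem Dominated.mono {ι : Type*} {f : ι → ι → ℝ} {z : ι → ℝ} {zt zt' : ι → ℝ≥0∞}
    (h : Dominated f z zt) (hle : ∀ s, zt s ≤ zt' s) : Dominated f z zt' := by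
  refine ⟨h.mem_Icc, fun l h1 h2 h3 => (h.prod_le l h1 h2 h3).trans ?_,
    fun i J h1 h2 => (h.reduced_le i J h1 h2).trans (hle i)⟩
  clear h1 h2 h3
  induction l with
  | nil => simp
  | cons s l ih => simpa using mul_le_mul' (hle s) ih

theorem dominated_zero {ι : Type*} (f : ι → ι → ℝ) (zt : ι → ℝ≥0∞) :
    Dominated f (fun _ => 0) zt := by
  refine ⟨by simp, fun l _ h2 _ => ?_, by simp⟩
  cases l with
  | nil => simp at h2
  | cons s l => simp

open Classical in
/-- The weights at the clouds, set to zero outside of `G`. -/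
def cutoffZeta (f : X → X → ℝ) (G : Set (Cloud Xs)) (x : Xl) (Y : Cloud Xs) : ℝ :=
  if Y ∈ G then zeta f x Y else 0

/-- Outside `G` the weights vanish and domination is trivial, so it holds at every cloud, as the
combinatorial estimates require. -/
theorem dominated_cutoffZeta {f : X → X → ℝ} (hf : ∀ x y, f x y ∈ Set.Icc (-1 : ℝ) 0)
    {ζt : Xl → Cloud Xs → ℝ} {m : ℕ} {x : Fin m → Xl} {G : Set (Cloud Xs)}
    (hG : ∀ Y ∈ G, Compatible f ζt x Y) {zt : Xl → Cloud Xs → ℝ≥0∞}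
    (hzt : ∀ Y ∈ G, ∀ s, ‖ζt (x s) Y‖ₑ ≤ zt (x s) Y) (Y : Cloud Xs) :
    Dominated (fun i j => f (x i) (x j)) (fun s => cutoffZeta f G (x s) Y)
      (fun s => zt (x s) Y) := by
  by_cases hY : Y ∈ G
  · simp only [cutoffZeta, hY, if_true]
    exact ((hG Y hY).dominated hf).mono (hzt Y hY)
  · simp only [cutoffZeta, hY, if_false]
    exact dominated_zero _ _

variable [MeasurableSpace X]

theorem measurable_cutoffZeta {f : X → X → ℝ} {G : Set (Cloud Xs)} (hG : MeasurableSet G) {x : Xl}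
    (h : Measurable fun Y : Cloud Xs => zeta f x Y) : Measurable (cutoffZeta f G x) :=
  Measurable.ite hG h measurable_const

variable (ν : Measure (Cloud Xs)) [SigmaFinite ν] {f : X → X → ℝ}

/-- Almost every tuple of clouds lies in `G`, so the cutoff does not change the integrals and
`listIntegral_forestSum_le` applies. -/
theorem tsum_ursellStar_le (hsymm : ∀ x y, f x y = f y x)
    (hf : ∀ x y, f x y ∈ Set.Icc (-1 : ℝ) 0) {ζt : Xl → Cloud Xs → ℝ} {M : ℕ}
    {x : Fin (M + 1) → Xl} {G : Set (Cloud Xs)} (hGm : MeasurableSet G)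
    (hGae : ∀ᵐ Y ∂ν, Y ∈ G) (hG : ∀ Y ∈ G, Compatible f ζt x Y)
    {p : Xl → Xl → ℝ≥0∞} (hp : ∀ i j, ‖f (x i) (x j)‖ₑ ≤ p (x i) (x j))
    {zt : Xl → Cloud Xs → ℝ≥0∞} (hzt : ∀ Y ∈ G, ∀ s, ‖ζt (x s) Y‖ₑ ≤ zt (x s) Y)
    (hztm : ∀ s, Measurable (zt s)) (hzm : ∀ s : Xl, Measurable fun Y : Cloud Xs => zeta f s Y)
    {q : ℕ} (hq : M + 1 ≤ q) :
    ∑' R : ℕ, (R.factorial : ℝ≥0∞)⁻¹ *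
      ∫⁻ Y : Fin R → Cloud Xs, ‖ursellStar f x Y‖ₑ ∂(Measure.pi fun _ => ν) ≤
    branchingWeight ν p zt q [x 0] (List.ofFn fun i : Fin M => x i.succ) := by
  have key := listIntegral_forestSum_le ν (f := fun i j => f (x i) (x j)) (fun i j => hsymm _ _)
    (fun i j => hf _ _) (p := fun i j => p (x i) (x j)) hp (z := fun s => cutoffZeta f G (x s))
    (fun s => measurable_cutoffZeta hGm (hzm _)) (zt := fun s => zt (x s)) (fun s => hztm _)
    (dominated_cutoffZeta hf hG hzt) q (I := [0]) (B := (List.finRange M).map Fin.succ)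
    (by
      have := List.nodup_finRange (M + 1)
      rw [List.finRange_succ] at this
      exact this) (by simpa [add_comm] using hq)
  -- From the labels in `Fin (M + 1)` to the positions `x`.
  rw [branchingWeight_map ν x p zt q] at key
  have hB : ((List.finRange M).map Fin.succ).map x = List.ofFn fun i : Fin M => x i.succ := by
    rw [List.map_map, List.ofFn_eq_map]; rfl
  rw [hB] at key
  refine le_trans (ENNReal.tsum_le_tsum fun R => ?_) key
  gcongr
  refine lintegral_mono_ae ?_
  have hall : ∀ᵐ Y : Fin R → Cloud Xs ∂(Measure.pi fun _ => ν), ∀ k, Y k ∈ G :=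
    ae_all_iff.2 fun k => (Measure.quasiMeasurePreserving_eval (fun _ => ν) k).ae hGae
  filter_upwards [hall] with Y hY
  rw [ursellStar_eq_forestSum f x Y (z := fun s => cutoffZeta f G (x s))]
  intro k s
  simp [cutoffZeta, hY k]

/-- The neighbours of `Y₁` are summed first; the remaining clouds are then integrated in a forest
rooted at these neighbours. -/
theorem tsum_ursellStar_cons_le (hsymm : ∀ x y, f x y = f y x)
    (hf : ∀ x y, f x y ∈ Set.Icc (-1 : ℝ) 0) {ζt : Xl → Cloud Xs → ℝ} {M : ℕ}
    {x : Fin (M + 1) → Xl} {G : Set (Cloud Xs)} (hGm : MeasurableSet G)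
    (hGae : ∀ᵐ Y ∂ν, Y ∈ G) (hG : ∀ Y ∈ G, Compatible f ζt x Y)
    {p : Xl → Xl → ℝ≥0∞} (hp : ∀ i j, ‖f (x i) (x j)‖ₑ ≤ p (x i) (x j))
    {zt : Xl → Cloud Xs → ℝ≥0∞} (hzt : ∀ Y ∈ G, ∀ s, ‖ζt (x s) Y‖ₑ ≤ zt (x s) Y)
    (hztm : ∀ s, Measurable (zt s)) (hzm : ∀ s : Xl, Measurable fun Y : Cloud Xs => zeta f s Y)
    {q : ℕ} (hq : M + 1 ≤ q) {Y₁ : Cloud Xs} (hY₁ : Y₁ ∈ G) :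
    ∑' R : ℕ, (R.factorial : ℝ≥0∞)⁻¹ *
      ∫⁻ Y : Fin R → Cloud Xs, ‖ursellStar f x (Fin.cons Y₁ Y : Fin (R + 1) → Cloud Xs)‖ₑ
        ∂(Measure.pi fun _ => ν) ≤
    splitSum (fun s => zt s Y₁) (branchingWeight ν p zt q) [] (List.ofFn x) := by
  have hd := dominated_cutoffZeta hf hG hzt
  have hzc : ∀ s, Measurable (cutoffZeta f G (x s)) := fun s => measurable_cutoffZeta hGm (hzm _)
  calc _ ≤ listIntegral ν (fun D => splitSum (fun s => zt (x s) Y₁)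
        (fun I B => ‖forestSum (fun i j => f (x i) (x j)) (fun s => cutoffZeta f G (x s))
          I B D‖ₑ) [] (List.finRange (M + 1))) := by
        refine ENNReal.tsum_le_tsum fun R => ?_
        gcongr
        refine lintegral_mono_ae ?_
        have hall : ∀ᵐ Y : Fin R → Cloud Xs ∂(Measure.pi fun _ => ν), ∀ k, Y k ∈ G :=
          ae_all_iff.2 fun k => (Measure.quasiMeasurePreserving_eval (fun _ => ν) k).ae hGae
        filter_upwards [hall] with Y hY
        exact enorm_ursellStar_cons_le f hsymm x Y₁ Y (z := fun s => cutoffZeta f G (x s))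
          (fun s => by simp [cutoffZeta, hY₁]) (fun k s => by simp [cutoffZeta, hY k])
          (zt := fun s => zt (x s)) (hd Y₁)
    _ = splitSum (fun s => zt (x s) Y₁) (fun I B => listIntegral ν
        (fun D => ‖forestSum (fun i j => f (x i) (x j)) (fun s => cutoffZeta f G (x s))
          I B D‖ₑ)) [] (List.finRange (M + 1)) :=
        listIntegral_splitSum_comm ν (fun I B n => measurable_forestSum_ofFn _ hzc I B n) _ _
    _ ≤ splitSum (fun s => zt (x s) Y₁) (branchingWeight ν (fun i j => p (x i) (x j))
          (fun s => zt (x s)) q) [] (List.finRange (M + 1)) := by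
        refine splitSum_mono fun r hr => ?_
        have hperm := perm_append_of_mem_splits (I := []) hr
        rw [List.nil_append] at hperm
        exact listIntegral_forestSum_le ν (fun i j => hsymm _ _) (fun i j => hf _ _)
          (p := fun i j => p (x i) (x j)) hp hzc (fun s => hztm _) hd q
          (hperm.nodup_iff.2 (List.nodup_finRange _)) (by rw [hperm.length_eq]; simpa using hq)
    _ = _ := by
        rw [List.ofFn_eq_map]
        exact splitSum_map x (fun s => zt s Y₁) (branchingWeight_map ν x p zt q) _ _

end Model

/-! ### Measures on clouds and on tuples -/

section Measures

theorem measurableSet_sigma {ι : Type*} {α : ι → Type*} [∀ i, MeasurableSpace (α i)]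
    {s : Set (Sigma α)} (h : ∀ i, MeasurableSet (Sigma.mk i ⁻¹' s)) : MeasurableSet s := by
  rw [Sigma.instMeasurableSpace, MeasurableSpace.measurableSet_iInf]
  exact h

theorem measurable_sigmaMk {ι : Type*} {α : ι → Type*} [∀ i, MeasurableSpace (α i)] (i : ι) :
    Measurable (Sigma.mk i : α i → Sigma α) := by
  intro s hs
  rw [Sigma.instMeasurableSpace, MeasurableSpace.measurableSet_iInf] at hs
  exact hs i

theorem measurableEmbedding_sigmaMk {ι : Type*} {α : ι → Type*} [∀ i, MeasurableSpace (α i)]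
    (i : ι) : MeasurableEmbedding (Sigma.mk i : α i → Sigma α) := by
  refine ⟨sigma_mk_injective, measurable_sigmaMk i, fun s hs => measurableSet_sigma fun j => ?_⟩
  by_cases hij : i = j
  · subst hij
    rwa [Set.preimage_image_eq _ sigma_mk_injective]
  · convert MeasurableSet.empty
    ext y
    simp only [Set.mem_preimage, Set.mem_image, Sigma.mk.injEq, Set.mem_empty_iff_false, iff_false]
    rintro ⟨x, -, h, -⟩
    exact hij h

/-- The `n`-th exhausting set meets only the components up to `n`, each in its `n`-th spanning set,
so its measure is a finite sum of finite terms. -/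
theorem sigmaFinite_sum_map_sigmaMk {α : ℕ → Type*} [∀ i, MeasurableSpace (α i)]
    (ρ : ∀ i, Measure (α i)) [∀ i, SigmaFinite (ρ i)] :
    SigmaFinite (Measure.sum fun i => (ρ i).map (Sigma.mk i : α i → Sigma α)) := by
  let S : ℕ → Set (Sigma α) := fun n => {Y | Y.1 ≤ n ∧ Y.2 ∈ spanningSets (ρ Y.1) n}
  have hpre : ∀ n i, (Sigma.mk i ⁻¹' S n : Set (α i)) =
      if i ≤ n then spanningSets (ρ i) n else ∅ := by
    intro n i
    ext y
    by_cases h : i ≤ n <;> simp [S, h]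
  have hS : ∀ n, MeasurableSet (S n) := fun n => measurableSet_sigma fun i => by
    rw [hpre]
    split_ifs
    exacts [measurableSet_spanningSets _ _, MeasurableSet.empty]
  refine ⟨⟨⟨S, fun _ => trivial, fun n => ?_, ?_⟩⟩⟩
  · rw [Measure.sum_apply _ (hS n), tsum_eq_sum (s := Finset.range (n + 1))]
    · refine ENNReal.sum_lt_top.2 fun i _ => ?_
      rw [Measure.map_apply (measurable_sigmaMk i) (hS n), hpre]
      split_ifs
      exacts [measure_spanningSets_lt_top _ _, by simp]
    · intro i hi
      rw [Measure.map_apply (measurable_sigmaMk i) (hS n), hpre, if_neg (by simpa using hi)]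
      simp
  · refine Set.eq_univ_of_forall fun ⟨i, y⟩ => ?_
    have : y ∈ ⋃ n, spanningSets (ρ i) n := by rw [iUnion_spanningSets]; trivial
    obtain ⟨n, hn⟩ := Set.mem_iUnion.1 this
    exact Set.mem_iUnion.2 ⟨max i n, le_max_left _ _,
      monotone_spanningSets _ (le_max_right _ _) hn⟩

theorem pi_absolutelyContinuous {α : Type u} [MeasurableSpace α] {μ μ' : Measure α}
    [SigmaFinite μ] [SigmaFinite μ'] (h : μ ≪ μ') (n : ℕ) :
    (Measure.pi fun _ : Fin n => μ) ≪ Measure.pi fun _ : Fin n => μ' := by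
  induction n with
  | zero =>
    rw [Measure.pi_of_empty, Measure.pi_of_empty]
  | succ n ih =>
    have h1 := measurePreserving_piFinSuccAbove (fun _ : Fin (n + 1) => μ) 0
    have h2 := measurePreserving_piFinSuccAbove (fun _ : Fin (n + 1) => μ') 0
    rw [← (h1.symm _).map_eq, ← (h2.symm _).map_eq]
    exact (h.prod ih).map (MeasurableEquiv.measurable _)

theorem quasiMeasurePreserving_comp_equiv {α : Type u} [MeasurableSpace α] (μ : Measure α)
    [SigmaFinite μ] {n m : ℕ} {p : Fin m → Prop} [DecidablePred p] (e : Fin n ≃ {j // p j}) :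
    Measure.QuasiMeasurePreserving (fun (x : Fin m → α) (i : Fin n) => x (e i))
      (Measure.pi fun _ => μ) (Measure.pi fun _ => μ) := by
  have h1 := (measurePreserving_piEquivPiSubtypeProd (fun _ : Fin m => μ) p).quasiMeasurePreserving
  have h2 := (Measure.quasiMeasurePreserving_fst (μ := Measure.pi fun _ : {j // p j} => μ)
    (ν := Measure.pi fun _ : {j // ¬ p j} => μ))
  have h3 := ((measurePreserving_piCongrLeft (fun _ : {j // p j} => μ) e).symm
    _).quasiMeasurePreserving
  exact h3.comp (h2.comp h1)

/-- Selecting distinct coordinates pulls null sets back to null sets, so conditions on `k`-tuples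
pass to all subfamilies of a larger tuple. -/
theorem quasiMeasurePreserving_comp_injective {α : Type u} [MeasurableSpace α] (μ : Measure α)
    [SigmaFinite μ] {n m : ℕ} {σ : Fin n → Fin m} (hσ : Function.Injective σ) :
    Measure.QuasiMeasurePreserving (fun (x : Fin m → α) (i : Fin n) => x (σ i))
      (Measure.pi fun _ => μ) (Measure.pi fun _ => μ) := by
  classical
  exact quasiMeasurePreserving_comp_equiv μ (p := (· ∈ Set.range σ)) (Equiv.ofInjective σ hσ)

theorem sigmaFinite_onSubset {X : Type*} [MeasurableSpace X] (m : Measure X) [SigmaFinite m]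
    {A : Set X} (hA : MeasurableSet A) : SigmaFinite (onSubset m A) := by
  refine SigmaFinite.of_map _ (f := (Subtype.val : A → X)) measurable_subtype_coe.aemeasurable ?_
  rw [onSubset, map_comap_subtype_coe hA]
  infer_instance

variable {X : Type*} [MeasurableSpace X]

theorem sigmaFinite_effVariation (f : X → X → ℝ) (m : Measure X) [SigmaFinite m] (θ : X → ℂ)
    {Xl : Set X} (Xs : Set X) (hXl : MeasurableSet Xl) :
    SigmaFinite (effVariation f m θ Xl Xs) := by
  have := sigmaFinite_onSubset m hXl
  exact SigmaFinite.withDensity_of_ne_top' fun _ => enorm_ne_top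

theorem sigmaFinite_cloudVariation (f : X → X → ℝ) (m : Measure X) [SigmaFinite m]
    {Xs : Set X} (hXs : MeasurableSet Xs) : SigmaFinite (cloudVariation f m Xs) := by
  have := sigmaFinite_onSubset m hXs
  have h : ∀ k : ℕ, SigmaFinite (((k + 1).factorial : ℝ≥0∞)⁻¹ •
      (Measure.pi fun _ : Fin (k + 1) => onSubset m Xs).withDensity
        (fun y => ‖ursell f (fun j => (y j : X))‖ₑ)) := by
    intro k
    rw [← withDensity_smul' _ _ (by simp [Nat.factorial_ne_zero])]
    refine SigmaFinite.withDensity_of_ne_top' fun y => ?_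
    exact ENNReal.mul_ne_top (by simp [Nat.factorial_ne_zero]) enorm_ne_top
  exact sigmaFinite_sum_map_sigmaMk _

end Measures

/-! ### Properties of Mayer's function and measurability -/

section Mayer

variable {X : Type*}

theorem mayer_mem_Icc (v : X → X → ℝ≥0∞) (x y : X) : mayer v x y ∈ Set.Icc (-1 : ℝ) 0 := by
  unfold mayer
  split_ifs
  · simp
  · exact ⟨by linarith [Real.exp_pos (-(v x y).toReal)],
      by linarith [Real.exp_le_one_iff.2 (neg_nonpos.2 (ENNReal.toReal_nonneg (a := v x y)))]⟩

theorem mayer_symm {v : X → X → ℝ≥0∞} (h : ∀ x y, v x y = v y x) (x y : X) :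
    mayer v x y = mayer v y x := by
  rw [mayer, mayer, h]

variable [MeasurableSpace X]

theorem measurable_mayer {v : X → X → ℝ≥0∞} (hv : Measurable (Function.uncurry v)) :
    Measurable (Function.uncurry (mayer v)) := by
  have : Function.uncurry (mayer v) = fun q => if Function.uncurry v q = ∞ then -1 else
      Real.exp (-(Function.uncurry v q).toReal) - 1 := rfl
  rw [this]
  refine Measurable.ite (hv (measurableSet_singleton _)) measurable_const ?_
  exact (Real.measurable_exp.comp hv.ennreal_toReal.neg).sub_const _

/-- Preimages are countable unions of images under measurable embeddings of the components, so each
component can be tested separately. -/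
theorem measurable_prod_sigma {γ δ : Type*} [MeasurableSpace γ] [MeasurableSpace δ] {ι : Type*}
    [Countable ι] {α : ι → Type*} [∀ i, MeasurableSpace (α i)] {g : γ × Sigma α → δ}
    (h : ∀ i, Measurable fun q : γ × α i => g (q.1, ⟨i, q.2⟩)) : Measurable g := by
  intro s hs
  have : g ⁻¹' s = ⋃ i, Prod.map id (Sigma.mk i) ''
      ((fun q : γ × α i => g (q.1, ⟨i, q.2⟩)) ⁻¹' s) := by
    ext ⟨c, i, y⟩
    simp only [Set.mem_preimage, Set.mem_iUnion, Set.mem_image, Prod.map, Prod.mk.injEq, id]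
    constructor
    · exact fun H => ⟨i, (c, y), H, rfl, rfl⟩
    · rintro ⟨j, ⟨c', y'⟩, H, rfl, h'⟩
      rw [← h']; exact H
  rw [this]
  exact MeasurableSet.iUnion fun i =>
    (MeasurableEmbedding.id.prodMap (measurableEmbedding_sigmaMk i)).measurableSet_image' (h i hs)

theorem measurable_zeta {f : X → X → ℝ} (hf : Measurable (Function.uncurry f)) {Xl Xs : Set X} :
    Measurable fun q : Xl × Cloud Xs => zeta f q.1 q.2 := by
  refine measurable_prod_sigma fun k => ?_
  have h : ∀ j : Fin (k + 1), Measurable fun q : Xl × (Fin (k + 1) → Xs) =>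
      f (q.1 : X) (q.2 j : X) := fun j =>
    hf.comp ((measurable_subtype_coe.comp measurable_fst).prodMk
      (measurable_subtype_coe.comp ((measurable_pi_apply j).comp measurable_snd)))
  have h' : Measurable fun q : Xl × (Fin (k + 1) → Xs) => ∏ j, (1 + f q.1 (q.2 j)) - 1 :=
    (Finset.measurable_prod Finset.univ fun j _ => (h j).const_add 1).sub_const 1
  exact h'

theorem measurableSet_compatible {f : X → X → ℝ} (hf : Measurable (Function.uncurry f))
    {Xl Xs : Set X} {ζt : Xl → Cloud Xs → ℝ} (hζt : Measurable (Function.uncurry ζt)) {m : ℕ} :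
    MeasurableSet {q : (Fin m → Xl) × Cloud Xs | Compatible f ζt q.1 q.2} := by
  have hs : ∀ s, Measurable fun q : (Fin m → Xl) × Cloud Xs => (q.1 s, q.2) := fun s =>
    ((measurable_pi_apply s).comp measurable_fst).prodMk measurable_snd
  have hz : ∀ s, Measurable fun q : (Fin m → Xl) × Cloud Xs => zeta f (q.1 s) q.2 := fun s =>
    (measurable_zeta hf (Xl := Xl) (Xs := Xs)).comp (hs s)
  have ht : ∀ s, Measurable fun q : (Fin m → Xl) × Cloud Xs => ζt (q.1 s) q.2 := fun s =>
    hζt.comp (hs s)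
  have hp : ∀ s t, Measurable fun q : (Fin m → Xl) × Cloud Xs => f (q.1 s : X) (q.1 t : X) :=
    fun s t => hf.comp
      ((measurable_subtype_coe.comp ((measurable_pi_apply s).comp measurable_fst)).prodMk
        (measurable_subtype_coe.comp ((measurable_pi_apply t).comp measurable_fst)))
  have hb : ∀ {n : ℕ} (σ : Fin n → Fin m),
      Measurable fun q : (Fin m → Xl) × Cloud Xs => boltzmann f fun i => q.1 (σ i) := fun σ =>
    Finset.measurable_prod _ fun e _ => (hp _ _).const_add 1
  unfold Compatible
  simp only [Set.ofPred_forall]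
  refine MeasurableSet.iInter fun n => MeasurableSet.iInter fun σ => MeasurableSet.iInter fun _ => ?_
  have h1 : MeasurableSet {q : (Fin m → Xl) × Cloud Xs |
      boltzmann f (fun i => q.1 (σ i)) * ∏ i, |zeta f (q.1 (σ i)) q.2| ≤
        boltzmann f (fun i => q.1 (σ i)) * ∏ i, |ζt (q.1 (σ i)) q.2|} :=
    measurableSet_le
      ((hb σ).mul (Finset.measurable_prod Finset.univ fun i _ =>
        measurable_norm.comp (hz (σ i))))
      ((hb σ).mul (Finset.measurable_prod Finset.univ fun i _ =>
        measurable_norm.comp (ht (σ i))))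
  have h2 : MeasurableSet {q : (Fin m → Xl) × Cloud Xs |
      |zeta f (q.1 (σ 0)) q.2| * boltzmann f (fun i => q.1 (σ i)) *
          |∏ j : Fin (n + 1), (1 + zeta f (q.1 (σ j.succ)) q.2) - 1| ≤
        |ζt (q.1 (σ 0)) q.2| * boltzmann f (fun i => q.1 (σ i))} :=
    measurableSet_le
      (((measurable_norm.comp (hz (σ 0))).mul (hb σ)).mul
        (measurable_norm.comp ((Finset.measurable_prod Finset.univ fun (i : Fin (n + 1)) _ =>
          (hz (σ i.succ)).const_add 1).sub_const 1)))
      ((measurable_norm.comp (ht (σ 0))).mul (hb σ))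
  exact h1.inter h2

/-- There are countably many sizes `k` and selections `σ`, so the almost sure conditions hold
simultaneously for all subfamilies. -/
theorem ReducedZeta.ae_compatible {X : Type u} [MeasurableSpace X] {f : X → X → ℝ} {m : Measure X}
    [SigmaFinite m] {Xl Xs : Set X} (hXl : MeasurableSet Xl) {ζt : Xl → Cloud Xs → ℝ}
    (h : ReducedZeta f m ζt) (n : ℕ) :
    ∀ᵐ x : Fin n → Xl ∂(Measure.pi fun _ => onSubset m Xl), ∀ᵐ Y ∂(cloudVariation f m Xs),
      Compatible f ζt x Y := by
  have := sigmaFinite_onSubset m hXl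
  have H : ∀ᵐ x : Fin n → Xl ∂(Measure.pi fun _ => onSubset m Xl),
      ∀ (k : ℕ) (σ : Fin (k + 2) → Fin n) (_ : Function.Injective σ), _ :=
    ae_all_iff.2 fun k => ae_all_iff.2 fun σ => ae_all_iff.2 fun hσ =>
      (quasiMeasurePreserving_comp_injective (onSubset m Xl) hσ).ae (h k)
  filter_upwards [H] with x hx
  exact ae_all_iff.2 fun k => ae_all_iff.2 fun σ => ae_all_iff.2 fun hσ => hx k σ hσ

end Mayer

/-! ### Summation over the number of stars -/

/-- The depth `q` must exceed the number of stars, so partial sums are bounded at a finite depth and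
the uniformity of `c` in `q` gives the series. `F q 0` supplies the subtracted 1. The shift `k` is 0
for a root star, which itself counts towards `m ≥ 2`, and 1 for a root cloud, where the term with
one star is dropped. -/
theorem tsum_le_sub_one {t : ℕ → ℝ≥0∞} {F : ℕ → ℕ → ℝ≥0∞} {c : ℝ≥0∞} (k : ℕ)
    (h0 : ∀ q, 1 ≤ F (q + 1) 0) (h : ∀ q M, M + k + 2 ≤ q → t M ≤ F q (M + k + 1))
    (hF : ∀ q, ∑' n, F q n ≤ c) : ∑' M, t M ≤ c - 1 := by
  refine ENNReal.tsum_le_of_sum_range_le fun N => ?_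
  -- The terms `M < N` need depth at most `N + k + 1`.
  refine ENNReal.le_sub_of_add_le_left ENNReal.one_ne_top (le_trans ?_ (hF (N + k + 1)))
  rw [tsum_eq_zero_add' ENNReal.summable]
  refine add_le_add (h0 _) ?_
  calc ∑ M ∈ Finset.range N, t M ≤ ∑ M ∈ Finset.range N, F (N + k + 1) (M + k + 1) :=
        Finset.sum_le_sum fun M hM => h _ _ (by have := Finset.mem_range.1 hM; omega)
    _ ≤ ∑' M, F (N + k + 1) (M + k + 1) := ENNReal.sum_le_tsum _
    _ ≤ ∑' n, F (N + k + 1) (n + 1) :=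
        ENNReal.tsum_comp_le_tsum_of_injective (add_left_injective k)
          (fun n => F (N + k + 1) (n + 1))

theorem ae_ae_cons {α : Type u} [MeasurableSpace α] (μ : Measure α) [SigmaFinite μ] {n : ℕ}
    {P : (Fin (n + 1) → α) → Prop} (h : ∀ᵐ x ∂(Measure.pi fun _ => μ), P x) :
    ∀ᵐ x₁ ∂μ, ∀ᵐ x : Fin n → α ∂(Measure.pi fun _ => μ), P (Fin.cons x₁ x) := by
  have h1 := ((measurePreserving_piFinSuccAbove (fun _ : Fin (n + 1) => μ) 0).symm
    _).quasiMeasurePreserving.ae h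
  have h2 := Measure.ae_ae_of_ae_prod h1
  filter_upwards [h2] with x₁ hx
  filter_upwards [hx] with x hx
  simpa [MeasurableEquiv.piFinSuccAbove, Fin.insertNthEquiv] using hx

section Bounds

variable {X : Type u} [MeasurableSpace X] {Xl Xs : Set X} {f : X → X → ℝ}

/-- Combines the bound for fixed stars with the fixed point bound. The almost sure conditions are
stated for `lam`, the integrals use `μ ≪ lam`. -/
theorem ae_star_tsum_le (lam μ : Measure Xl) [SigmaFinite lam] [SigmaFinite μ] (hac : μ ≪ lam)
    (ν : Measure (Cloud Xs)) [SigmaFinite ν] (hfm : Measurable (Function.uncurry f))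
    (hsymm : ∀ x y, f x y = f y x) (hf : ∀ x y, f x y ∈ Set.Icc (-1 : ℝ) 0)
    {ζt : Xl → Cloud Xs → ℝ} (hζt : Measurable (Function.uncurry ζt))
    (hcomp : ∀ n, ∀ᵐ x : Fin n → Xl ∂(Measure.pi fun _ => lam), ∀ᵐ Y ∂ν, Compatible f ζt x Y)
    {p : Xl → Xl → ℝ≥0∞} (hpm : Measurable (Function.uncurry p))
    {zt : Xl → Cloud Xs → ℝ≥0∞} (hztm : Measurable (Function.uncurry zt))
    {S : Set (Cloud Xs)} (hSm : MeasurableSet S) (hS : ∀ᵐ Y ∂ν, Y ∈ S)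
    (hdom : ∀ᵐ x : Xl ∂lam, (∀ x' : Xl, ‖f x x'‖ₑ ≤ p x x') ∧ ∀ Y ∈ S, ‖ζt x Y‖ₑ ≤ zt x Y)
    {A : Xl → ℝ≥0∞} (hA : Measurable A) {B : Cloud Xs → ℝ≥0∞} (hBm : Measurable B)
    (hB : ∀ Y, expSeries (∫⁻ t, zt t Y * A t ∂μ) ≤ B Y)
    (hA' : ∀ i, expSeries (∫⁻ Y, zt i Y * B Y ∂ν) * expSeries (∫⁻ t, p i t * A t ∂μ) ≤ A i) :
    ∀ᵐ x₁ ∂lam, ∑' M : ℕ, ((M + 1).factorial : ℝ≥0∞)⁻¹ *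
      ∫⁻ x : Fin (M + 1) → Xl, (∑' R : ℕ, (R.factorial : ℝ≥0∞)⁻¹ *
        ∫⁻ Y : Fin R → Cloud Xs, ‖ursellStar f (Fin.cons x₁ x : Fin (M + 2) → Xl) Y‖ₑ
          ∂(Measure.pi fun _ => ν)) ∂(Measure.pi fun _ => μ) ≤ A x₁ - 1 := by
  have hdom' : ∀ n, ∀ᵐ x : Fin n → Xl ∂(Measure.pi fun _ => lam), ∀ i,
      (∀ x' : Xl, ‖f (x i) x'‖ₑ ≤ p (x i) x') ∧ ∀ Y ∈ S, ‖ζt (x i) Y‖ₑ ≤ zt (x i) Y := fun n =>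
    ae_all_iff.2 fun i => (Measure.quasiMeasurePreserving_eval (fun _ => lam) i).ae hdom
  have hall := ae_all_iff.2 fun M : ℕ => ae_ae_cons lam ((hcomp (M + 2)).and (hdom' (M + 2)))
  filter_upwards [hall] with x₁ hx₁
  refine tsum_le_sub_one 0 (F := fun q n => (n.factorial : ℝ≥0∞)⁻¹ *
    tupleIntegral μ n (branchingWeight ν p zt q [x₁])) (fun q => ?_) (fun q M hq => ?_)
    (fun q => (listIntegral_branchingWeight_le μ ν hpm hztm hA hBm hB hA' q [x₁]).trans (by simp))
  · simpa using one_le_branchingWeight ν p zt q x₁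
  · gcongr
    refine lintegral_mono_ae ?_
    filter_upwards [(pi_absolutelyContinuous hac (M + 1)).ae_le (hx₁ M)] with x hx
    obtain ⟨hc, hd⟩ := hx
    refine tsum_ursellStar_le ν hsymm hf (x := (Fin.cons x₁ x : Fin (M + 2) → Xl))
      (G := S ∩ {Y | Compatible f ζt (Fin.cons x₁ x : Fin (M + 2) → Xl) Y})
      (hSm.inter (measurable_prodMk_left (measurableSet_compatible hfm hζt)))
      (hS.and hc) (fun Y hY => hY.2) (fun i j => (hd i).1 _)
      (fun Y hY s => (hd s).2 Y hY.1) (fun s => hztm.comp measurable_prodMk_left)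
      (fun s => (measurable_zeta hfm).comp measurable_prodMk_left) hq

theorem ae_cloud_tsum_le (lam μ : Measure Xl) [SigmaFinite lam] [SigmaFinite μ] (hac : μ ≪ lam)
    (ν : Measure (Cloud Xs)) [SigmaFinite ν] (hfm : Measurable (Function.uncurry f))
    (hsymm : ∀ x y, f x y = f y x) (hf : ∀ x y, f x y ∈ Set.Icc (-1 : ℝ) 0)
    {ζt : Xl → Cloud Xs → ℝ} (hζt : Measurable (Function.uncurry ζt))
    (hcomp : ∀ n, ∀ᵐ x : Fin n → Xl ∂(Measure.pi fun _ => lam), ∀ᵐ Y ∂ν, Compatible f ζt x Y)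
    {p : Xl → Xl → ℝ≥0∞} (hpm : Measurable (Function.uncurry p))
    {zt : Xl → Cloud Xs → ℝ≥0∞} (hztm : Measurable (Function.uncurry zt))
    {S : Set (Cloud Xs)} (hSm : MeasurableSet S) (hS : ∀ᵐ Y ∂ν, Y ∈ S)
    (hdom : ∀ᵐ x : Xl ∂lam, (∀ x' : Xl, ‖f x x'‖ₑ ≤ p x x') ∧ ∀ Y ∈ S, ‖ζt x Y‖ₑ ≤ zt x Y)
    {A : Xl → ℝ≥0∞} (hA : Measurable A) {B : Cloud Xs → ℝ≥0∞} (hBm : Measurable B)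
    (hB : ∀ Y, expSeries (∫⁻ t, zt t Y * A t ∂μ) ≤ B Y)
    (hA' : ∀ i, expSeries (∫⁻ Y, zt i Y * B Y ∂ν) * expSeries (∫⁻ t, p i t * A t ∂μ) ≤ A i) :
    ∀ᵐ Y₁ ∂ν, ∑' M : ℕ, ((M + 2).factorial : ℝ≥0∞)⁻¹ *
      ∫⁻ x : Fin (M + 2) → Xl, (∑' R : ℕ, (R.factorial : ℝ≥0∞)⁻¹ *
        ∫⁻ Y : Fin R → Cloud Xs, ‖ursellStar f x (Fin.cons Y₁ Y : Fin (R + 1) → Cloud Xs)‖ₑ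
          ∂(Measure.pi fun _ => ν)) ∂(Measure.pi fun _ => μ) ≤ B Y₁ - 1 := by
  have hdom' : ∀ n, ∀ᵐ x : Fin n → Xl ∂(Measure.pi fun _ => lam), ∀ i,
      (∀ x' : Xl, ‖f (x i) x'‖ₑ ≤ p (x i) x') ∧ ∀ Y ∈ S, ‖ζt (x i) Y‖ₑ ≤ zt (x i) Y := fun n =>
    ae_all_iff.2 fun i => (Measure.quasiMeasurePreserving_eval (fun _ => lam) i).ae hdom
  -- The root cloud is fixed before the stars, so the two almost-everywhere quantifiers are
  -- exchanged; this uses joint measurability of compatibility.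
  have hswap := ae_all_iff.2 fun n : ℕ => (Measure.ae_ae_comm
    (measurableSet_compatible hfm hζt (m := n))).1 (hcomp n)
  filter_upwards [hswap, hS] with Y₁ hY₁ hY₁S
  refine tsum_le_sub_one 1 (F := fun q n => (n.factorial : ℝ≥0∞)⁻¹ *
    tupleIntegral μ n (splitSum (fun s => zt s Y₁) (branchingWeight ν p zt q) []))
    (fun q => ?_) (fun q M hq => ?_) (fun q => ?_)
  -- The root cloud without any star contributes exactly 1.
  · simp [splitSum, splits, branchingWeight_nil]
  · gcongr
    refine lintegral_mono_ae ?_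
    filter_upwards [(pi_absolutelyContinuous hac (M + 2)).ae_le (hcomp (M + 2)),
      (pi_absolutelyContinuous hac (M + 2)).ae_le (hdom' (M + 2)),
      (pi_absolutelyContinuous hac (M + 2)).ae_le (hY₁ (M + 2))] with x hc hd hcY
    exact tsum_ursellStar_cons_le ν hsymm hf
      (G := S ∩ {Y | Compatible f ζt x Y})
      (hSm.inter (measurable_prodMk_left (measurableSet_compatible hfm hζt)))
      (hS.and hc) (fun Y hY => hY.2) (fun i j => (hd i).1 _)
      (fun Y hY s => (hd s).2 Y hY.1) (fun s => hztm.comp measurable_prodMk_left)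
      (fun s => (measurable_zeta hfm).comp measurable_prodMk_left) (by omega) ⟨hY₁S, hcY⟩
  · refine (listIntegral_splitSum_le μ (c := 1) (hztm.comp measurable_prodMk_right) hA
      (listMeasurable_branchingWeight ν hpm hztm q) (fun J => ?_) []).trans ?_
    · rw [one_mul]
      exact listIntegral_branchingWeight_le μ ν hpm hztm hA hBm hB hA' q J
    · simpa using hB Y₁

end Bounds

/-! ### Cutoff of the kernels to good sets, and the main theorem -/

section Cutoff

open Classical in
/-- The absolute value of a kernel, set to zero outside of `S ×ˢ T`. -/
def cutoffKernel {α β : Type*} (S : Set α) (T : Set β) (g : α → β → ℝ) (x : α) (y : β) : ℝ≥0∞ :=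
  if x ∈ S ∧ y ∈ T then ‖g x y‖ₑ else 0

variable {α β : Type*} {S : Set α} {T : Set β} {g : α → β → ℝ}

theorem measurable_cutoffKernel [MeasurableSpace α] [MeasurableSpace β] (hS : MeasurableSet S)
    (hT : MeasurableSet T) (hg : Measurable (Function.uncurry g)) :
    Measurable (Function.uncurry (cutoffKernel S T g)) :=
  Measurable.ite (hS.prod hT) hg.enorm measurable_const

theorem cutoffKernel_of_mem {x : α} {y : β} (hx : x ∈ S) (hy : y ∈ T) :
    cutoffKernel S T g x y = ‖g x y‖ₑ := if_pos ⟨hx, hy⟩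

theorem cutoffKernel_of_left_notMem {x : α} (hx : x ∉ S) (y : β) :
    cutoffKernel S T g x y = 0 := if_neg fun h => hx h.1

theorem cutoffKernel_of_right_notMem (x : α) {y : β} (hy : y ∉ T) :
    cutoffKernel S T g x y = 0 := if_neg fun h => hy h.2

theorem cutoffKernel_mul_ofReal_le (x : α) (y : β) (r : ℝ) :
    cutoffKernel S T g x y * ENNReal.ofReal r ≤ ENNReal.ofReal (|g x y| * r) := by
  rw [ENNReal.ofReal_mul (abs_nonneg _), ← Real.enorm_eq_ofReal_abs]
  gcongr
  unfold cutoffKernel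
  split_ifs
  exacts [le_rfl, zero_le]

end Cutoff

theorem exists_measurableSet_of_ae {α : Type*} [MeasurableSpace α] {μ : Measure α} {P : α → Prop}
    (h : ∀ᵐ x ∂μ, P x) : ∃ S, MeasurableSet S ∧ (∀ᵐ x ∂μ, x ∈ S) ∧ ∀ x ∈ S, P x := by
  refine ⟨(toMeasurable μ {x | ¬ P x})ᶜ, (measurableSet_toMeasurable _ _).compl, ?_, ?_⟩
  · rw [ae_iff]
    simpa [measure_toMeasurable] using ae_iff.1 h
  · intro x hx
    by_contra hP
    exact hx (subset_toMeasurable _ _ hP)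

end BinaryCluster

end

theorem theorem1 {X : Type*} [MeasurableSpace X]
    -- the large and the small objects
    (Xl Xs : Set X) (hXl : MeasurableSet Xl) (hXs : MeasurableSet Xs) (hX : IsCompl Xl Xs)
    -- the symmetric pair potential with values in `[0,∞]`
    (v : X → X → ℝ≥0∞) (hv : Measurable (Function.uncurry v)) (hsymm : ∀ x y, v x y = v y x)
    -- the complex activity measure `dμ = θ dm`, where `m = |μ|` is σ-finite and `|θ| = 1`
    (m : Measure X) [SigmaFinite m] (θ : X → ℂ) (hθ : Measurable θ) (hθ1 : ∀ x, ‖θ x‖ = 1)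
    (hsmall : BinaryCluster.SmallCondition (BinaryCluster.mayer v) m Xl Xs)
    -- the reduced function
    (ζt : Xl → BinaryCluster.Cloud Xs → ℝ) (hζt : Measurable (Function.uncurry ζt))
    (hred : BinaryCluster.ReducedZeta (BinaryCluster.mayer v) m ζt)
    (a : Xl → ℝ) (ha : Measurable a) (ha0 : ∀ x, 0 ≤ a x)
    (b : BinaryCluster.Cloud Xs → ℝ) (hb : Measurable b) (hb0 : ∀ Y, 0 ≤ b Y)
    (hsuff1 : ∀ᵐ x ∂(BinaryCluster.onSubset m Xl),
      ∫⁻ Y, ENNReal.ofReal (|ζt x Y| * Real.exp (b Y))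
          ∂(BinaryCluster.cloudVariation (BinaryCluster.mayer v) m Xs) +
        ∫⁻ x' : Xl, ENNReal.ofReal (|BinaryCluster.mayer v x x'| * Real.exp (a x'))
          ∂(BinaryCluster.effVariation (BinaryCluster.mayer v) m θ Xl Xs)
        ≤ ENNReal.ofReal (a x))
    (hsuff2 : ∀ᵐ Y ∂(BinaryCluster.cloudVariation (BinaryCluster.mayer v) m Xs),
      ∫⁻ x' : Xl, ENNReal.ofReal (|ζt x' Y| * Real.exp (a x'))
          ∂(BinaryCluster.effVariation (BinaryCluster.mayer v) m θ Xl Xs)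
        ≤ ENNReal.ofReal (b Y)) :
    -- rooted at a large object: `m = M + 2 ≥ 2` large objects, `r = R ≥ 0` clouds
    (∀ᵐ x₁ ∂(BinaryCluster.onSubset m Xl),
      ∑' M : ℕ, ((M + 1).factorial : ℝ≥0∞)⁻¹ *
        ∫⁻ x : Fin (M + 1) → Xl,
          (∑' R : ℕ, (R.factorial : ℝ≥0∞)⁻¹ *
            ∫⁻ Y : Fin R → BinaryCluster.Cloud Xs,
              ‖BinaryCluster.ursellStar (BinaryCluster.mayer v)
                (Fin.cons x₁ x : Fin (M + 2) → Xl) Y‖ₑ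
              ∂(Measure.pi fun _ =>
                BinaryCluster.cloudVariation (BinaryCluster.mayer v) m Xs))
          ∂(Measure.pi fun _ => BinaryCluster.effVariation (BinaryCluster.mayer v) m θ Xl Xs)
        ≤ ENNReal.ofReal (Real.exp (a x₁) - 1)) ∧
    -- rooted at a cloud: `m = M + 2 ≥ 2` large objects, `r = R + 1 ≥ 1` clouds
    (∀ᵐ Y₁ ∂(BinaryCluster.cloudVariation (BinaryCluster.mayer v) m Xs),
      ∑' M : ℕ, ((M + 2).factorial : ℝ≥0∞)⁻¹ *
        ∫⁻ x : Fin (M + 2) → Xl,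
          (∑' R : ℕ, (R.factorial : ℝ≥0∞)⁻¹ *
            ∫⁻ Y : Fin R → BinaryCluster.Cloud Xs,
              ‖BinaryCluster.ursellStar (BinaryCluster.mayer v)
                x (Fin.cons Y₁ Y : Fin (R + 1) → BinaryCluster.Cloud Xs)‖ₑ
              ∂(Measure.pi fun _ =>
                BinaryCluster.cloudVariation (BinaryCluster.mayer v) m Xs))
          ∂(Measure.pi fun _ => BinaryCluster.effVariation (BinaryCluster.mayer v) m θ Xl Xs)
        ≤ ENNReal.ofReal (Real.exp (b Y₁) - 1)) := by
  have hlam := BinaryCluster.sigmaFinite_onSubset m hXl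
  have hμ := BinaryCluster.sigmaFinite_effVariation (BinaryCluster.mayer v) m θ Xs hXl
  have hν := BinaryCluster.sigmaFinite_cloudVariation (BinaryCluster.mayer v) m hXs
  have hac : BinaryCluster.effVariation (BinaryCluster.mayer v) m θ Xl Xs ≪ BinaryCluster.onSubset m Xl :=
    withDensity_absolutelyContinuous _ _
  have hfm := BinaryCluster.measurable_mayer hv
  obtain ⟨S, hSm, hS, hS'⟩ := BinaryCluster.exists_measurableSet_of_ae hsuff1
  obtain ⟨T, hTm, hT, hT'⟩ := BinaryCluster.exists_measurableSet_of_ae hsuff2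
  -- The kernel `|f|` is cut off only in its first argument, because hypothesis 3 restricts only
  -- `x`.
  have hpm : Measurable (Function.uncurry (BinaryCluster.cutoffKernel S Set.univ fun x x' : Xl => BinaryCluster.mayer v x x')) :=
    BinaryCluster.measurable_cutoffKernel hSm MeasurableSet.univ
      (hfm.comp (measurable_subtype_coe.prodMap measurable_subtype_coe))
  have hztm := BinaryCluster.measurable_cutoffKernel hSm hTm hζt
  have hdom : ∀ᵐ x : Xl ∂(BinaryCluster.onSubset m Xl),
      (∀ x' : Xl, ‖BinaryCluster.mayer v x x'‖ₑ ≤ BinaryCluster.cutoffKernel S Set.univ (fun x x' : Xl => BinaryCluster.mayer v x x') x x') ∧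
      ∀ Y ∈ T, ‖ζt x Y‖ₑ ≤ BinaryCluster.cutoffKernel S T ζt x Y := by
    filter_upwards [hS] with x hx
    exact ⟨fun x' => (BinaryCluster.cutoffKernel_of_mem hx (Set.mem_univ _)).ge,
      fun Y hY => (BinaryCluster.cutoffKernel_of_mem hx hY).ge⟩
  have hA : Measurable fun x => ENNReal.ofReal (Real.exp (a x)) :=
    (Real.measurable_exp.comp ha).ennreal_ofReal
  have hB : Measurable fun Y => ENNReal.ofReal (Real.exp (b Y)) :=
    (Real.measurable_exp.comp hb).ennreal_ofReal
  have one_le : ∀ {r : ℝ}, 0 ≤ r → 1 ≤ ENNReal.ofReal (Real.exp r) := fun hr => by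
    rw [← ENNReal.ofReal_one]
    exact ENNReal.ofReal_le_ofReal (Real.one_le_exp hr)
  have hexp0 : BinaryCluster.expSeries 0 = 1 := by simpa using BinaryCluster.expSeries_ofReal le_rfl
  -- For `Y ∉ T` the kernel vanishes and the claim is `exp 0 ≤ e^b`, true since `b ≥ 0`. The case `x
  -- ∉ S` below is the same with `a`.
  have hB' : ∀ Y, BinaryCluster.expSeries (∫⁻ t, BinaryCluster.cutoffKernel S T ζt t Y * ENNReal.ofReal (Real.exp (a t))
      ∂(BinaryCluster.effVariation (BinaryCluster.mayer v) m θ Xl Xs)) ≤ ENNReal.ofReal (Real.exp (b Y)) := by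
    intro Y
    by_cases hY : Y ∈ T
    · rw [← BinaryCluster.expSeries_ofReal (hb0 Y)]
      exact BinaryCluster.expSeries_mono ((lintegral_mono fun t =>
        BinaryCluster.cutoffKernel_mul_ofReal_le t Y _).trans (hT' Y hY))
    · simp [BinaryCluster.cutoffKernel_of_right_notMem _ hY, hexp0, one_le (hb0 Y)]
  have hA' : ∀ x, BinaryCluster.expSeries (∫⁻ Y, BinaryCluster.cutoffKernel S T ζt x Y * ENNReal.ofReal (Real.exp (b Y))
        ∂(BinaryCluster.cloudVariation (BinaryCluster.mayer v) m Xs)) *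
      BinaryCluster.expSeries (∫⁻ t, BinaryCluster.cutoffKernel S Set.univ (fun x x' : Xl => BinaryCluster.mayer v x x') x t *
        ENNReal.ofReal (Real.exp (a t)) ∂(BinaryCluster.effVariation (BinaryCluster.mayer v) m θ Xl Xs)) ≤
      ENNReal.ofReal (Real.exp (a x)) := by
    intro x
    by_cases hx : x ∈ S
    · exact BinaryCluster.expSeries_mul_le (ha0 x) ((add_le_add
        (lintegral_mono fun Y => BinaryCluster.cutoffKernel_mul_ofReal_le x Y _)
        (lintegral_mono fun t => BinaryCluster.cutoffKernel_mul_ofReal_le x t _)).trans (hS' x hx))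
    · simp [BinaryCluster.cutoffKernel_of_left_notMem hx, hexp0, one_le (ha0 x)]
  have hsub : ∀ r : ℝ, ENNReal.ofReal (Real.exp r - 1) = ENNReal.ofReal (Real.exp r) - 1 :=
    fun r => by rw [ENNReal.ofReal_sub _ zero_le_one, ENNReal.ofReal_one]
  simp only [hsub]
  exact ⟨BinaryCluster.ae_star_tsum_le _ _ hac _ hfm (BinaryCluster.mayer_symm hsymm) (BinaryCluster.mayer_mem_Icc v) hζt
      (BinaryCluster.ReducedZeta.ae_compatible hXl hred) hpm hztm hTm hT hdom hA hB hB' hA',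
    BinaryCluster.ae_cloud_tsum_le _ _ hac _ hfm (BinaryCluster.mayer_symm hsymm) (BinaryCluster.mayer_mem_Icc v) hζt
      (BinaryCluster.ReducedZeta.ae_compatible hXl hred) hpm hztm hTm hT hdom hA hB hB' hA'⟩
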